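/- **Conventions.** Inner products are linear in the second variable and tensor products are Hilbert space tensor products. A standard subspace of a complex Hilbert space $\mathcal H$ is a closed real subspace $H$ with $H\cap iH=\{0\}$ and $\overline{H+iH}=\mathcal H$; $H'=\{x:\operatorname{Im}\langle h,x\rangle=0\ \forall h\in H\}$ is its symplectic complement, and its modular objects $J_H$ (an antiunitary involution) and $\Delta_H^{it}$ (a unitary one-parameter group) are given by the polar decomposition $S_H=J_H\Delta_H^{1/2}$ of $S_H:f+ig\mapsto f-ig$ ($f,g\in H$). A standard pair $(H,T)$ is a standard subspace together with a strongly continuous one-parameter unitary group $T(t)=e^{itP}$ with $T(t)H\subset H$ for $t\ge 0$, where $P$ is positive and $0$ is not an eigenvalue of $P$. For an operator $A$ on a twofold tensor product, $A_{ij}$ denotes $A$ acting on the $i$-th and $j$-th factors. $\mathcal S(H,T)$ is the set of unitaries $R$ on $\mathcal H\otimes\mathcal H$ with: $R_{21}=R^*$; $R_{12}R_{13}R_{23}=R_{23}R_{13}R_{12}$; $[R,T(t_1)\otimes T(t_2)]=0$ for all $t_1,t_2\in\mathbb R$; $[\Delta_H^{it}\otimes\Delta_H^{it},R]=0$ for all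 $t$ and $R(J_H\otimes J_H)=(J_H\otimes J_H)R^*$; and $\langle g'\otimes\eta,R(f\otimes\xi)\rangle=\langle f\otimes\eta,R^*(g'\otimes\xi)\rangle$ for all $f\in H$, $g'\in H'$, $\xi,\eta\in\mathcal H$. For standard pairs $(H_\pm,T_\pm)$ on $\mathcal H_\pm$ and $R^\pm\in\mathcal S(H_\pm,T_\pm)$, $\mathcal S(R^+,R^-)$ is the set of unitaries $S$ on $\mathcal H_+\otimes\mathcal H_-$ with: $[S,\Delta_{H_+}^{it}\otimes\Delta_{H_-}^{-it}]=0$ for all $t$; $[S,T_+(t_+)\otimes T_-(t_-)]=0$ for all $t_\pm$; $R^+_{12}S_{13}S_{23}=S_{23}S_{13}R^+_{12}$ on $\mathcal H_+\otimes\mathcal H_+\otimes\mathcal H_-$; $S_{12}S_{13}R^-_{23}=R^-_{23}S_{13}S_{12}$ on $\mathcal H_+\otimes\mathcal H_-\otimes\mathcal H_-$; $\langle g'\otimes\eta,S(f\otimes\xi)\rangle=\langle f\otimes\eta,S^*(g'\otimes\xi)\rangle$ for all $f\in H_+$, $g'\in H_+'$, $\xi,\eta\in\mathcal H_-$; and $\langle\eta\otimes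 g',S(\xi\otimes f)\rangle=\langle\eta\otimes f,S^*(\xi\otimes g')\rangle$ for all $f\in H_-$, $g'\in H_-'$, $\xi,\eta\in\mathcal H_+$. Let the standard pairs $(H_\pm,T_\pm)$ have finite multiplicities $n_\pm$ and be given in the following parametrization: $\mathcal H_\pm$ is identified with $L^2(\mathbb R,\mathbb C^{n_\pm})$ so that $(T_\pm(t)f)(q)=e^{ite^q}f(q)$, $(\Delta_{H_\pm}^{it}f)(q)=f(q-2\pi t)$ and $(J_{H_\pm}f)^\alpha(q)=\overline{f^{\bar\alpha}(q)}$, where $\alpha\mapsto\bar\alpha$ is an involution of the index set (one for each sign). Then $\mathcal H_\pm\otimes\mathcal H_\pm$ and $\mathcal H_+\otimes\mathcal H_-$ become spaces of square-integrable functions $f^{\alpha\beta}(q_1,q_2)$. **Proposition.** Let $R^\pm\in\mathcal S(H_\pm,T_\pm)$ and $S\in\mathcal S(R^+,R^-)$. There are measurable matrix-valued functions $\underline R^\pm$ and $\underline S$ on $\mathbb R$ such that $$(R^\pm f)^{\alpha\beta}(q_1,q_2)=\sum_{\gamma,\delta}(\underline R^{\pm})^{\alpha\beta}_{\gamma\delta}(q_1-q_2)f^{\gamma\delta}(q_1,q_2),\qquad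 (Sf)^{\alpha\beta}(q_1,q_2)=\sum_{\gamma,\delta}\underline S^{\alpha\beta}_{\gamma\delta}(q_1+q_2)f^{\gamma\delta}(q_1,q_2),$$ and the following hold. 1. Unitarity: $\underline S(q)^*=\underline S(q)^{-1}$ for almost all $q\in\mathbb R$. 2. Left mixed Yang–Baxter identity: for almost all $(q,q')\in\mathbb R^2$ and all indices, $$\sum_{\alpha'\beta'\gamma'}(\underline R^+)^{\alpha\beta}_{\alpha'\beta'}(q-q')\,\underline S^{\alpha'\gamma}_{\alpha''\gamma'}(q)\,\underline S^{\beta'\gamma'}_{\beta''\gamma''}(q')=\sum_{\alpha'\beta'\gamma'}\underline S^{\beta\gamma}_{\beta'\gamma'}(q')\,\underline S^{\alpha\gamma'}_{\alpha'\gamma''}(q)\,(\underline R^+)^{\alpha'\beta'}_{\alpha''\beta''}(q-q').$$ 3. Right mixed Yang–Baxter identity: for almost all $(q,q')\in\mathbb R^2$ and all indices, $$\sum_{\alpha'\beta'\gamma'}\underline S^{\alpha\beta}_{\alpha'\beta'}(q)\,\underline S^{\alpha'\gamma}_{\alpha''\gamma'}(q')\,(\underline R^-)^{\beta'\gamma'}_{\beta''\gamma''}(q-q')=\sum_{\alpha'\beta'\gamma'}(\underline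 R^-)^{\beta\gamma}_{\beta'\gamma'}(q-q')\,\underline S^{\alpha\gamma'}_{\alpha'\gamma''}(q')\,\underline S^{\alpha'\beta'}_{\alpha''\beta''}(q).$$ 4. Analyticity: there is a bounded analytic matrix-valued function on the strip $\mathbb R+i(0,\pi)$ with boundary value $\underline S(q)$ for almost all $q\in\mathbb R$ (limit as $\operatorname{Im}\downarrow 0$ along vertical lines), which also has a boundary value, denoted $\underline S(q+i\pi)$, for almost all $q$ on the upper edge (limit as $\operatorname{Im}\uparrow\pi$). 5. Mixed unitary-crossing relation: for almost all $q\in\mathbb R$ and all indices, $$\underline S^{\alpha\beta}_{\gamma\delta}(q+i\pi)=\overline{\underline S^{\bar\alpha\delta}_{\bar\gamma\beta}(q)}=\overline{\underline S^{\gamma\bar\beta}_{\alpha\bar\delta}(q)}.$$ -/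

import Mathlib

open MeasureTheory Filter Topology
open scoped TensorProduct InnerProductSpace ComplexConjugate

noncomputable section

namespace LRScattering

/-! ### Hilbert space tensor products and leg notation -/

/-- The Hilbert space tensor product: the completion of the algebraic tensor product for the
inner product `⟪a ⊗ b, c ⊗ d⟫ = ⟪a, c⟫ * ⟪b, d⟫`. -/
def HTensor (E F : Type*) [NormedAddCommGroup E] [InnerProductSpace ℂ E]
    [NormedAddCommGroup F] [InnerProductSpace ℂ F] : Type _ :=
  UniformSpace.Completion (E ⊗[ℂ] F)

section Tensor

variable {E F G E' F' : Type*}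
  [NormedAddCommGroup E] [InnerProductSpace ℂ E] [NormedAddCommGroup F] [InnerProductSpace ℂ F]
  [NormedAddCommGroup G] [InnerProductSpace ℂ G]
  [NormedAddCommGroup E'] [InnerProductSpace ℂ E'] [NormedAddCommGroup F'] [InnerProductSpace ℂ F']

instance : NormedAddCommGroup (HTensor E F) :=
  inferInstanceAs (NormedAddCommGroup (UniformSpace.Completion (E ⊗[ℂ] F)))

instance : InnerProductSpace ℂ (HTensor E F) :=
  inferInstanceAs (InnerProductSpace ℂ (UniformSpace.Completion (E ⊗[ℂ] F)))

instance : CompleteSpace (HTensor E F) :=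
  inferInstanceAs (CompleteSpace (UniformSpace.Completion (E ⊗[ℂ] F)))

/-- The embedding of the algebraic tensor product. -/
def toH (E F : Type*) [NormedAddCommGroup E] [InnerProductSpace ℂ E]
    [NormedAddCommGroup F] [InnerProductSpace ℂ F] : (E ⊗[ℂ] F) →ₗᵢ[ℂ] HTensor E F :=
  (UniformSpace.Completion.toComplₗᵢ : (E ⊗[ℂ] F) →ₗᵢ[ℂ] UniformSpace.Completion (E ⊗[ℂ] F))

lemma denseRange_toH : DenseRange (toH E F) :=
  UniformSpace.Completion.denseRange_coe

/-- The simple tensor `x ⊗ y` in the Hilbert space tensor product. -/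
def tpure (x : E) (y : F) : HTensor E F := toH E F (x ⊗ₜ[ℂ] y)

lemma inner_tpure (x x' : E) (y y' : F) :
    ⟪tpure x y, tpure x' y'⟫_ℂ = ⟪x, x'⟫_ℂ * ⟪y, y'⟫_ℂ := by
  rw [tpure, tpure, LinearIsometry.inner_map_map, TensorProduct.inner_tmul]

/-- The operator `A ⊗ B` on the Hilbert space tensor product. -/
def tmap (A : E →L[ℂ] E') (B : F →L[ℂ] F') : HTensor E F →L[ℂ] HTensor E' F' :=
  ((toH E' F').toLinearMap ∘ₗ
    TensorProduct.map (A : E →ₗ[ℂ] E') (B : F →ₗ[ℂ] F')).extendOfNorm (toH E F).toLinearMap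

lemma tmap_toH (A : E →L[ℂ] E') (B : F →L[ℂ] F') (x : E ⊗[ℂ] F) :
    tmap A B (toH E F x)
      = toH E' F' (TensorProduct.map (A : E →ₗ[ℂ] E') (B : F →ₗ[ℂ] F') x) := by
  refine LinearMap.extendOfNorm_eq (e := (toH E F).toLinearMap) denseRange_toH
    ⟨‖TensorProduct.mapL A B‖, fun x => ?_⟩ x
  simpa using (TensorProduct.mapL A B).le_opNorm x

@[simp] lemma tmap_tpure (A : E →L[ℂ] E') (B : F →L[ℂ] F') (x : E) (y : F) :
    tmap A B (tpure x y) = tpure (A x) (B y) :=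
  tmap_toH A B _

/-- The flip `x ⊗ y ↦ y ⊗ x`. -/
def flipH (E F : Type*) [NormedAddCommGroup E] [InnerProductSpace ℂ E]
    [NormedAddCommGroup F] [InnerProductSpace ℂ F] : HTensor E F ≃ₗᵢ[ℂ] HTensor F E :=
  (TensorProduct.comm ℂ E F).extendOfIsometry (toH E F).toLinearMap (toH F E).toLinearMap
    denseRange_toH denseRange_toH (fun x => by simp)

@[simp] lemma flipH_tpure (x : E) (y : F) : flipH E F (tpure x y) = tpure y x := by
  rw [flipH, LinearEquiv.extendOfIsometry_apply]
  exact LinearMap.extendOfNorm_eq (e := (toH E F).toLinearMap) denseRange_toH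
    ⟨1, fun x => by simp⟩ _

/-- Isometries with dense range have tensor products with dense range. -/
lemma denseRange_map (f : E →ₗᵢ[ℂ] E') (g : F →ₗᵢ[ℂ] F')
    (hf : DenseRange f) (hg : DenseRange g) :
    DenseRange (TensorProduct.mapIsometry f g) := by
  intro z
  induction z using TensorProduct.induction_on with
  | zero => exact subset_closure ⟨0, by simp⟩
  | tmul x y =>
    have h : (x, y) ∈ closure (Set.range (Prod.map f g)) := (hf.prodMap hg) (x, y)
    have hc : Continuous fun p : E' × F' => p.1 ⊗ₜ[ℂ] p.2 := TensorProduct.continuous_tmul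
    have := image_closure_subset_closure_image hc (Set.mem_image_of_mem _ h)
    refine closure_mono ?_ this
    rintro _ ⟨_, ⟨⟨a, b⟩, rfl⟩, rfl⟩
    exact ⟨a ⊗ₜ[ℂ] b, by simp⟩
  | add x y hx hy =>
    exact (TensorProduct.mapIsometry f g).toLinearMap.range.topologicalClosure.add_mem
      (x := x) (y := y) hx hy

/-- The algebraic threefold tensor product in the Hilbert space one, bracketed to the left. -/
def tripleLeft (E F G : Type*) [NormedAddCommGroup E] [InnerProductSpace ℂ E]
    [NormedAddCommGroup F] [InnerProductSpace ℂ F] [NormedAddCommGroup G] [InnerProductSpace ℂ G] :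
    ((E ⊗[ℂ] F) ⊗[ℂ] G) →ₗᵢ[ℂ] HTensor (HTensor E F) G :=
  (toH (HTensor E F) G).comp (TensorProduct.mapIsometry (toH E F) LinearIsometry.id)

/-- The algebraic threefold tensor product in the Hilbert space one, bracketed to the right. -/
def tripleRight (E F G : Type*) [NormedAddCommGroup E] [InnerProductSpace ℂ E]
    [NormedAddCommGroup F] [InnerProductSpace ℂ F] [NormedAddCommGroup G] [InnerProductSpace ℂ G] :
    (E ⊗[ℂ] (F ⊗[ℂ] G)) →ₗᵢ[ℂ] HTensor E (HTensor F G) :=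
  (toH E (HTensor F G)).comp (TensorProduct.mapIsometry LinearIsometry.id (toH F G))

lemma denseRange_tripleLeft : DenseRange (tripleLeft E F G) :=
  denseRange_toH.comp (denseRange_map _ _ denseRange_toH Function.surjective_id.denseRange)
    (toH _ _).continuous

lemma denseRange_tripleRight : DenseRange (tripleRight E F G) :=
  denseRange_toH.comp (denseRange_map _ _ Function.surjective_id.denseRange denseRange_toH)
    (toH _ _).continuous

lemma norm_triple (x : (E ⊗[ℂ] F) ⊗[ℂ] G) :
    ‖tripleRight E F G (TensorProduct.assoc ℂ E F G x)‖ = ‖tripleLeft E F G x‖ := by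
  rw [LinearIsometry.norm_map, LinearIsometry.norm_map, TensorProduct.norm_assoc]

/-- The associator `(x ⊗ y) ⊗ z ↦ x ⊗ (y ⊗ z)`. -/
def assoc (E F G : Type*) [NormedAddCommGroup E] [InnerProductSpace ℂ E]
    [NormedAddCommGroup F] [InnerProductSpace ℂ F] [NormedAddCommGroup G] [InnerProductSpace ℂ G] :
    HTensor (HTensor E F) G ≃ₗᵢ[ℂ] HTensor E (HTensor F G) :=
  (TensorProduct.assoc ℂ E F G).extendOfIsometry
    (tripleLeft E F G).toLinearMap (tripleRight E F G).toLinearMap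
    denseRange_tripleLeft denseRange_tripleRight norm_triple

@[simp] lemma assoc_tpure (x : E) (y : F) (z : G) :
    assoc E F G (tpure (tpure x y) z) = tpure x (tpure y z) := by
  rw [assoc, LinearEquiv.extendOfIsometry_apply]
  exact LinearMap.extendOfNorm_eq (e := (tripleLeft E F G).toLinearMap) denseRange_tripleLeft
    ⟨1, fun x => by simpa using (norm_triple x).le⟩ ((x ⊗ₜ[ℂ] y) ⊗ₜ[ℂ] z)

@[simp] lemma assoc_symm_tpure (x : E) (y : F) (z : G) :
    (assoc E F G).symm (tpure x (tpure y z)) = tpure (tpure x y) z := by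
  rw [LinearIsometryEquiv.symm_apply_eq, assoc_tpure]

/-- Exchange of the second and third tensor factor, `(x ⊗ y) ⊗ z ↦ (x ⊗ z) ⊗ y`. -/
def swap23 (E F G : Type*) [NormedAddCommGroup E] [InnerProductSpace ℂ E]
    [NormedAddCommGroup F] [InnerProductSpace ℂ F] [NormedAddCommGroup G] [InnerProductSpace ℂ G] :
    HTensor (HTensor E F) G →L[ℂ] HTensor (HTensor E G) F :=
  ((assoc E G F).symm : HTensor E (HTensor G F) →L[ℂ] HTensor (HTensor E G) F) ∘L
    tmap (ContinuousLinearMap.id ℂ E) (flipH F G : HTensor F G →L[ℂ] HTensor G F) ∘L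
    (assoc E F G : HTensor (HTensor E F) G →L[ℂ] HTensor E (HTensor F G))

@[simp] lemma swap23_tpure (x : E) (y : F) (z : G) :
    swap23 E F G (tpure (tpure x y) z) = tpure (tpure x z) y := by
  simp [swap23, assoc_tpure, LinearIsometryEquiv.symm_apply_eq]

/-- `A₁₂` on `E ⊗ F ⊗ G`. -/
def leg12 (G : Type*) [NormedAddCommGroup G] [InnerProductSpace ℂ G]
    (A : HTensor E F →L[ℂ] HTensor E F) :
    HTensor (HTensor E F) G →L[ℂ] HTensor (HTensor E F) G :=
  tmap A (ContinuousLinearMap.id ℂ G)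

/-- `A₂₃` on `E ⊗ F ⊗ G`. -/
def leg23 (E : Type*) [NormedAddCommGroup E] [InnerProductSpace ℂ E]
    (A : HTensor F G →L[ℂ] HTensor F G) :
    HTensor (HTensor E F) G →L[ℂ] HTensor (HTensor E F) G :=
  ((assoc E F G).symm : HTensor E (HTensor F G) →L[ℂ] HTensor (HTensor E F) G) ∘L
    tmap (ContinuousLinearMap.id ℂ E) A ∘L
    (assoc E F G : HTensor (HTensor E F) G →L[ℂ] HTensor E (HTensor F G))

/-- `A₁₃` on `E ⊗ F ⊗ G`. -/
def leg13 (F : Type*) [NormedAddCommGroup F] [InnerProductSpace ℂ F]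
    (A : HTensor E G →L[ℂ] HTensor E G) :
    HTensor (HTensor E F) G →L[ℂ] HTensor (HTensor E F) G :=
  swap23 E G F ∘L leg12 F A ∘L swap23 E F G

lemma inner_map_antiunitary (J : E ≃ₗᵢ⋆[ℂ] E) (x y : E ⊗[ℂ] E)
    (hJ : ∀ a b : E, ⟪J a, J b⟫_ℂ = ⟪b, a⟫_ℂ) :
    ⟪TensorProduct.map (J : E →ₛₗ[starRingEnd ℂ] E) (J : E →ₛₗ[starRingEnd ℂ] E) x,
      TensorProduct.map (J : E →ₛₗ[starRingEnd ℂ] E) (J : E →ₛₗ[starRingEnd ℂ] E) y⟫_ℂ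
      = ⟪y, x⟫_ℂ := by
  induction x using TensorProduct.induction_on with
  | zero => simp
  | add x x' hx hx' => simp [inner_add_left, inner_add_right, hx, hx']
  | tmul a b =>
    induction y using TensorProduct.induction_on with
    | zero => simp
    | add y y' hy hy' => rw [map_add, inner_add_right, inner_add_left, hy, hy']
    | tmul c d => simp [hJ]

/-- A conjugate linear isometry is antiunitary. -/
lemma inner_antiunitary (J : E ≃ₗᵢ⋆[ℂ] E) (a b : E) : ⟪J a, J b⟫_ℂ = ⟪b, a⟫_ℂ := by
  have key : ∀ a b : E, RCLike.re ⟪J a, J b⟫_ℂ = RCLike.re ⟪b, a⟫_ℂ := by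
    intro a b
    have h1 := norm_add_sq (𝕜 := ℂ) (J a) (J b)
    have h2 := norm_add_sq (𝕜 := ℂ) b a
    rw [← map_add, J.norm_map, J.norm_map, J.norm_map, add_comm a b] at h1
    linarith
  apply Complex.ext
  · simpa using key a b
  · have h := key (Complex.I • a) b
    rw [LinearIsometryEquiv.map_smulₛₗ] at h
    simp only [inner_smul_left, inner_smul_right, Complex.conj_I] at h
    simpa using h

/-- The antiunitary operator `J ⊗ J`. -/
def antiTensor (J : E ≃ₗᵢ⋆[ℂ] E) : HTensor E E →L⋆[ℂ] HTensor E E :=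
  ((toH E E).toLinearMap ∘ₛₗ
    TensorProduct.map (J : E →ₛₗ[starRingEnd ℂ] E) (J : E →ₛₗ[starRingEnd ℂ] E)).extendOfNorm
    (toH E E).toLinearMap

@[simp] lemma antiTensor_tpure (J : E ≃ₗᵢ⋆[ℂ] E) (x y : E) :
    antiTensor J (tpure x y) = tpure (J x) (J y) := by
  refine LinearMap.extendOfNorm_eq (e := (toH E E).toLinearMap) denseRange_toH
    ⟨1, fun x => ?_⟩ (x ⊗ₜ[ℂ] y)
  have h := congrArg Complex.re (inner_map_antiunitary J x x (inner_antiunitary J))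
  have h1 := norm_sq_eq_re_inner (𝕜 := ℂ)
    (TensorProduct.map (J : E →ₛₗ[starRingEnd ℂ] E) (J : E →ₛₗ[starRingEnd ℂ] E) x)
  have h2 := norm_sq_eq_re_inner (𝕜 := ℂ) x
  have h3 := (sq_eq_sq₀ (norm_nonneg _) (norm_nonneg _)).mp ((h1.trans h).trans h2.symm)
  simpa using h3.le

end Tensor

/-! ### Standard pairs and modular objects -/

section StandardPairs

variable {𝓗 : Type*} [NormedAddCommGroup 𝓗] [InnerProductSpace ℂ 𝓗] [CompleteSpace 𝓗]

/-- `U` is a strongly continuous one-parameter group of unitary operators. -/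
structure IsUnitaryGroup (U : ℝ → 𝓗 →L[ℂ] 𝓗) : Prop where
  unitary : ∀ t, U t ∈ unitary (𝓗 →L[ℂ] 𝓗)
  map_add : ∀ s t, U (s + t) = U s * U t
  continuous : ∀ x, Continuous fun t => U t x

/-- `x` is in the domain of the self-adjoint generator `P` of `U(t) = exp(itP)` and `P x = y`. -/
def IsGeneratorValue (U : ℝ → 𝓗 →L[ℂ] 𝓗) (x y : 𝓗) : Prop :=
  HasDerivAt (fun t : ℝ => U t x) (Complex.I • y) 0

/-- A (non-degenerate) standard pair `(H, T)`: a standard subspace `H` and a one-parameter unitary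
group `T(t) = exp(itP)` with `T(t) H ⊆ H` for `t ≥ 0`, such that `P` is positive and `0` is not in
the point spectrum of `P`. -/
structure StandardPair (𝓗 : Type*) [NormedAddCommGroup 𝓗] [InnerProductSpace ℂ 𝓗]
    [CompleteSpace 𝓗] where
  H : StandardSubspace 𝓗
  T : ℝ → 𝓗 →L[ℂ] 𝓗
  unitaryGroup : IsUnitaryGroup T
  mapsTo : ∀ t, 0 ≤ t → ∀ x ∈ H.toClosedSubmodule, T t x ∈ H.toClosedSubmodule
  positive : ∀ x y, IsGeneratorValue T x y → 0 ≤ (⟪x, y⟫_ℂ).re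
  nondegenerate : ∀ x, IsGeneratorValue T x 0 → x = 0

/-- The graph of the Tomita operator `S_H : f + ig ↦ f - ig`, `f, g ∈ H`. -/
def tomitaGraph (H : StandardSubspace 𝓗) : Set (𝓗 × 𝓗) :=
  {p | ∃ f ∈ H.toClosedSubmodule, ∃ g ∈ H.toClosedSubmodule,
    p = (f + Complex.I • g, f - Complex.I • g)}

/-- The graph of `Δ^{1/2}`, for a one-parameter unitary group `U(t) = Δ^{it}`: the vector `x` is in
the domain of `Δ^{1/2}` iff its orbit `t ↦ Δ^{it} x` extends continuously to the strip
`-1/2 ≤ Im z ≤ 0`, analytically in the interior, and `Δ^{1/2} x` is the value at `z = -i/2`. -/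
def sqrtGraph (U : ℝ → 𝓗 →L[ℂ] 𝓗) : Set (𝓗 × 𝓗) :=
  {p | ∃ F : ℂ → 𝓗, ContinuousOn F {z | -(1 / 2) ≤ z.im ∧ z.im ≤ 0} ∧
    DifferentiableOn ℂ F {z | -(1 / 2) < z.im ∧ z.im < 0} ∧
    (∀ t : ℝ, F t = U t p.1) ∧ F (-(Complex.I / 2)) = p.2}

/-- `J` and `U(t) = Δ^{it}` are the modular conjugation and the modular unitary group of the
standard subspace `H`: the polar decomposition of the Tomita operator is `S_H = J Δ^{1/2}`, with an
antiunitary involution `J`. (Such `J` and `U` exist and are unique, for every standard subspace.) -/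
structure IsModular (H : StandardSubspace 𝓗) (J : 𝓗 ≃ₗᵢ⋆[ℂ] 𝓗) (U : ℝ → 𝓗 →L[ℂ] 𝓗) :
    Prop where
  involutive : ∀ x, J (J x) = x
  unitaryGroup : IsUnitaryGroup U
  polar : tomitaGraph H = {p | ∃ y, (p.1, y) ∈ sqrtGraph U ∧ p.2 = J y}

end StandardPairs

/-! ### Scattering operators -/

section Scattering

variable {𝓗 𝓗₁ 𝓗₂ : Type*} [NormedAddCommGroup 𝓗] [InnerProductSpace ℂ 𝓗] [CompleteSpace 𝓗]
  [NormedAddCommGroup 𝓗₁] [InnerProductSpace ℂ 𝓗₁] [CompleteSpace 𝓗₁]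
  [NormedAddCommGroup 𝓗₂] [InnerProductSpace ℂ 𝓗₂] [CompleteSpace 𝓗₂]

/-- The set `𝒮(H, T)` of two-particle scattering operators of a standard pair. -/
structure IsScattering (P : StandardPair 𝓗) (R : HTensor 𝓗 𝓗 →L[ℂ] HTensor 𝓗 𝓗) : Prop where
  unitary : R ∈ unitary (HTensor 𝓗 𝓗 →L[ℂ] HTensor 𝓗 𝓗)
  reflection : ∀ Φ, flipH 𝓗 𝓗 (R (flipH 𝓗 𝓗 Φ)) = star R Φ
  yangBaxter : leg12 𝓗 R * leg13 𝓗 R * leg23 𝓗 R = leg23 𝓗 R * leg13 𝓗 R * leg12 𝓗 R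
  translation : ∀ t₁ t₂, Commute R (tmap (P.T t₁) (P.T t₂))
  dilation : ∀ J U, IsModular P.H J U → ∀ t, Commute (tmap (U t) (U t)) R
  tcp : ∀ J U, IsModular P.H J U → ∀ Φ, R (antiTensor J Φ) = antiTensor J (star R Φ)
  locality : ∀ f ∈ P.H.toClosedSubmodule, ∀ g' ∈ P.H.symplComp.toClosedSubmodule, ∀ ξ η : 𝓗,
    ⟪tpure g' η, R (tpure f ξ)⟫_ℂ = ⟪tpure f η, star R (tpure g' ξ)⟫_ℂ

/-- The set `𝒮(R⁺, R⁻)` of left-right scattering operators; `P₁`, `R₁` stand for `(H₊, T₊)`, `R⁺`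
and `P₂`, `R₂` for `(H₋, T₋)`, `R⁻`. -/
structure IsLRScattering (P₁ : StandardPair 𝓗₁) (P₂ : StandardPair 𝓗₂)
    (R₁ : HTensor 𝓗₁ 𝓗₁ →L[ℂ] HTensor 𝓗₁ 𝓗₁) (R₂ : HTensor 𝓗₂ 𝓗₂ →L[ℂ] HTensor 𝓗₂ 𝓗₂)
    (S : HTensor 𝓗₁ 𝓗₂ →L[ℂ] HTensor 𝓗₁ 𝓗₂) : Prop where
  unitary : S ∈ unitary (HTensor 𝓗₁ 𝓗₂ →L[ℂ] HTensor 𝓗₁ 𝓗₂)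
  boost : ∀ J₁ U₁ J₂ U₂, IsModular P₁.H J₁ U₁ → IsModular P₂.H J₂ U₂ →
    ∀ t, Commute S (tmap (U₁ t) (U₂ (-t)))
  translation : ∀ t₁ t₂, Commute S (tmap (P₁.T t₁) (P₂.T t₂))
  leftYangBaxter : leg12 𝓗₂ R₁ * leg13 𝓗₁ S * leg23 𝓗₁ S
    = leg23 𝓗₁ S * leg13 𝓗₁ S * leg12 𝓗₂ R₁
  rightYangBaxter : leg12 𝓗₂ S * leg13 𝓗₂ S * leg23 𝓗₁ R₂
    = leg23 𝓗₁ R₂ * leg13 𝓗₂ S * leg12 𝓗₂ S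
  leftLocality : ∀ f ∈ P₁.H.toClosedSubmodule, ∀ g' ∈ P₁.H.symplComp.toClosedSubmodule,
    ∀ ξ η : 𝓗₂, ⟪tpure g' η, S (tpure f ξ)⟫_ℂ = ⟪tpure f η, star S (tpure g' ξ)⟫_ℂ
  rightLocality : ∀ f ∈ P₂.H.toClosedSubmodule, ∀ g' ∈ P₂.H.symplComp.toClosedSubmodule,
    ∀ ξ η : 𝓗₁, ⟪tpure η g', S (tpure ξ f)⟫_ℂ = ⟪tpure η f, star S (tpure ξ g')⟫_ℂ

end Scattering

/-! ### The parametrization of standard pairs of finite multiplicity -/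

section Parametrization

variable {𝓗 𝓗₁ 𝓗₂ : Type*} [NormedAddCommGroup 𝓗] [InnerProductSpace ℂ 𝓗] [CompleteSpace 𝓗]
  [NormedAddCommGroup 𝓗₁] [InnerProductSpace ℂ 𝓗₁] [CompleteSpace 𝓗₁]
  [NormedAddCommGroup 𝓗₂] [InnerProductSpace ℂ 𝓗₂] [CompleteSpace 𝓗₂]

/-- `L²(X, ℂⁿ)`, with components indexed by `ι`. -/
abbrev L2 (X : Type*) [MeasureSpace X] (ι : Type*) [Fintype ι] : Type _ :=
  Lp (EuclideanSpace ℂ ι) 2 (volume : Measure X)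

/-- The identification of a standard pair of multiplicity `n = #ι` with the `n`-fold multiple of the
irreducible one, in the Schrödinger representation on `L²(ℝ, ℂⁿ)`: the translations are
`(T(t)f)(q) = exp(i t e^q) f(q)`, i.e. `Q = ln P` is multiplication by `q`, the modular group is
`(Δ^{it} f)(q) = f(q - 2πt)`, and the modular conjugation is the complex conjugation twisted by an
involution `α ↦ ᾱ` of the index set, `(J f)^α(q) = conj (f^{ᾱ}(q))`. -/
structure Parametrization (P : StandardPair 𝓗) (ι : Type*) [Fintype ι] where
  V : 𝓗 ≃ₗᵢ[ℂ] L2 ℝ ι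
  bar : ι → ι
  bar_bar : ∀ α, bar (bar α) = α
  J : 𝓗 ≃ₗᵢ⋆[ℂ] 𝓗
  U : ℝ → 𝓗 →L[ℂ] 𝓗
  isModular : IsModular P.H J U
  translation : ∀ t x, ∀ᵐ q : ℝ, ∀ α,
    V (P.T t x) q α = Complex.exp (Complex.I * t * Real.exp q) * V x q α
  modularGroup : ∀ t x, ∀ᵐ q : ℝ, ∀ α, V (U t x) q α = V x (q - 2 * Real.pi * t) α
  conjugation : ∀ x, ∀ᵐ q : ℝ, ∀ α, V (J x) q α = conj (V x q (bar α))

/-- In the parametrizations of two standard pairs, the operator `A` on the tensor product is the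
multiplication by the (measurable) matrix-valued function `M`, composed with `s`:
`(A f)^{αβ}(q₁, q₂) = ∑ M^{αβ}_{γδ}(s(q₁, q₂)) f^{γδ}(q₁, q₂)`. Upper indices are the row, lower
indices the column. The unitary `W` is the canonical identification of the tensor product with
`L²(ℝ², ℂⁿ ⊗ ℂᵐ)`. -/
def IsMultiplication {ι κ : Type*} [Fintype ι] [Fintype κ]
    {P₁ : StandardPair 𝓗₁} {P₂ : StandardPair 𝓗₂}
    (X₁ : Parametrization P₁ ι) (X₂ : Parametrization P₂ κ) (s : ℝ × ℝ → ℝ)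
    (A : HTensor 𝓗₁ 𝓗₂ →L[ℂ] HTensor 𝓗₁ 𝓗₂) (M : ℝ → Matrix (ι × κ) (ι × κ) ℂ) : Prop :=
  (∀ a b, Measurable fun q => M q a b) ∧
  ∃ W : HTensor 𝓗₁ 𝓗₂ ≃ₗᵢ[ℂ] L2 (ℝ × ℝ) (ι × κ),
    (∀ x y, ∀ᵐ q : ℝ × ℝ, ∀ α β, W (tpure x y) q (α, β) = X₁.V x q.1 α * X₂.V y q.2 β) ∧
    ∀ Φ, ∀ᵐ q : ℝ × ℝ, ∀ a, W (A Φ) q a = ∑ b, M (s q) a b * W Φ q b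

/-- The strip `ℝ + i(0, π)`. -/
def strip : Set ℂ := {z | 0 < z.im ∧ z.im < Real.pi}

/-- `M` and `N` are, almost everywhere, the boundary values at `ℝ` and at `ℝ + iπ` of a bounded
analytic matrix-valued function on the strip `ℝ + i(0, π)`; i.e. `M` is the boundary value of a
bounded analytic function and `N(q)` is what is written `M(q + iπ)`. -/
def IsStripBoundaryValue {m : Type*} (M N : ℝ → Matrix m m ℂ) : Prop :=
  ∃ F : ℂ → Matrix m m ℂ,
    (∀ a b, DifferentiableOn ℂ (fun z => F z a b) strip) ∧
    (∃ C : ℝ, ∀ z ∈ strip, ∀ a b, ‖F z a b‖ ≤ C) ∧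
    (∀ᵐ q : ℝ, ∀ a b,
      Tendsto (fun y : ℝ => F (q + y * Complex.I) a b) (𝓝[>] 0) (𝓝 (M q a b))) ∧
    (∀ᵐ q : ℝ, ∀ a b,
      Tendsto (fun y : ℝ => F (q + y * Complex.I) a b) (𝓝[<] Real.pi) (𝓝 (N q a b)))

end Parametrization

end LRScattering

end

open LRScattering

/-! The tensor product of the two spaces is realized as `L²(ℝ², ℂⁿ ⊗ ℂᵐ)` (`tensorL2`). The
translations `T(t₁) ⊗ T(t₂)` act there as multiplication by `exp(i t₁ e^{q₁} + i t₂ e^{q₂})`. By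
uniqueness of Fourier transforms, the translates of the Gaussian vectors are total, so an operator
commuting with all translations is determined by its values on finitely many Gaussians and is
multiplication by a matrix function of `(q₁, q₂)` (`exists_symbol`). Commutation with the modular
groups makes this function invariant along the lines `q₁ + ε q₂ = const`. Hence it depends only on
the sum for `S` and only on the difference for `R⁺` and `R⁻` (`exists_symbol_sum`). Operator
identities then become pointwise identities of symbols (`matrix_ae_ext`). This gives unitarity, and
also the Yang–Baxter identities after a linear change of variables.

Analyticity and crossing come from testing locality on Gaussians `exp(-a (q - w)²) c` with `c` fixed
by the conjugation of `ℂⁿ`. The modular group moves the center `w` along the real axis and `J`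
reflects it. So the Gaussian with center `iπ/2` lies in `H` and the one with center `-iπ/2` lies in
`H'` (`gaussVec_mem`, `gaussVec_mem_symplComp`). With these vectors locality compares the Gaussian
convolution of an entry `m` of the symbol at height `π/2` with that of a conjugated entry `n` at
height `-π/2`. Both convolutions are entire functions of the center, so the identity theorem gives
the regularized crossing relation `CrossingPair m n`, valid for every width.

It remains to remove the regularization. By Phragmén–Lindelöf the normalized convolutions are
bounded on the closed strip by the bound of `m` and `n`, uniformly in the width. On the two edges
they converge almost everywhere to `m` and `n`. The Cauchy formula for the strip (`strip_cauchy`)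
carries this convergence into the interior, and the limit `stripExtension` is bounded and analytic.
Its boundary values are obtained as in Fatou's theorem: on the lower edge the kernel is a Poisson
kernel and the other edge contributes nothing in the limit. The upper edge reduces to the lower one
by the rotation `z ↦ iπ - z`. Left and right locality give two crossing pairs with the same `m`.
Since `m` determines its partner (`CrossingPair.ae_unique`), the two crossing formulas agree. -/

set_option linter.unusedSectionVars false

noncomputable section

namespace LRScattering

/-! ### The tensor product of `L²`-spaces -/

section VectorL2

variable {X Y ι κ : Type*} [MeasureSpace X] [MeasureSpace Y] [Fintype ι] [Fintype κ]

/-- The pointwise tensor product of vector-valued functions. -/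
def prodFun (f : X → EuclideanSpace ℂ ι) (g : Y → EuclideanSpace ℂ κ) :
    X × Y → EuclideanSpace ℂ (ι × κ) :=
  fun q => WithLp.toLp 2 fun a => f q.1 a.1 * g q.2 a.2

lemma norm_prodFun (f : X → EuclideanSpace ℂ ι) (g : Y → EuclideanSpace ℂ κ) (q : X × Y) :
    ‖prodFun f g q‖ = ‖f q.1‖ * ‖g q.2‖ := by
  rw [EuclideanSpace.norm_eq, EuclideanSpace.norm_eq, EuclideanSpace.norm_eq,
    ← Real.sqrt_mul (by positivity), Finset.sum_mul_sum, ← Finset.univ_product_univ,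
    Finset.sum_product]
  simp [prodFun, mul_pow]

lemma aestronglyMeasurable_euclidean {f : X → EuclideanSpace ℂ ι} :
    AEStronglyMeasurable f volume ↔ ∀ a, AEStronglyMeasurable (fun q => f q a) volume := by
  refine ⟨fun h a => (EuclideanSpace.proj (𝕜 := ℂ) a).continuous.comp_aestronglyMeasurable h,
    fun h => ?_⟩
  have : AEMeasurable (fun q => WithLp.toLp 2 (fun a => f q a) : X → EuclideanSpace ℂ ι)
      volume :=
    (WithLp.measurable_toLp 2 (ι → ℂ)).comp_aemeasurable
      (aemeasurable_pi_lambda _ fun a => (h a).aemeasurable)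
  exact this.aestronglyMeasurable

lemma ae_fst [SFinite (volume : Measure Y)] {p : X → Prop} (h : ∀ᵐ x, p x) : ∀ᵐ q : X × Y, p q.1 :=
  Measure.quasiMeasurePreserving_fst.ae h

lemma ae_snd [SFinite (volume : Measure X)] [SFinite (volume : Measure Y)] {p : Y → Prop}
    (h : ∀ᵐ y, p y) : ∀ᵐ q : X × Y, p q.2 :=
  Measure.quasiMeasurePreserving_snd.ae h

lemma L2_add_ae (f g : L2 X ι) : ∀ᵐ q, ∀ a, (f + g) q a = f q a + g q a := by
  filter_upwards [Lp.coeFn_add f g] with q h a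
  rw [h]; rfl

lemma L2_smul_ae (c : ℂ) (f : L2 X ι) : ∀ᵐ q, ∀ a, (c • f) q a = c * f q a := by
  filter_upwards [Lp.coeFn_smul c f] with q h a
  rw [h]; rfl

lemma L2_ext {f g : L2 X ι} (h : ∀ᵐ q, ∀ a, f q a = g q a) : f = g := by
  refine Lp.ext ?_
  filter_upwards [h] with q hq
  ext a; exact hq a

/-- The vector-valued function `1_s e_a` in `L²`. -/
def indL2 [DecidableEq ι] {s : Set X} (hs : MeasurableSet s) (h : volume s < ⊤) (a : ι) : L2 X ι :=
  indicatorConstLp 2 hs h.ne (EuclideanSpace.single a (1 : ℂ))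

lemma indL2_ae [DecidableEq ι] {s : Set X} (hs : MeasurableSet s) (h : volume s < ⊤) (a : ι) :
    ∀ᵐ q, ∀ b, indL2 hs h a q b = if b = a then s.indicator 1 q else 0 := by
  filter_upwards [indicatorConstLp_coeFn (p := 2) (hs := hs) (hμs := h.ne)
    (c := EuclideanSpace.single a (1 : ℂ))] with q hq b
  rw [indL2, hq]
  by_cases hqs : q ∈ s <;> simp [hqs, PiLp.single_apply]

end VectorL2

section ProdL2

variable {X Y ι κ : Type*} [MeasureSpace X] [MeasureSpace Y]
  [SigmaFinite (volume : Measure X)] [SigmaFinite (volume : Measure Y)] [Fintype ι] [Fintype κ]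

lemma memLp_prodFun {f : X → EuclideanSpace ℂ ι} {g : Y → EuclideanSpace ℂ κ}
    (hf : MemLp f 2 volume) (hg : MemLp g 2 volume) :
    MemLp (prodFun f g) 2 (volume : Measure (X × Y)) := by
  have hm : AEStronglyMeasurable (prodFun f g) (volume : Measure (X × Y)) := by
    rw [aestronglyMeasurable_euclidean]
    intro a
    exact ((aestronglyMeasurable_euclidean.1 hf.1 a.1).comp_fst).mul
      ((aestronglyMeasurable_euclidean.1 hg.1 a.2).comp_snd)
  rw [memLp_two_iff_integrable_sq_norm hm]
  simp only [norm_prodFun, mul_pow]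
  exact ((memLp_two_iff_integrable_sq_norm hf.1).1 hf).mul_prod
    ((memLp_two_iff_integrable_sq_norm hg.1).1 hg)

/-- The tensor product of two `L²`-functions. -/
def mulL2 (f : L2 X ι) (g : L2 Y κ) : L2 (X × Y) (ι × κ) :=
  (memLp_prodFun (Lp.memLp f) (Lp.memLp g)).toLp

lemma coeFn_mulL2 (f : L2 X ι) (g : L2 Y κ) :
    (mulL2 f g : X × Y → _) =ᵐ[volume] prodFun f g := MemLp.coeFn_toLp _

lemma mulL2_ae (f : L2 X ι) (g : L2 Y κ) :
    ∀ᵐ q : X × Y, ∀ a, mulL2 f g q a = f q.1 a.1 * g q.2 a.2 := by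
  filter_upwards [coeFn_mulL2 f g] with q hq a
  rw [hq]; rfl

lemma inner_mulL2 (f f' : L2 X ι) (g g' : L2 Y κ) :
    ⟪mulL2 f g, mulL2 f' g'⟫_ℂ = ⟪f, f'⟫_ℂ * ⟪g, g'⟫_ℂ := by
  simp only [L2.inner_def]
  rw [← integral_prod_mul]
  refine integral_congr_ae ?_
  filter_upwards [mulL2_ae f g, mulL2_ae f' g'] with q h1 h2
  simp only [PiLp.inner_apply, h1, h2, RCLike.inner_apply, map_mul]
  rw [Finset.sum_mul_sum, ← Finset.univ_product_univ, Finset.sum_product]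
  refine Finset.sum_congr rfl fun a _ => Finset.sum_congr rfl fun b _ => by ring

/-- The tensor product of `L²`-functions as a bilinear map. -/
def mulL2Bilin : L2 X ι →ₗ[ℂ] L2 Y κ →ₗ[ℂ] L2 (X × Y) (ι × κ) :=
  LinearMap.mk₂ ℂ mulL2
    (fun f f' g => L2_ext <| by
      filter_upwards [mulL2_ae (f + f') g, mulL2_ae f g, mulL2_ae f' g,
        ae_fst (Y := Y) (L2_add_ae f f'), L2_add_ae (mulL2 f g) (mulL2 f' g)] with q h1 h2 h3 h4 h5 a
      rw [h1, h5, h2, h3, h4, add_mul])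
    (fun c f g => L2_ext <| by
      filter_upwards [mulL2_ae (c • f) g, mulL2_ae f g,
        ae_fst (Y := Y) (L2_smul_ae c f), L2_smul_ae c (mulL2 f g)] with q h1 h2 h3 h4 a
      rw [h1, h4, h2, h3, mul_assoc])
    (fun f g g' => L2_ext <| by
      filter_upwards [mulL2_ae f (g + g'), mulL2_ae f g, mulL2_ae f g',
        ae_snd (X := X) (L2_add_ae g g'), L2_add_ae (mulL2 f g) (mulL2 f g')] with q h1 h2 h3 h4 h5 a
      rw [h1, h5, h2, h3, h4, mul_add])
    (fun c f g => L2_ext <| by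
      filter_upwards [mulL2_ae f (c • g), mulL2_ae f g,
        ae_snd (X := X) (L2_smul_ae c g), L2_smul_ae c (mulL2 f g)] with q h1 h2 h3 h4 a
      rw [h1, h4, h2, h3, mul_left_comm])

/-- An integrable function on a product all of whose integrals over rectangles of finite measure
vanish is zero. -/
lemma ae_eq_zero_of_setIntegral_rectangle {h : X × Y → ℂ}
    (hint : ∀ s t, MeasurableSet s → MeasurableSet t → volume s < ⊤ → volume t < ⊤ →
      IntegrableOn h (s ×ˢ t) volume)
    (h0 : ∀ s t, MeasurableSet s → MeasurableSet t → volume s < ⊤ → volume t < ⊤ →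
      ∫ q in s ×ˢ t, h q = 0) : h =ᵐ[volume] 0 := by
  have key : ∀ s t, MeasurableSet s → MeasurableSet t → volume s < ⊤ → volume t < ⊤ →
      h =ᵐ[volume.restrict (s ×ˢ t)] 0 := by
    intro s t hs ht hs' ht'
    refine (hint s t hs ht hs' ht').ae_eq_zero_of_forall_setIntegral_eq_zero fun A hA hA' => ?_
    -- Inside the rectangle every set has finite measure. Without this hypothesis the claim is
    -- stable under complements and disjoint unions, as the π-λ induction requires.
    clear hA'
    have hI := hint s t hs ht hs' ht'
    induction A, hA using MeasurableSpace.induction_on_inter generateFrom_prod.symm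
      isPiSystem_prod with
    | empty => simp
    | basic A hA =>
      obtain ⟨u, hu, v, hv, rfl⟩ := hA
      rw [Measure.restrict_restrict (hu.prod hv), Set.prod_inter_prod]
      exact h0 _ _ (hu.inter hs) (hv.inter ht) ((measure_mono Set.inter_subset_right).trans_lt hs')
        ((measure_mono Set.inter_subset_right).trans_lt ht')
    | compl A hA ih =>
      rw [setIntegral_compl hA hI, ih, h0 s t hs ht hs' ht', sub_zero]
    | iUnion f hd hf ih =>
      rw [integral_iUnion hf hd hI.integrableOn]
      simp only [ih, tsum_zero]
  have hcov : (Set.univ : Set (X × Y)) ⊆ ⋃ n : ℕ, spanningSets (volume : Measure X) n ×ˢ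
      spanningSets (volume : Measure Y) n := by
    intro q _
    have h1 := iUnion_spanningSets (volume : Measure X)
    have h2 := iUnion_spanningSets (volume : Measure Y)
    obtain ⟨n, hn⟩ := Set.mem_iUnion.1 (h1 ▸ Set.mem_univ q.1)
    obtain ⟨m, hm⟩ := Set.mem_iUnion.1 (h2 ▸ Set.mem_univ q.2)
    exact Set.mem_iUnion.2 ⟨max n m, monotone_spanningSets _ (le_max_left _ _) hn,
      monotone_spanningSets _ (le_max_right _ _) hm⟩
  rw [← Measure.restrict_univ (μ := (volume : Measure (X × Y)))]
  refine ae_restrict_of_ae_restrict_of_subset hcov ?_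
  rw [ae_restrict_iUnion_eq]
  simp only [eventually_iSup]
  exact fun n => key _ _ (measurableSet_spanningSets _ n) (measurableSet_spanningSets _ n)
    (measure_spanningSets_lt_top _ n) (measure_spanningSets_lt_top _ n)

/-- Products of indicators times basis vectors single out one component of `Ψ` and integrate it over
a rectangle, so each component has vanishing rectangle integrals. -/
lemma eq_zero_of_inner_mulL2 (Ψ : L2 (X × Y) (ι × κ)) (h : ∀ f g, ⟪mulL2 f g, Ψ⟫_ℂ = 0) :
    Ψ = 0 := by
  classical
  have hc : ∀ a, ∀ᵐ q, Ψ q a = 0 := by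
    intro a
    have hmem : MemLp (fun q => Ψ q a) 2 volume :=
      (EuclideanSpace.proj (𝕜 := ℂ) a).comp_memLp' (Lp.memLp Ψ)
    refine ae_eq_zero_of_setIntegral_rectangle ?_ ?_
    · intro s t hs ht hs' ht'
      have : volume (s ×ˢ t) < ⊤ := by
        rw [Measure.volume_eq_prod, Measure.prod_prod]; exact ENNReal.mul_lt_top hs' ht'
      have : IsFiniteMeasure ((volume : Measure (X × Y)).restrict (s ×ˢ t)) :=
        isFiniteMeasure_restrict.2 this.ne
      exact (hmem.restrict _).integrable (by norm_num)
    · intro s t hs ht hs' ht'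
      rw [← h (indL2 hs hs' a.1) (indL2 ht ht' a.2), L2.inner_def,
        ← integral_indicator (hs.prod ht)]
      refine integral_congr_ae ?_
      filter_upwards [mulL2_ae (indL2 hs hs' a.1) (indL2 ht ht' a.2),
        ae_fst (Y := Y) (indL2_ae hs hs' a.1), ae_snd (X := X) (indL2_ae ht ht' a.2)]
        with q h1 h2 h3
      simp only [PiLp.inner_apply, h1, h2, h3, RCLike.inner_apply]
      rw [Finset.sum_eq_single a]
      · by_cases h4 : q.1 ∈ s <;> by_cases h5 : q.2 ∈ t <;> simp [h4, h5]
      · intro b _ hb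
        by_cases h6 : b.1 = a.1
        · have : b.2 ≠ a.2 := fun h7 => hb (Prod.ext h6 h7)
          simp [this]
        · simp [h6]
      · simp
  refine L2_ext ?_
  filter_upwards [ae_all_iff.2 hc, Lp.coeFn_zero (EuclideanSpace ℂ (ι × κ)) 2
    (volume : Measure (X × Y))] with q h1 h2 a
  rw [h1, h2]; rfl

end ProdL2

section TensorL2

variable {E F X Y ι κ : Type*} [NormedAddCommGroup E] [InnerProductSpace ℂ E]
  [NormedAddCommGroup F] [InnerProductSpace ℂ F] [MeasureSpace X] [MeasureSpace Y]
  [SigmaFinite (volume : Measure X)] [SigmaFinite (volume : Measure Y)] [Fintype ι] [Fintype κ]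

/-- The isometry of the algebraic tensor product into `L²` of the product space. -/
def tensorL2Alg (V₁ : E ≃ₗᵢ[ℂ] L2 X ι) (V₂ : F ≃ₗᵢ[ℂ] L2 Y κ) :
    (E ⊗[ℂ] F) →ₗᵢ[ℂ] L2 (X × Y) (ι × κ) :=
  (TensorProduct.lift (mulL2Bilin.compl₁₂ V₁.toLinearEquiv.toLinearMap
    V₂.toLinearEquiv.toLinearMap)).isometryOfInner <| by
    intro x y
    induction x using TensorProduct.induction_on with
    | zero => simp
    | add x x' hx hx' => rw [map_add, inner_add_left, inner_add_left, hx, hx']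
    | tmul a b =>
      induction y using TensorProduct.induction_on with
      | zero => simp
      | add y y' hy hy' => rw [map_add, inner_add_right, inner_add_right, hy, hy']
      | tmul c d =>
        have := inner_mulL2 (V₁ a) (V₁ c) (V₂ b) (V₂ d)
        rw [V₁.inner_map_map, V₂.inner_map_map] at this
        simpa [mulL2Bilin] using this

lemma tensorL2Alg_tmul (V₁ : E ≃ₗᵢ[ℂ] L2 X ι) (V₂ : F ≃ₗᵢ[ℂ] L2 Y κ) (x : E) (y : F) :
    tensorL2Alg V₁ V₂ (x ⊗ₜ y) = mulL2 (V₁ x) (V₂ y) := by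
  simp [tensorL2Alg, mulL2Bilin]

lemma denseRange_tensorL2Alg (V₁ : E ≃ₗᵢ[ℂ] L2 X ι) (V₂ : F ≃ₗᵢ[ℂ] L2 Y κ) :
    DenseRange (tensorL2Alg V₁ V₂) := by
  have : (LinearMap.range (tensorL2Alg V₁ V₂).toLinearMap).topologicalClosure = ⊤ := by
    rw [Submodule.topologicalClosure_eq_top_iff, Submodule.eq_bot_iff]
    intro Ψ hΨ
    refine eq_zero_of_inner_mulL2 Ψ fun f g => ?_
    refine (Submodule.mem_orthogonal _ _).1 hΨ _ ⟨V₁.symm f ⊗ₜ V₂.symm g, ?_⟩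
    simp [tensorL2Alg_tmul]
  have h2 := (Submodule.dense_iff_topologicalClosure_eq_top).2 this
  exact h2

/-- The identification of the tensor product of two spaces of the form `L²(X, ℂⁿ)`, `L²(Y, ℂᵐ)` with
`L²(X × Y, ℂⁿ ⊗ ℂᵐ)`. -/
def tensorL2 (V₁ : E ≃ₗᵢ[ℂ] L2 X ι) (V₂ : F ≃ₗᵢ[ℂ] L2 Y κ) :
    HTensor E F ≃ₗᵢ[ℂ] L2 (X × Y) (ι × κ) := by
  let T : HTensor E F →ₗᵢ[ℂ] L2 (X × Y) (ι × κ) :=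
    { toLinearMap := ((tensorL2Alg V₁ V₂).toLinearMap.extendOfNorm (toH E F).toLinearMap :
        HTensor E F →L[ℂ] L2 (X × Y) (ι × κ)).toLinearMap
      norm_map' := by
        have h : ∀ x, (tensorL2Alg V₁ V₂).toLinearMap.extendOfNorm (toH E F).toLinearMap
            (toH E F x) = tensorL2Alg V₁ V₂ x := fun x =>
          LinearMap.extendOfNorm_eq (e := (toH E F).toLinearMap) denseRange_toH
            ⟨1, fun x => by simp⟩ x
        refine denseRange_toH.induction ?_ (isClosed_eq (by fun_prop) (by fun_prop))
        rintro x ⟨x, rfl⟩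
        refine (congrArg norm (h x)).trans ?_
        simp }
  refine LinearIsometryEquiv.ofSurjective T ?_
  -- An isometry of a complete space has closed range, so density of the range already gives
  -- surjectivity.
  have hr : IsClosed (Set.range T) := T.isometry.isClosedEmbedding.isClosed_range
  rw [← Set.range_eq_univ, ← hr.closure_eq, ← dense_iff_closure_eq]
  refine (denseRange_tensorL2Alg V₁ V₂).mono ?_
  rintro _ ⟨x, rfl⟩
  exact ⟨toH E F x, LinearMap.extendOfNorm_eq (e := (toH E F).toLinearMap) denseRange_toH
            ⟨1, fun x => by simp⟩ x⟩

lemma tensorL2_tpure (V₁ : E ≃ₗᵢ[ℂ] L2 X ι) (V₂ : F ≃ₗᵢ[ℂ] L2 Y κ) (x : E) (y : F) :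
    tensorL2 V₁ V₂ (tpure x y) = mulL2 (V₁ x) (V₂ y) := by
  rw [← tensorL2Alg_tmul]
  exact LinearMap.extendOfNorm_eq (e := (toH E F).toLinearMap) denseRange_toH
            ⟨1, fun x => by simp⟩ _

lemma tensorL2_tpure_ae (V₁ : E ≃ₗᵢ[ℂ] L2 X ι) (V₂ : F ≃ₗᵢ[ℂ] L2 Y κ) (x : E) (y : F) :
    ∀ᵐ q : X × Y, ∀ a, tensorL2 V₁ V₂ (tpure x y) q a = V₁ x q.1 a.1 * V₂ y q.2 a.2 := by
  rw [tensorL2_tpure]; exact mulL2_ae _ _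

end TensorL2

end LRScattering

end

noncomputable section

namespace LRScattering

/-! ### Operators acting pointwise -/

section Acts

variable {K K' X X' ι ι' : Type*} [NormedAddCommGroup K] [InnerProductSpace ℂ K]
  [NormedAddCommGroup K'] [InnerProductSpace ℂ K'] [MeasureSpace X] [MeasureSpace X']
  [Fintype ι] [Fintype ι']

lemma L2_exists_seq_tendsto_ae {f : ℕ → L2 X ι} {g : L2 X ι} (h : Tendsto f atTop (𝓝 g)) :
    ∃ ns : ℕ → ℕ, StrictMono ns ∧
      ∀ᵐ q, ∀ a, Tendsto (fun n => f (ns n) q a) atTop (𝓝 (g q a)) := by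
  obtain ⟨ns, hns, h2⟩ := (tendstoInMeasure_of_tendsto_Lp h).exists_seq_tendsto_ae
  refine ⟨ns, hns, ?_⟩
  filter_upwards [h2] with q hq a
  exact ((EuclideanSpace.proj (𝕜 := ℂ) a).continuous.tendsto _).comp hq

/-- A bounded operator which acts in a pointwise way on the vectors of a total set acts in this way
on all vectors. -/
lemma acts_of_dense (W : K ≃ₗᵢ[ℂ] L2 X ι) (W' : K' ≃ₗᵢ[ℂ] L2 X' ι') (A : K →L[ℂ] K')
    {τ : X' → X} (hτ : Measure.QuasiMeasurePreserving τ volume volume)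
    (m : X' → Matrix ι' ι ℂ) {s : Set K}
    (hs : Dense (Submodule.span ℂ s : Set K))
    (h : ∀ x ∈ s, ∀ᵐ q, ∀ a, W' (A x) q a = ∑ b, m q a b * W x (τ q) b) (x : K) :
    ∀ᵐ q, ∀ a, W' (A x) q a = ∑ b, m q a b * W x (τ q) b := by
  let p : Submodule ℂ K :=
    { carrier := {x | ∀ᵐ q, ∀ a, W' (A x) q a = ∑ b, m q a b * W x (τ q) b}
      zero_mem' := by
        filter_upwards [Lp.coeFn_zero (EuclideanSpace ℂ ι') 2 (volume : Measure X'),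
          hτ.ae (Lp.coeFn_zero (EuclideanSpace ℂ ι) 2 (volume : Measure X))] with q h1 h2 a
        simp only [map_zero]
        rw [h1, h2]
        simp
      add_mem' := by
        intro x y hx hy
        filter_upwards [hx, hy, L2_add_ae (W' (A x)) (W' (A y)), hτ.ae (L2_add_ae (W x) (W y))]
          with q h1 h2 h3 h4 a
        simp only [map_add, h3, h4, h1, h2, mul_add, Finset.sum_add_distrib]
      smul_mem' := by
        intro c x hx
        filter_upwards [hx, L2_smul_ae c (W' (A x)), hτ.ae (L2_smul_ae c (W x))] with q h1 h2 h3 a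
        simp only [map_smul, h2, h3, h1, Finset.mul_sum, mul_left_comm] }
  -- The symbol `m` is not assumed bounded, so closedness is checked pointwise: one subsequence
  -- makes the left side converge almost everywhere, a further one the right side, and `τ` pulls
  -- null sets back to null sets.
  have hp : IsClosed (p : Set K) := by
    refine IsSeqClosed.isClosed fun x y hx hxy => ?_
    obtain ⟨ns, hns, h1⟩ := L2_exists_seq_tendsto_ae
      (((W'.continuous.comp A.continuous).tendsto y).comp hxy)
    obtain ⟨ms, hms, h2⟩ := L2_exists_seq_tendsto_ae
      (((W.continuous.tendsto y).comp hxy).comp hns.tendsto_atTop)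
    change ∀ᵐ q, ∀ a, W' (A y) q a = ∑ b, m q a b * W y (τ q) b
    filter_upwards [h1, hτ.ae h2, ae_all_iff.2 fun n => hx (ns (ms n))] with q h1 h2 h3 a
    refine tendsto_nhds_unique ((h1 a).comp hms.tendsto_atTop) ?_
    refine (tendsto_finsetSum Finset.univ fun b _ => (h2 b).const_mul (m q a b)).congr fun n => ?_
    exact (h3 n a).symm
  have hsp : Submodule.span ℂ s ≤ p := Submodule.span_le.2 h
  have : x ∈ (p : Set K) := by
    have := hs.mono hsp
    rw [← hp.closure_eq]
    exact this x
  exact this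

end Acts

/-! ### Total sets in Hilbert space tensor products -/

section Total

variable {E F G : Type*}
  [NormedAddCommGroup E] [InnerProductSpace ℂ E] [NormedAddCommGroup F] [InnerProductSpace ℂ F]
  [NormedAddCommGroup G] [InnerProductSpace ℂ G]

lemma continuous_tpure : Continuous fun p : E × F => tpure p.1 p.2 :=
  (toH E F).continuous.comp TensorProduct.continuous_tmul

/-- Tensor products of total sets are total. -/
lemma dense_span_tpure {s : Set E} {t : Set F} (hs : Dense (Submodule.span ℂ s : Set E))
    (ht : Dense (Submodule.span ℂ t : Set F)) :
    Dense ((Submodule.span ℂ (Set.image2 tpure s t) : Submodule ℂ (HTensor E F)) :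
      Set (HTensor E F)) := by
  rw [Submodule.dense_iff_topologicalClosure_eq_top]
  set p := (Submodule.span ℂ (Set.image2 tpure s t)).topologicalClosure with hp
  have hpc : IsClosed (p : Set (HTensor E F)) := Submodule.isClosed_topologicalClosure _
  have hspan : ∀ x ∈ Submodule.span ℂ s, ∀ y ∈ Submodule.span ℂ t, tpure x y ∈ p := by
    intro x hx y hy
    refine Submodule.le_topologicalClosure _ ?_
    induction hx using Submodule.span_induction with
    | zero => simp [tpure]
    | add x x' _ _ h h' => simpa [tpure, TensorProduct.add_tmul] using add_mem h h'
    | smul c x _ h =>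
      simpa [tpure, ← TensorProduct.smul_tmul'] using Submodule.smul_mem _ c h
    | mem x hx =>
      induction hy using Submodule.span_induction with
      | zero => simp [tpure]
      | add y y' _ _ h h' => simpa [tpure, TensorProduct.tmul_add] using add_mem h h'
      | smul c y _ h => simpa [tpure] using Submodule.smul_mem _ c h
      | mem y hy => exact Submodule.subset_span ⟨x, hx, y, hy, rfl⟩
  have hall : ∀ x y, tpure x y ∈ p := by
    intro x y
    have h1 : IsClosed {q : E × F | tpure q.1 q.2 ∈ p} := hpc.preimage continuous_tpure
    have h2 : Dense ((Submodule.span ℂ s : Set E) ×ˢ (Submodule.span ℂ t : Set F)) := hs.prod ht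
    exact h1.closure_subset_iff.2 (fun q hq => hspan q.1 hq.1 q.2 hq.2) (h2 (x, y))
  rw [eq_top_iff]
  intro z _
  refine denseRange_toH.induction (P := fun z => z ∈ p) ?_ hpc z
  rintro _ ⟨x, rfl⟩
  induction x using TensorProduct.induction_on with
  | zero => simp
  | tmul x y => exact hall x y
  | add x y hx hy => rw [map_add]; exact add_mem hx hy

lemma dense_span_univ : Dense (Submodule.span ℂ (Set.univ : Set E) : Set E) := by
  simp

lemma dense_span_range_tpure :
    Dense ((Submodule.span ℂ (Set.image2 tpure Set.univ Set.univ) : Submodule ℂ (HTensor E F)) :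
      Set (HTensor E F)) :=
  dense_span_tpure dense_span_univ dense_span_univ

lemma dense_span_triple_left :
    Dense ((Submodule.span ℂ (Set.image2 tpure (Set.image2 tpure Set.univ Set.univ) Set.univ) :
      Submodule ℂ (HTensor (HTensor E F) G)) :
      Set (HTensor (HTensor E F) G)) :=
  dense_span_tpure dense_span_range_tpure dense_span_univ

end Total

/-! ### Pointwise form of the flip, the associator and the leg operators -/

section Legs

variable {E F G E' F' X Y Z X' Y' ι κ μ ι' κ' : Type*}
  [NormedAddCommGroup E] [InnerProductSpace ℂ E] [NormedAddCommGroup F] [InnerProductSpace ℂ F]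
  [NormedAddCommGroup G] [InnerProductSpace ℂ G]
  [NormedAddCommGroup E'] [InnerProductSpace ℂ E'] [NormedAddCommGroup F'] [InnerProductSpace ℂ F']
  [MeasureSpace X] [MeasureSpace Y] [MeasureSpace Z] [MeasureSpace X'] [MeasureSpace Y']
  [SigmaFinite (volume : Measure X)] [SigmaFinite (volume : Measure Y)]
  [SigmaFinite (volume : Measure Z)]
  [SigmaFinite (volume : Measure X')] [SigmaFinite (volume : Measure Y')]
  [Fintype ι] [Fintype κ] [Fintype μ] [Fintype ι'] [Fintype κ']

/-- On simple tensors both sides factorize, and these are total. The substitutions `τ` and `σ` are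
included so that the modular groups, which translate the variable, are covered along with
multiplication operators. -/
lemma tmap_ae (V₁ : E ≃ₗᵢ[ℂ] L2 X ι) (V₂ : F ≃ₗᵢ[ℂ] L2 Y κ) (V₁' : E' ≃ₗᵢ[ℂ] L2 X' ι')
    (V₂' : F' ≃ₗᵢ[ℂ] L2 Y' κ') (A : E →L[ℂ] E') (B : F →L[ℂ] F')
    {τ : X' → X} (hτ : MeasurePreserving τ volume volume)
    {σ : Y' → Y} (hσ : MeasurePreserving σ volume volume)
    (m : X' → Matrix ι' ι ℂ) (n : Y' → Matrix κ' κ ℂ)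
    (hA : ∀ x, ∀ᵐ q, ∀ a, V₁' (A x) q a = ∑ b, m q a b * V₁ x (τ q) b)
    (hB : ∀ x, ∀ᵐ q, ∀ a, V₂' (B x) q a = ∑ b, n q a b * V₂ x (σ q) b) (Φ : HTensor E F) :
    ∀ᵐ q, ∀ a, tensorL2 V₁' V₂' (tmap A B Φ) q a =
      ∑ b : ι × κ, (m q.1 a.1 b.1 * n q.2 a.2 b.2) * tensorL2 V₁ V₂ Φ (τ q.1, σ q.2) b := by
  have hτσ : MeasurePreserving (Prod.map τ σ) (volume : Measure (X' × Y')) volume := hτ.prod hσ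
  refine acts_of_dense (tensorL2 V₁ V₂) (tensorL2 V₁' V₂') (tmap A B)
    hτσ.quasiMeasurePreserving (fun q => Matrix.of fun a b => m q.1 a.1 b.1 * n q.2 a.2 b.2)
    dense_span_range_tpure ?_ Φ
  rintro _ ⟨x, -, y, -, rfl⟩
  rw [tmap_tpure]
  filter_upwards [tensorL2_tpure_ae V₁' V₂' (A x) (B y), ae_fst (hA x), ae_snd (hB y),
    hτσ.quasiMeasurePreserving.ae (tensorL2_tpure_ae V₁ V₂ x y)] with q h1 h2 h3 h4 a
  change tensorL2 V₁' V₂' (tpure (A x) (B y)) q a =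
    ∑ b, _ * tensorL2 V₁ V₂ (tpure x y) (Prod.map τ σ q) b
  simp only [h1, h2, h3, h4, Finset.sum_mul_sum, Matrix.of_apply]
  rw [← Finset.univ_product_univ, Finset.sum_product]
  exact Finset.sum_congr rfl fun b _ => Finset.sum_congr rfl fun c _ => by
    simp only [Prod.map]; ring

lemma id_ae [DecidableEq ι] (V₁ : E ≃ₗᵢ[ℂ] L2 X ι) (x : E) : ∀ᵐ q, ∀ a,
    V₁ (ContinuousLinearMap.id ℂ E x) q a
      = ∑ b, (1 : Matrix ι ι ℂ) a b * V₁ x (id q) b := by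
  simp [Matrix.one_apply]

variable (V₁ : E ≃ₗᵢ[ℂ] L2 X ι) (V₂ : F ≃ₗᵢ[ℂ] L2 Y κ) (V₃ : G ≃ₗᵢ[ℂ] L2 Z μ)

/-- The relabelling operators act pointwise. -/
lemma relabel_ae {K K' : Type*} [NormedAddCommGroup K] [InnerProductSpace ℂ K]
    [NormedAddCommGroup K'] [InnerProductSpace ℂ K']
    (W : K ≃ₗᵢ[ℂ] L2 X ι) (W' : K' ≃ₗᵢ[ℂ] L2 X' ι') (A : K →L[ℂ] K')
    {τ : X' → X} (hτ : MeasurePreserving τ volume volume) (e : ι' → ι) {s : Set K}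
    (hs : Dense (Submodule.span ℂ s : Set K))
    (h : ∀ x ∈ s, ∀ᵐ q, ∀ a, W' (A x) q a = W x (τ q) (e a)) (x : K) :
    ∀ᵐ q, ∀ a, W' (A x) q a = W x (τ q) (e a) := by
  classical
  have := acts_of_dense W W' A hτ.quasiMeasurePreserving
    (fun _ => Matrix.of fun a b => if b = e a then 1 else 0) hs (fun x hx => ?_) x
  · simpa using this
  · simpa using h x hx

lemma flipH_ae (Φ : HTensor E F) : ∀ᵐ q, ∀ a,
    tensorL2 V₂ V₁ (flipH E F Φ) q a = tensorL2 V₁ V₂ Φ (q.2, q.1) (a.2, a.1) := by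
  have hτ : MeasurePreserving Prod.swap (volume : Measure (Y × X)) volume :=
    Measure.measurePreserving_swap
  refine relabel_ae (tensorL2 V₁ V₂) (tensorL2 V₂ V₁)
    (flipH E F).toContinuousLinearEquiv.toContinuousLinearMap hτ
    (fun a => (a.2, a.1)) dense_span_range_tpure (fun x hx => ?_) Φ
  change ∀ᵐ q, ∀ a, tensorL2 V₂ V₁ (flipH E F x) q a = _
  revert x
  rintro _ ⟨x, -, y, -, rfl⟩
  filter_upwards [tensorL2_tpure_ae V₂ V₁ y x,
    hτ.quasiMeasurePreserving.ae (tensorL2_tpure_ae V₁ V₂ x y)] with q h1 h2 a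
  simp [h1, h2, mul_comm]

lemma assoc_ae (Φ : HTensor (HTensor E F) G) : ∀ᵐ q : X × Y × Z, ∀ a,
    tensorL2 V₁ (tensorL2 V₂ V₃) (assoc E F G Φ) q a =
      tensorL2 (tensorL2 V₁ V₂) V₃ Φ ((q.1, q.2.1), q.2.2) ((a.1, a.2.1), a.2.2) := by
  have hτ : MeasurePreserving (fun q : X × Y × Z => ((q.1, q.2.1), q.2.2)) volume volume :=
    volume_preserving_prodAssoc.symm _
  refine relabel_ae (tensorL2 (tensorL2 V₁ V₂) V₃) (tensorL2 V₁ (tensorL2 V₂ V₃))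
    (assoc E F G).toContinuousLinearEquiv.toContinuousLinearMap hτ
    (fun a => ((a.1, a.2.1), a.2.2)) dense_span_triple_left (fun x hx => ?_) Φ
  change ∀ᵐ q, ∀ a, tensorL2 V₁ (tensorL2 V₂ V₃) (assoc E F G x) q a = _
  revert x
  rintro _ ⟨_, ⟨x, -, y, -, rfl⟩, z, -, rfl⟩
  filter_upwards [tensorL2_tpure_ae V₁ (tensorL2 V₂ V₃) x (tpure y z),
    ae_snd (tensorL2_tpure_ae V₂ V₃ y z),
    hτ.quasiMeasurePreserving.ae (tensorL2_tpure_ae (tensorL2 V₁ V₂) V₃ (tpure x y) z),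
    hτ.quasiMeasurePreserving.ae (ae_fst (tensorL2_tpure_ae V₁ V₂ x y))] with q h1 h2 h3 h4 a
  simp [h1, h2, h3, h4, mul_assoc]

lemma assoc_symm_ae (Φ : HTensor E (HTensor F G)) : ∀ᵐ q : (X × Y) × Z, ∀ a,
    tensorL2 (tensorL2 V₁ V₂) V₃ ((assoc E F G).symm Φ) q a =
      tensorL2 V₁ (tensorL2 V₂ V₃) Φ (q.1.1, q.1.2, q.2) (a.1.1, a.1.2, a.2) := by
  have hτ : MeasurePreserving (fun q : (X × Y) × Z => (q.1.1, q.1.2, q.2)) volume volume :=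
    volume_preserving_prodAssoc
  have := hτ.quasiMeasurePreserving.ae (assoc_ae V₁ V₂ V₃ ((assoc E F G).symm Φ))
  filter_upwards [this] with q h a
  simpa using (h (a.1.1, a.1.2, a.2)).symm

lemma swap23_ae (Φ : HTensor (HTensor E F) G) : ∀ᵐ q : (X × Z) × Y, ∀ a,
    tensorL2 (tensorL2 V₁ V₃) V₂ (swap23 E F G Φ) q a =
      tensorL2 (tensorL2 V₁ V₂) V₃ Φ ((q.1.1, q.2), q.1.2) ((a.1.1, a.2), a.1.2) := by
  have hτ : MeasurePreserving (fun q : (X × Z) × Y => ((q.1.1, q.2), q.1.2)) volume volume :=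
    (volume_preserving_prodAssoc.symm (MeasurableEquiv.prodAssoc (α := X) (β := Y) (γ := Z))).comp
      (((MeasurePreserving.id volume).prod Measure.measurePreserving_swap).comp
        (volume_preserving_prodAssoc (α₁ := X) (β₁ := Z) (γ₁ := Y)))
  refine relabel_ae (tensorL2 (tensorL2 V₁ V₂) V₃) (tensorL2 (tensorL2 V₁ V₃) V₂)
    (swap23 E F G) hτ (fun a => ((a.1.1, a.2), a.1.2)) dense_span_triple_left ?_ Φ
  rintro _ ⟨_, ⟨x, -, y, -, rfl⟩, z, -, rfl⟩
  filter_upwards [tensorL2_tpure_ae (tensorL2 V₁ V₃) V₂ (tpure x z) y,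
    ae_fst (tensorL2_tpure_ae V₁ V₃ x z),
    hτ.quasiMeasurePreserving.ae (tensorL2_tpure_ae (tensorL2 V₁ V₂) V₃ (tpure x y) z),
    hτ.quasiMeasurePreserving.ae (ae_fst (tensorL2_tpure_ae V₁ V₂ x y))] with q h1 h2 h3 h4 a
  simp [h1, h2, h3, h4, mul_assoc, mul_comm, mul_left_comm]

lemma leg12_ae {A : HTensor E F →L[ℂ] HTensor E F} {m : X × Y → Matrix (ι × κ) (ι × κ) ℂ}
    (hA : ∀ Φ, ∀ᵐ q, ∀ a, tensorL2 V₁ V₂ (A Φ) q a = ∑ b, m q a b * tensorL2 V₁ V₂ Φ q b)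
    (Φ : HTensor (HTensor E F) G) : ∀ᵐ q : (X × Y) × Z, ∀ a,
    tensorL2 (tensorL2 V₁ V₂) V₃ (leg12 G A Φ) q a =
      ∑ b, m q.1 a.1 b * tensorL2 (tensorL2 V₁ V₂) V₃ Φ q (b, a.2) := by
  classical
  have := tmap_ae (tensorL2 V₁ V₂) V₃ (tensorL2 V₁ V₂) V₃ A (ContinuousLinearMap.id ℂ G)
    (MeasurePreserving.id _) (MeasurePreserving.id _) m (fun _ => 1) hA (id_ae V₃) Φ
  filter_upwards [this] with q h a
  rw [leg12, h]
  simp only [← Finset.univ_product_univ (α := ι × κ) (β := μ), Finset.sum_product]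
  simp [Matrix.one_apply]

lemma leg13_ae {A : HTensor E G →L[ℂ] HTensor E G} {m : X × Z → Matrix (ι × μ) (ι × μ) ℂ}
    (hA : ∀ Φ, ∀ᵐ q, ∀ a, tensorL2 V₁ V₃ (A Φ) q a = ∑ b, m q a b * tensorL2 V₁ V₃ Φ q b)
    (Φ : HTensor (HTensor E F) G) : ∀ᵐ q : (X × Y) × Z, ∀ a,
    tensorL2 (tensorL2 V₁ V₂) V₃ (leg13 F A Φ) q a =
      ∑ b, m (q.1.1, q.2) (a.1.1, a.2) b *
        tensorL2 (tensorL2 V₁ V₂) V₃ Φ q ((b.1, a.1.2), b.2) := by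
  have hτ : MeasurePreserving (fun q : (X × Y) × Z => ((q.1.1, q.2), q.1.2)) volume volume :=
    (volume_preserving_prodAssoc.symm (MeasurableEquiv.prodAssoc (α := X) (β := Z) (γ := Y))).comp
      (((MeasurePreserving.id volume).prod Measure.measurePreserving_swap).comp
        (volume_preserving_prodAssoc (α₁ := X) (β₁ := Y) (γ₁ := Z)))
  filter_upwards [swap23_ae V₁ V₃ V₂ (leg12 F A (swap23 E F G Φ)),
    hτ.quasiMeasurePreserving.ae (leg12_ae V₁ V₃ V₂ hA (swap23 E F G Φ)),
    hτ.quasiMeasurePreserving.ae (swap23_ae V₁ V₂ V₃ Φ)] with q h1 h2 h3 a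
  rw [leg13, ContinuousLinearMap.comp_apply, ContinuousLinearMap.comp_apply, h1, h2]
  simp only [h3]

lemma leg23_ae {A : HTensor F G →L[ℂ] HTensor F G} {m : Y × Z → Matrix (κ × μ) (κ × μ) ℂ}
    (hA : ∀ Φ, ∀ᵐ q, ∀ a, tensorL2 V₂ V₃ (A Φ) q a = ∑ b, m q a b * tensorL2 V₂ V₃ Φ q b)
    (Φ : HTensor (HTensor E F) G) : ∀ᵐ q : (X × Y) × Z, ∀ a,
    tensorL2 (tensorL2 V₁ V₂) V₃ (leg23 E A Φ) q a =
      ∑ b, m (q.1.2, q.2) (a.1.2, a.2) b *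
        tensorL2 (tensorL2 V₁ V₂) V₃ Φ q ((a.1.1, b.1), b.2) := by
  classical
  have hτ : MeasurePreserving (fun q : (X × Y) × Z => (q.1.1, q.1.2, q.2)) volume volume :=
    volume_preserving_prodAssoc
  have h := tmap_ae V₁ (tensorL2 V₂ V₃) V₁ (tensorL2 V₂ V₃) (ContinuousLinearMap.id ℂ E) A
    (MeasurePreserving.id _) (MeasurePreserving.id _) (fun _ => 1) m (id_ae V₁) hA
    (assoc E F G Φ)
  filter_upwards [assoc_symm_ae V₁ V₂ V₃ (tmap (ContinuousLinearMap.id ℂ E) A (assoc E F G Φ)),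
    hτ.quasiMeasurePreserving.ae h, hτ.quasiMeasurePreserving.ae (assoc_ae V₁ V₂ V₃ Φ)]
    with q h1 h2 h3 a
  refine (h1 a).trans ((h2 (a.1.1, a.1.2, a.2)).trans ?_)
  simp only [← Finset.univ_product_univ (α := ι) (β := κ × μ), Finset.sum_product]
  rw [Finset.sum_eq_single a.1.1]
  · simp [h3]
  · intro b _ hb
    simp [hb.symm]
  · simp

end Legs

end LRScattering

end

noncomputable section

namespace LRScattering

/-! ### Gaussian functions -/

section Gauss

/-- The Gaussian `exp (-a (q - w)²)` with complex center `w`. -/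
def gauss (a : ℝ) (w : ℂ) (q : ℝ) : ℂ := Complex.exp (-a * (q - w) ^ 2)

lemma gauss_ne_zero (a : ℝ) (w : ℂ) (q : ℝ) : gauss a w q ≠ 0 := Complex.exp_ne_zero _

/-- The imaginary part of the center costs only the constant factor `exp (a (Im w)²)`, which is what
keeps all integrals against complex Gaussians under control. -/
lemma norm_gauss (a : ℝ) (w : ℂ) (q : ℝ) :
    ‖gauss a w q‖ = Real.exp (a * w.im ^ 2) * Real.exp (-a * (q - w.re) ^ 2) := by
  rw [gauss, Complex.norm_exp, ← Real.exp_add]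
  congr 1
  simp [pow_two]
  ring

lemma continuous_gauss (a : ℝ) (w : ℂ) : Continuous (gauss a w) := by
  unfold gauss; fun_prop

lemma integrable_exp_sq {a : ℝ} (ha : 0 < a) (x : ℝ) :
    Integrable fun q : ℝ => Real.exp (-a * (q - x) ^ 2) :=
  (integrable_exp_neg_mul_sq ha).comp_sub_right x

lemma integrable_gauss {a : ℝ} (ha : 0 < a) (w : ℂ) : Integrable (gauss a w) := by
  rw [← integrable_norm_iff (continuous_gauss a w).aestronglyMeasurable]
  simp only [norm_gauss]
  exact (integrable_exp_sq ha _).const_mul _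

lemma memLp_gauss {a : ℝ} (ha : 0 < a) (w : ℂ) : MemLp (gauss a w) 2 volume := by
  rw [memLp_two_iff_integrable_sq_norm (continuous_gauss a w).aestronglyMeasurable]
  refine ((integrable_exp_sq (a := 2 * a) (by positivity) w.re).const_mul
    (Real.exp (2 * a * w.im ^ 2))).congr (Eventually.of_forall fun q => ?_)
  simp only [norm_gauss]
  rw [mul_pow, ← Real.exp_nat_mul, ← Real.exp_nat_mul]
  congr 2 <;> push_cast <;> ring

variable {ι : Type*} [Fintype ι]

lemma memLp_gauss_smul {a : ℝ} (ha : 0 < a) (w : ℂ) (c : EuclideanSpace ℂ ι) :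
    MemLp (fun q => gauss a w q • c) 2 volume :=
  (ContinuousLinearMap.toSpanSingleton ℂ c).comp_memLp' (memLp_gauss ha w)

/-- The vector `exp (-a (q - w)²) c` of `L²(ℝ, ℂⁿ)`. -/
def gaussL2 {a : ℝ} (ha : 0 < a) (w : ℂ) (c : EuclideanSpace ℂ ι) : L2 ℝ ι :=
  (memLp_gauss_smul ha w c).toLp

lemma gaussL2_ae {a : ℝ} (ha : 0 < a) (w : ℂ) (c : EuclideanSpace ℂ ι) :
    ∀ᵐ q, ∀ α, gaussL2 ha w c q α = gauss a w q * c α := by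
  filter_upwards [(memLp_gauss_smul ha w c).coeFn_toLp] with q hq α
  rw [gaussL2, hq]; rfl

end Gauss

/-! ### Uniqueness of Fourier transforms -/

section Fourier

/-- The positive and negative parts of `h` are densities of finite measures. The hypothesis says
that their images under `φ` have the same characteristic function, hence coincide. As `φ` is an
embedding, the densities agree almost everywhere, so both parts vanish. -/
lemma ae_eq_zero_of_integral_exp_real {φ : ℝ → ℝ} (hφ : MeasurableEmbedding φ) {h : ℝ → ℝ}
    (hh : Integrable h) (h0 : ∀ t : ℝ, ∫ q, Complex.exp (t * φ q * Complex.I) * (h q : ℂ) = 0) :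
    h =ᵐ[volume] 0 := by
  have hpos : ∀ {k : ℝ → ℝ}, Integrable k → ∀ t : ℝ,
      charFun (((volume : Measure ℝ).withDensity fun q => ENNReal.ofReal (k q)).map φ) t
        = ∫ q, Complex.exp (t * φ q * Complex.I) * ((max (k q) 0 : ℝ) : ℂ) := by
    intro k hk t
    rw [charFun_apply_real, hφ.integral_map,
      integral_withDensity_eq_integral_toReal_smul₀ hk.aemeasurable.ennreal_ofReal (by simp)]
    refine integral_congr_ae (Eventually.of_forall fun q => ?_)
    simp only [ENNReal.toReal_ofReal']
    rw [mul_comm, Complex.real_smul, mul_comm]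
  have hfin : ∀ {k : ℝ → ℝ}, Integrable k →
      IsFiniteMeasure (((volume : Measure ℝ).withDensity fun q => ENNReal.ofReal (k q)).map φ) := by
    intro k hk
    have := isFiniteMeasure_withDensity_ofReal hk.2
    infer_instance
  have hint : ∀ (t : ℝ) {k : ℝ → ℝ}, Integrable k →
      Integrable fun q => Complex.exp (t * φ q * Complex.I) * ((max (k q) 0 : ℝ) : ℂ) := by
    intro t k hk
    refine Integrable.bdd_mul (c := 1) hk.pos_part.ofReal ?_ (Eventually.of_forall fun q => ?_)
    · have := hφ.measurable
      exact Measurable.aestronglyMeasurable (by fun_prop)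
    · rw [← Complex.ofReal_mul, Complex.norm_exp_ofReal_mul_I]
  have := hfin hh
  have := hfin hh.neg
  have heq := Measure.ext_of_charFun
    (μ := ((volume : Measure ℝ).withDensity fun q => ENNReal.ofReal (h q)).map φ)
    (ν := ((volume : Measure ℝ).withDensity fun q => ENNReal.ofReal ((-h) q)).map φ) <| by
      ext t
      rw [hpos hh, hpos hh.neg, ← sub_eq_zero, ← integral_sub (hint t hh) (hint t hh.neg), ← h0 t]
      refine integral_congr_ae (Eventually.of_forall fun q => ?_)
      simp only [← mul_sub, ← Complex.ofReal_sub, Pi.neg_apply]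
      congr 2
      rcases le_total (h q) 0 with h1 | h1 <;> simp [h1]
  have heq2 := congrArg (Measure.comap φ) heq
  rw [hφ.comap_map, hφ.comap_map] at heq2
  have h3 := (withDensity_eq_iff hh.aemeasurable.ennreal_ofReal
    hh.neg.aemeasurable.ennreal_ofReal (by
      have := (isFiniteMeasure_withDensity_ofReal hh.2).measure_univ_lt_top
      simpa using this.ne)).1 heq2
  filter_upwards [h3] with q hq
  have := congrArg ENNReal.toReal hq
  simp only [ENNReal.toReal_ofReal', Pi.neg_apply] at this
  rcases le_total (h q) 0 with h1 | h1 <;> simp_all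

/-- Conjugation together with `t ↦ -t` shows that the transform of `conj g` vanishes too, so the
real case applies to the real and imaginary parts. -/
lemma ae_eq_zero_of_integral_exp {φ : ℝ → ℝ} (hφ : MeasurableEmbedding φ) {g : ℝ → ℂ}
    (hg : Integrable g) (h0 : ∀ t : ℝ, ∫ q, Complex.exp (t * φ q * Complex.I) * g q = 0) :
    g =ᵐ[volume] 0 := by
  have hint : ∀ (t : ℝ), Integrable fun q => Complex.exp (t * φ q * Complex.I) * g q := by
    intro t
    refine Integrable.bdd_mul (c := 1) hg ?_ (Eventually.of_forall fun q => ?_)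
    · have := hφ.measurable
      exact Measurable.aestronglyMeasurable (by fun_prop)
    · rw [← Complex.ofReal_mul, Complex.norm_exp_ofReal_mul_I]
  have hconj : ∀ t : ℝ, ∀ q, conj (Complex.exp ((-t : ℝ) * φ q * Complex.I) * g q)
      = Complex.exp (t * φ q * Complex.I) * conj (g q) := by
    intro t q
    rw [map_mul, ← Complex.exp_conj]
    simp
  have h1 : ∀ t : ℝ, ∫ q, Complex.exp (t * φ q * Complex.I) * conj (g q) = 0 := by
    intro t
    simp only [← hconj]
    rw [integral_conj, h0, map_zero]
  have hint' : ∀ (t : ℝ), Integrable fun q => Complex.exp (t * φ q * Complex.I) * conj (g q) := by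
    intro t
    simp only [← hconj]
    exact (LinearIsometryEquiv.integrable_comp_iff (Complex.conjLIE)).2 (hint (-t))
  have hre := ae_eq_zero_of_integral_exp_real hφ hg.re (fun t => by
    have : ∀ q, Complex.exp (t * φ q * Complex.I) * ((RCLike.re (g q) : ℝ) : ℂ)
        = (Complex.exp (t * φ q * Complex.I) * g q
          + Complex.exp (t * φ q * Complex.I) * conj (g q)) / 2 := by
      intro q
      rw [← mul_add, Complex.add_conj]; simp; ring
    simp only [this]
    rw [integral_div, integral_add (hint t) (hint' t), h0, h1]; simp)
  have him := ae_eq_zero_of_integral_exp_real hφ hg.im (fun t => by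
    have : ∀ q, Complex.exp (t * φ q * Complex.I) * ((RCLike.im (g q) : ℝ) : ℂ)
        = (Complex.exp (t * φ q * Complex.I) * g q
          - Complex.exp (t * φ q * Complex.I) * conj (g q)) / (2 * Complex.I) := by
      intro q
      rw [← mul_sub, Complex.sub_conj]; simp; field_simp
    simp only [this]
    rw [integral_div, integral_sub (hint t) (hint' t), h0, h1]; simp)
  filter_upwards [hre, him] with q h2 h3
  exact Complex.ext h2 h3

lemma measurableEmbedding_exp : MeasurableEmbedding Real.exp :=
  Real.isOpenEmbedding_exp.measurableEmbedding

end Fourier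

/-! ### Multiplication operators -/

section Matrices

variable {K X ι ι' : Type*} [NormedAddCommGroup K] [InnerProductSpace ℂ K] [MeasureSpace X]
  [SigmaFinite (volume : Measure X)] [Fintype ι]

/-- Basis vectors cut off to sets of finite measure read off the columns of the symbol, and
countably many such sets exhaust `X`. -/
lemma matrix_ae_ext (W : K ≃ₗᵢ[ℂ] L2 X ι) {m m' : X → Matrix ι' ι ℂ}
    (h : ∀ Φ, ∀ᵐ q, ∀ a, ∑ b, m q a b * W Φ q b = ∑ b, m' q a b * W Φ q b) :
    ∀ᵐ q, m q = m' q := by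
  classical
  have key : ∀ (n : ℕ) (b : ι), ∀ᵐ q, q ∈ spanningSets (volume : Measure X) n →
      ∀ a, m q a b = m' q a b := by
    intro n b
    have h1 := h (W.symm (indL2 (measurableSet_spanningSets (volume : Measure X) n)
      (measure_spanningSets_lt_top _ n) b))
    filter_upwards [h1, indL2_ae (measurableSet_spanningSets (volume : Measure X) n)
      (measure_spanningSets_lt_top _ n) b] with q h1 h2 hq a
    have := h1 a
    rw [LinearIsometryEquiv.apply_symm_apply] at this
    simpa [h2, hq] using this
  filter_upwards [ae_all_iff.2 fun n => ae_all_iff.2 (key n)] with q hq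
  have h2 := iUnion_spanningSets (volume : Measure X)
  obtain ⟨n, hn⟩ := Set.mem_iUnion.1 (h2 ▸ Set.mem_univ q)
  ext a b
  exact hq n b hn a

/-- A multiplication operator is isometric only if its symbol is. -/
lemma conjTranspose_mul_self_ae [DecidableEq ι] (W : K ≃ₗᵢ[ℂ] L2 X ι) {A : K → K}
    {m : X → Matrix ι ι ℂ} (hA : ∀ x y, ⟪A x, A y⟫_ℂ = ⟪x, y⟫_ℂ)
    (hm : ∀ Φ, ∀ᵐ q, ∀ a, W (A Φ) q a = ∑ b, m q a b * W Φ q b) :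
    ∀ᵐ q, (m q).conjTranspose * m q = 1 := by
  have hbc : ∀ b c, (fun q => ((m q).conjTranspose * m q) b c)
      =ᵐ[volume] fun _ => (1 : Matrix ι ι ℂ) b c := by
    intro b c
    -- The entry `(b, c)` of the Gram matrix, integrated over `s`, is the inner product of the
    -- images of `1_s e_b` and `1_s e_c`. Its integrability is part of the claim because `m` carries
    -- no bound.
    have key : ∀ s, MeasurableSet s → volume s < ⊤ →
        IntegrableOn (fun q => ((m q).conjTranspose * m q) b c) s volume ∧
        ∫ q in s, ((m q).conjTranspose * m q) b c = ∫ q in s, (1 : Matrix ι ι ℂ) b c := by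
      intro s hs hs'
      set x := W.symm (indL2 hs hs' b)
      set y := W.symm (indL2 hs hs' c)
      have e1 : (fun q => ⟪W (A x) q, W (A y) q⟫_ℂ)
          =ᵐ[volume] s.indicator fun q => ((m q).conjTranspose * m q) b c := by
        filter_upwards [hm x, hm y, indL2_ae hs hs' b, indL2_ae hs hs' c] with q h1 h2 h3 h4
        simp only [PiLp.inner_apply, RCLike.inner_apply, h1, h2, x, y,
          LinearIsometryEquiv.apply_symm_apply, h3, h4]
        by_cases hq : q ∈ s <;> simp [hq, Matrix.mul_apply, mul_comm]
      have e2 : (fun q => ⟪W x q, W y q⟫_ℂ)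
          =ᵐ[volume] s.indicator fun q => (1 : Matrix ι ι ℂ) b c := by
        filter_upwards [indL2_ae hs hs' b, indL2_ae hs hs' c] with q h3 h4
        simp only [PiLp.inner_apply, RCLike.inner_apply, x, y,
          LinearIsometryEquiv.apply_symm_apply, h3, h4]
        by_cases hq : q ∈ s <;> simp [hq, Matrix.one_apply, eq_comm]
      refine ⟨(integrable_indicator_iff hs).1 ((L2.integrable_inner _ _).congr e1), ?_⟩
      rw [← integral_indicator hs, ← integral_indicator hs, ← integral_congr_ae e1,
        ← integral_congr_ae e2, ← L2.inner_def, ← L2.inner_def, W.inner_map_map,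
        W.inner_map_map, hA]
    refine ae_eq_of_forall_setIntegral_eq_of_sigmaFinite (fun s hs hs' => (key s hs hs').1)
      (fun s hs hs' => ?_) fun s hs hs' => (key s hs hs').2
    exact integrableOn_const hs'.ne
  filter_upwards [ae_all_iff.2 fun b => ae_all_iff.2 (hbc b)] with q hq
  ext b c
  exact hq b c

end Matrices

/-! ### Functions invariant under shifts -/

section Descend

lemma measurePreserving_sign {ε : ℝ} (hε : ε = 1 ∨ ε = -1) (v : ℝ) :
    MeasurePreserving (fun x : ℝ => ε * (x - v)) volume volume := by
  have h := measurePreserving_sub_right (volume : Measure ℝ) v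
  rcases hε with rfl | rfl
  · simpa using h
  · have := (Measure.measurePreserving_neg (volume : Measure ℝ)).comp h
    simpa [Function.comp_def] using this

/-- For each shift the exceptional null set may be different. Fubini converts this into one
horizontal line on which almost all shifts of almost all points behave well, and the values on that
line define `M`. -/
lemma exists_descend {n : Type*} [Fintype n] {ε : ℝ} (hε : ε = 1 ∨ ε = -1)
    {m : ℝ × ℝ → Matrix n n ℂ} (hm : ∀ a b, Measurable fun q => m q a b)
    (h : ∀ s : ℝ, ∀ᵐ q : ℝ × ℝ, m (q.1 - s, q.2 + ε * s) = m q) :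
    ∃ M : ℝ → Matrix n n ℂ, (∀ a b, Measurable fun q => M q a b) ∧
      ∀ᵐ q : ℝ × ℝ, m q = M (q.1 + ε * q.2) := by
  have hε2 : ε * ε = 1 := by rcases hε with rfl | rfl <;> norm_num
  have h1 : ∀ᵐ x : ℝ × (ℝ × ℝ), m (x.2.1 - x.1, x.2.2 + ε * x.1) = m x.2 := by
    have hS : MeasurableSet {x : ℝ × (ℝ × ℝ) | m (x.2.1 - x.1, x.2.2 + ε * x.1) = m x.2} := by
      have : {x : ℝ × (ℝ × ℝ) | m (x.2.1 - x.1, x.2.2 + ε * x.1) = m x.2} =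
          ⋂ a, ⋂ b, {x : ℝ × (ℝ × ℝ) | m (x.2.1 - x.1, x.2.2 + ε * x.1) a b = m x.2 a b} := by
        ext x
        simp only [Set.mem_ofPred_eq, Set.mem_iInter]
        exact ⟨fun h a b => by rw [h], fun h => by ext a b; exact h a b⟩
      rw [this]
      refine MeasurableSet.iInter fun a => MeasurableSet.iInter fun b => measurableSet_eq_fun ?_ ?_
      · exact (hm a b).comp (by fun_prop)
      · exact (hm a b).comp (by fun_prop)
    exact (Measure.ae_prod_mem_iff_ae_ae_mem hS).2 (Eventually.of_forall h)
  have hτ : MeasurePreserving (fun x : ℝ × (ℝ × ℝ) => (x.2.1, x.2.2, x.1)) volume volume :=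
    (volume_preserving_prodAssoc (α₁ := ℝ) (β₁ := ℝ) (γ₁ := ℝ)).comp
      (Measure.measurePreserving_swap (μ := (volume : Measure ℝ)))
  have h2 : ∀ᵐ v : ℝ, ∀ᵐ x : ℝ × ℝ, m (x.2 - x.1, v + ε * x.1) = m (x.2, v) :=
    Measure.ae_ae_of_ae_prod (hτ.quasiMeasurePreserving.ae h1)
  -- `v` is the height of a good line. A point `p` is carried to it along `q₁ + ε q₂ = const`,
  -- arriving at the first coordinate `p.1 + ε (p.2 - v)`.
  obtain ⟨v, hv⟩ := h2.exists
  refine ⟨fun u => m (u - ε * v, v), fun a b => (hm a b).comp (by fun_prop), ?_⟩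
  have hσ : MeasurePreserving (fun p : ℝ × ℝ => (ε * (p.2 - v), p.1 + ε * (p.2 - v)))
      volume volume := by
    have e1 : MeasurePreserving (fun p : ℝ × ℝ => (ε * (p.2 - v), p.1)) volume volume :=
      ((measurePreserving_sign hε v).prod (MeasurePreserving.id volume)).comp
        (Measure.measurePreserving_swap (μ := (volume : Measure ℝ)))
    have e2 : MeasurePreserving (fun p : ℝ × ℝ => (p.1, p.2 + p.1)) volume volume := by
      have := measurePreserving_prod_add (volume : Measure ℝ) (volume : Measure ℝ)
      simpa [add_comm] using! this
    exact e2.comp e1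
  filter_upwards [hσ.quasiMeasurePreserving.ae hv] with p hp
  have : p = (p.1 + ε * (p.2 - v) - ε * (p.2 - v), v + ε * (ε * (p.2 - v))) := by
    ext
    · simp
    · simp only; rw [← mul_assoc, hε2]; ring
  rw [← this] at hp
  rw [hp]
  congr 2
  ring

end Descend

end LRScattering

end

noncomputable section

namespace LRScattering

/-! ### Operators commuting with translations and boosts -/

section Commutant

variable {𝓗 𝓗₁ 𝓗₂ : Type*} [NormedAddCommGroup 𝓗] [InnerProductSpace ℂ 𝓗] [CompleteSpace 𝓗]
  [NormedAddCommGroup 𝓗₁] [InnerProductSpace ℂ 𝓗₁] [CompleteSpace 𝓗₁]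
  [NormedAddCommGroup 𝓗₂] [InnerProductSpace ℂ 𝓗₂] [CompleteSpace 𝓗₂]
  {ι κ : Type*} [Fintype ι] [Fintype κ]
  {P : StandardPair 𝓗} {P₁ : StandardPair 𝓗₁} {P₂ : StandardPair 𝓗₂}

/-- The vector which is a Gaussian centered at `0` in the component `γ`. -/
def Parametrization.omega [DecidableEq ι] (X : Parametrization P ι) (γ : ι) : 𝓗 :=
  X.V.symm (gaussL2 one_pos 0 (EuclideanSpace.single γ 1))

lemma Parametrization.omega_ae [DecidableEq ι] (X : Parametrization P ι) (γ : ι) :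
    ∀ᵐ q, ∀ α, X.V (X.omega γ) q α = if α = γ then gauss 1 0 q else 0 := by
  filter_upwards [gaussL2_ae one_pos 0 (EuclideanSpace.single γ (1 : ℂ))] with q hq α
  rw [Parametrization.omega, LinearIsometryEquiv.apply_symm_apply, hq]
  simp [PiLp.single_apply]

/-- The translates of the Gaussian vectors are total. -/
lemma Parametrization.dense_span_omega [DecidableEq ι] (X : Parametrization P ι) :
    Dense (Submodule.span ℂ (Set.range fun p : ℝ × ι => P.T p.1 (X.omega p.2)) : Set 𝓗) := by
  rw [Submodule.dense_iff_topologicalClosure_eq_top, Submodule.topologicalClosure_eq_top_iff,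
    Submodule.eq_bot_iff]
  intro y hy
  have hy' : ∀ t γ, ⟪P.T t (X.omega γ), y⟫_ℂ = 0 := fun t γ =>
    (Submodule.mem_orthogonal _ _).1 hy _ (Submodule.subset_span ⟨(t, γ), rfl⟩)
  have hz : ∀ γ, ∀ᵐ q, X.V y q γ = 0 := by
    intro γ
    have hmem : MemLp (fun q => X.V y q γ) 2 volume :=
      (EuclideanSpace.proj (𝕜 := ℂ) γ).comp_memLp' (Lp.memLp (X.V y))
    have hint : Integrable fun q => conj (gauss 1 0 q) * X.V y q γ := by
      have h1 : MemLp (fun q => conj (gauss 1 0 q)) 2 volume :=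
        Complex.conjLIE.toContinuousLinearEquiv.toContinuousLinearMap.comp_memLp'
          (memLp_gauss one_pos 0)
      exact h1.integrable_mul hmem
    -- Orthogonality to all translates is the vanishing of a Fourier integral in the variable `e^q`.
    -- The translation by `-t` appears because the inner product is conjugate linear on the left.
    have h0 := ae_eq_zero_of_integral_exp measurableEmbedding_exp hint fun t => by
      refine Eq.trans ?_ (hy' (-t) γ)
      rw [← X.V.inner_map_map, L2.inner_def]
      refine integral_congr_ae ?_
      filter_upwards [X.translation (-t) (X.omega γ), X.omega_ae γ] with q h1 h2
      simp only [PiLp.inner_apply, RCLike.inner_apply, h1, h2]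
      rw [Finset.sum_eq_single γ]
      · simp only [if_true, map_mul, ← Complex.exp_conj, Complex.conj_I, Complex.conj_ofReal]
        rw [mul_comm (X.V y q γ), ← mul_assoc]
        congr 3
        push_cast
        ring
      · intro b _ hb; simp [hb]
      · simp
    filter_upwards [h0] with q hq
    have := gauss_ne_zero 1 0 q
    simpa [this] using hq
  rw [← X.V.map_eq_zero_iff]
  refine L2_ext ?_
  filter_upwards [ae_all_iff.2 hz, Lp.coeFn_zero (EuclideanSpace ℂ ι) 2
    (volume : Measure ℝ)] with q h1 h2 a
  rw [h1, h2]; rfl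

/-- The identification of the tensor product with an `L²`-space of functions of two variables. -/
abbrev pairL2 (X₁ : Parametrization P₁ ι) (X₂ : Parametrization P₂ κ) :
    HTensor 𝓗₁ 𝓗₂ ≃ₗᵢ[ℂ] L2 (ℝ × ℝ) (ι × κ) := tensorL2 X₁.V X₂.V

lemma tmap_translation_ae [DecidableEq ι] [DecidableEq κ] (X₁ : Parametrization P₁ ι)
    (X₂ : Parametrization P₂ κ) (t₁ t₂ : ℝ) (Φ : HTensor 𝓗₁ 𝓗₂) : ∀ᵐ q : ℝ × ℝ, ∀ a,
    pairL2 X₁ X₂ (tmap (P₁.T t₁) (P₂.T t₂) Φ) q a =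
      Complex.exp (Complex.I * t₁ * Real.exp q.1) * Complex.exp (Complex.I * t₂ * Real.exp q.2) *
        pairL2 X₁ X₂ Φ q a := by
  have := tmap_ae X₁.V X₂.V X₁.V X₂.V (P₁.T t₁) (P₂.T t₂) (MeasurePreserving.id _)
    (MeasurePreserving.id _)
    (fun q => Matrix.diagonal fun _ => Complex.exp (Complex.I * t₁ * Real.exp q))
    (fun q => Matrix.diagonal fun _ => Complex.exp (Complex.I * t₂ * Real.exp q))
    (fun x => by
      filter_upwards [X₁.translation t₁ x] with q h a
      simp [h, Matrix.diagonal_apply])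
    (fun x => by
      filter_upwards [X₂.translation t₂ x] with q h a
      simp [h, Matrix.diagonal_apply]) Φ
  filter_upwards [this] with q h a
  rw [h, Finset.sum_eq_single a]
  · simp
  · intro b _ hb
    by_cases h1 : a.1 = b.1
    · have h2 : a.2 ≠ b.2 := fun h2 => hb (Prod.ext h1 h2).symm
      simp [Matrix.diagonal_apply_ne _ h2]
    · simp [Matrix.diagonal_apply_ne _ h1]
  · simp

lemma tmap_modular_ae [DecidableEq ι] [DecidableEq κ] (X₁ : Parametrization P₁ ι)
    (X₂ : Parametrization P₂ κ) (t₁ t₂ : ℝ) (Φ : HTensor 𝓗₁ 𝓗₂) : ∀ᵐ q : ℝ × ℝ, ∀ a,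
    pairL2 X₁ X₂ (tmap (X₁.U t₁) (X₂.U t₂) Φ) q a =
      pairL2 X₁ X₂ Φ (q.1 - 2 * Real.pi * t₁, q.2 - 2 * Real.pi * t₂) a := by
  have := tmap_ae X₁.V X₂.V X₁.V X₂.V (X₁.U t₁) (X₂.U t₂)
    (measurePreserving_sub_right (volume : Measure ℝ) (2 * Real.pi * t₁))
    (measurePreserving_sub_right (volume : Measure ℝ) (2 * Real.pi * t₂))
    (fun q => 1) (fun q => 1)
    (fun x => by
      filter_upwards [X₁.modularGroup t₁ x] with q h a
      simp [h, Matrix.one_apply])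
    (fun x => by
      filter_upwards [X₂.modularGroup t₂ x] with q h a
      simp [h, Matrix.one_apply]) Φ
  filter_upwards [this] with q h a
  rw [h, Finset.sum_eq_single a]
  · simp
  · intro b _ hb
    by_cases h1 : a.1 = b.1
    · have h2 : a.2 ≠ b.2 := fun h2 => hb (Prod.ext h1 h2).symm
      simp [h2]
    · simp [h1]
  · simp

/-- An operator commuting with all translations is a multiplication operator. -/
lemma exists_symbol [DecidableEq ι] [DecidableEq κ] (X₁ : Parametrization P₁ ι)
    (X₂ : Parametrization P₂ κ) (A : HTensor 𝓗₁ 𝓗₂ →L[ℂ] HTensor 𝓗₁ 𝓗₂)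
    (hA : ∀ t₁ t₂, Commute A (tmap (P₁.T t₁) (P₂.T t₂))) :
    ∃ m : ℝ × ℝ → Matrix (ι × κ) (ι × κ) ℂ, (∀ a b, Measurable fun q => m q a b) ∧
      ∀ Φ, ∀ᵐ q, ∀ a, pairL2 X₁ X₂ (A Φ) q a = ∑ b, m q a b * pairL2 X₁ X₂ Φ q b := by
  -- If `A` multiplies by a matrix function, its column `b` is the image of the Gaussian in
  -- component `b` divided by that Gaussian, which vanishes nowhere. This quotient serves as the
  -- definition.
  refine ⟨fun q => Matrix.of fun a b =>
    pairL2 X₁ X₂ (A (tpure (X₁.omega b.1) (X₂.omega b.2))) q a / (gauss 1 0 q.1 * gauss 1 0 q.2),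
    fun a b => ?_, ?_⟩
  · have h1 : Measurable fun q => pairL2 X₁ X₂ (A (tpure (X₁.omega b.1) (X₂.omega b.2))) q a :=
      (EuclideanSpace.proj (𝕜 := ℂ) a).continuous.measurable.comp
        (Lp.stronglyMeasurable _).measurable
    have h2 := (continuous_gauss 1 0).measurable
    exact h1.div ((h2.comp measurable_fst).mul (h2.comp measurable_snd))
  · refine acts_of_dense (pairL2 X₁ X₂) (pairL2 X₁ X₂) A
      (τ := id) (MeasurePreserving.id _).quasiMeasurePreserving _
      (dense_span_tpure X₁.dense_span_omega X₂.dense_span_omega) ?_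
    rintro _ ⟨_, ⟨⟨t₁, γ⟩, rfl⟩, _, ⟨⟨t₂, δ⟩, rfl⟩, rfl⟩
    have hc : A (tmap (P₁.T t₁) (P₂.T t₂) (tpure (X₁.omega γ) (X₂.omega δ)))
        = tmap (P₁.T t₁) (P₂.T t₂) (A (tpure (X₁.omega γ) (X₂.omega δ))) :=
      congrArg (fun B : HTensor 𝓗₁ 𝓗₂ →L[ℂ] HTensor 𝓗₁ 𝓗₂ =>
        B (tpure (X₁.omega γ) (X₂.omega δ))) (hA t₁ t₂).eq
    simp only
    rw [← tmap_tpure, hc]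
    filter_upwards [tmap_translation_ae X₁ X₂ t₁ t₂ (A (tpure (X₁.omega γ) (X₂.omega δ))),
      tmap_translation_ae X₁ X₂ t₁ t₂ (tpure (X₁.omega γ) (X₂.omega δ)),
      tensorL2_tpure_ae X₁.V X₂.V (X₁.omega γ) (X₂.omega δ),
      ae_fst (Y := ℝ) (X₁.omega_ae γ), ae_snd (X := ℝ) (X₂.omega_ae δ)] with q h1 h2 h3 h4 h5 a
    rw [h1, Finset.sum_eq_single (γ, δ)]
    · rw [id, h2, h3, h4, h5]
      have := gauss_ne_zero 1 0 q.1
      have := gauss_ne_zero 1 0 q.2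
      simp only [Matrix.of_apply, if_true]
      field_simp
    · intro b _ hb
      rw [id, h2, h3, h4, h5]
      by_cases h6 : b.1 = γ
      · have h7 : b.2 ≠ δ := fun h7 => hb (Prod.ext h6 h7)
        simp [h7]
      · simp [h6]
    · simp

/-- An operator commuting with all translations and boosts is the multiplication by a function of
the sum or difference of the two variables. -/
lemma exists_symbol_sum [DecidableEq ι] [DecidableEq κ] (X₁ : Parametrization P₁ ι)
    (X₂ : Parametrization P₂ κ) (A : HTensor 𝓗₁ 𝓗₂ →L[ℂ] HTensor 𝓗₁ 𝓗₂)
    (hA : ∀ t₁ t₂, Commute A (tmap (P₁.T t₁) (P₂.T t₂))) {ε : ℝ} (hε : ε = 1 ∨ ε = -1)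
    (hU : ∀ t, Commute A (tmap (X₁.U t) (X₂.U (-ε * t)))) :
    ∃ M : ℝ → Matrix (ι × κ) (ι × κ) ℂ, (∀ a b, Measurable fun q => M q a b) ∧
      ∀ Φ, ∀ᵐ q : ℝ × ℝ, ∀ a,
        pairL2 X₁ X₂ (A Φ) q a = ∑ b, M (q.1 + ε * q.2) a b * pairL2 X₁ X₂ Φ q b := by
  obtain ⟨m, hm, h⟩ := exists_symbol X₁ X₂ A hA
  obtain ⟨M, hM, hmM⟩ := exists_descend hε hm <| by
    intro s
    -- `Δ^{it}` translates by `2πt`, so this parameter produces the shift by `s`.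
    set t := -s / (2 * Real.pi) with ht
    have hs : 2 * Real.pi * t = -s := by rw [ht]; field_simp
    have hτ : MeasurePreserving (fun q : ℝ × ℝ => (q.1 - s, q.2 + ε * s)) volume volume :=
      (measurePreserving_sub_right (volume : Measure ℝ) s).prod
        (measurePreserving_add_right (volume : Measure ℝ) (ε * s))
    refine matrix_ae_ext (pairL2 X₁ X₂) fun Φ => ?_
    have hc : A (tmap (X₁.U t) (X₂.U (-ε * t)) Φ) = tmap (X₁.U t) (X₂.U (-ε * t)) (A Φ) :=
      congrArg (fun B : HTensor 𝓗₁ 𝓗₂ →L[ℂ] HTensor 𝓗₁ 𝓗₂ => B Φ) (hU t).eq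
    have e1 := h (tmap (X₁.U t) (X₂.U (-ε * t)) Φ)
    rw [hc] at e1
    filter_upwards [hτ.quasiMeasurePreserving.ae e1, h Φ,
      hτ.quasiMeasurePreserving.ae (tmap_modular_ae X₁ X₂ t (-ε * t) (A Φ)),
      hτ.quasiMeasurePreserving.ae (tmap_modular_ae X₁ X₂ t (-ε * t) Φ)] with q h1 h2 h3 h4 a
    have hq : (q.1 - s - 2 * Real.pi * t, q.2 + ε * s - 2 * Real.pi * (-ε * t)) = q := by
      ext
      · simp only [hs]; ring
      · simp only
        linear_combination ε * hs
    simp only [hq] at h3 h4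
    rw [← h2, ← h3, h1]
    exact Finset.sum_congr rfl fun b _ => by rw [h4]
  refine ⟨M, hM, fun Φ => ?_⟩
  filter_upwards [h Φ, hmM] with q h1 h2 a
  rw [h1, h2]

end Commutant

end LRScattering

end

noncomputable section

namespace LRScattering

/-! ### Almost everywhere convergence of radial approximate identities -/

section Radial

/-- After the substitution `u = x + ε s` this is Lebesgue differentiation on intervals of radius `r
ε` about `x`. The exceptional set does not depend on `r`, which the superposition over radii needs.
-/
lemma tendsto_integral_symm_interval {m : ℝ → ℂ} (hm : LocallyIntegrable m) :
    ∀ᵐ x, ∀ r > 0, Tendsto (fun ε : ℝ => ∫ s in Set.Ioo (-r) r, m (x + ε * s)) (𝓝[>] 0)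
      (𝓝 ((2 * r : ℝ) * m x)) := by
  filter_upwards [IsUnifLocDoublingMeasure.ae_tendsto_average volume hm 1] with x hx r hr
  have h1 : Tendsto (fun ε : ℝ => r * ε) (𝓝[>] 0) (𝓝[>] 0) := by
    refine tendsto_nhdsWithin_iff.2 ⟨?_, ?_⟩
    · have : Tendsto (fun ε : ℝ => r * ε) (𝓝 0) (𝓝 (r * 0)) := by
        exact tendsto_id.const_mul r
      simpa using this.mono_left nhdsWithin_le_nhds
    · filter_upwards [self_mem_nhdsWithin] with ε hε
      exact mul_pos hr hε
  have h2 := hx (fun _ => x) (fun ε => r * ε) h1 (by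
    filter_upwards [self_mem_nhdsWithin] with ε hε
    have : 0 < r * ε := mul_pos hr hε
    simpa using this.le)
  refine (h2.const_mul ((2 * r : ℝ) : ℂ)).congr' ?_
  filter_upwards [self_mem_nhdsWithin] with ε hε
  have hε' : 0 < ε := hε
  have hrε := mul_pos hr hε'
  rw [setAverage_eq, Real.closedBall_eq_Icc, integral_Icc_eq_integral_Ioc,
    ← intervalIntegral.integral_of_le (by linarith), integral_Ioc_eq_integral_Ioo.symm,
    ← intervalIntegral.integral_of_le (by linarith),
    intervalIntegral.integral_comp_add_mul (fun u => m u) hε'.ne']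
  simp only [Real.volume_real_Icc]
  rw [max_eq_left (by linarith), Complex.real_smul, Complex.real_smul, ← mul_assoc]
  congr 1
  · push_cast
    field_simp
    have : (r : ℂ) ≠ 0 := by exact_mod_cast hr.ne'
    have : (ε : ℂ) ≠ 0 := by exact_mod_cast hε'.ne'
    ring_nf
    field_simp
  · congr 1 <;> ring

/-- Convergence almost everywhere of the convolutions with the dilations of the radial kernel
`K(s) = ∫_{r > |s|} k(r) dr`. -/
lemma ae_tendsto_integral_radial {k K : ℝ → ℝ} (hk : Measurable k) (hk0 : ∀ r > 0, 0 ≤ k r)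
    (hkint : IntegrableOn (fun r => r * k r) (Set.Ioi 0))
    (hK : ∀ s, s ≠ 0 → K s = ∫ r in Set.Ioi |s|, k r) {m : ℝ → ℂ} (hm : Measurable m) {C : ℝ}
    (hC : ∀ x, ‖m x‖ ≤ C) :
    ∀ᵐ x, Tendsto (fun ε : ℝ => ∫ s, (K s : ℂ) * m (x + ε * s)) (𝓝[>] 0)
      (𝓝 ((∫ s, (K s : ℂ)) * m x)) := by
  have hC0 : 0 ≤ C := (norm_nonneg _).trans (hC 0)
  have hloc : LocallyIntegrable m := by
    refine (locallyIntegrable_const (C : ℝ)).mono hm.aestronglyMeasurable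
      (Eventually.of_forall fun x => ?_)
    rw [Real.norm_of_nonneg hC0]; exact hC x
  -- layer cake
  have hT : MeasurableSet {p : ℝ × ℝ | |p.1| < p.2} :=
    measurableSet_lt (by fun_prop) (by fun_prop)
  have layer : ∀ f : ℝ → ℂ, Measurable f → (∃ D, ∀ x, ‖f x‖ ≤ D) → ∫ s, (K s : ℂ) * f s =
      ∫ r in Set.Ioi (0 : ℝ), (k r : ℂ) * ∫ s in Set.Ioo (-r) r, f s := by
    rintro f hf ⟨D, hD⟩
    let g : ℝ × ℝ → ℂ := {p : ℝ × ℝ | |p.1| < p.2}.indicator fun p => (k p.2 : ℂ) * f p.1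
    have hgm : Measurable g := by
      refine Measurable.indicator ?_ hT
      exact (Complex.measurable_ofReal.comp (hk.comp measurable_snd)).mul (hf.comp measurable_fst)
    have hg1 : ∀ s r, g (s, r) = (Set.Ioi |s|).indicator (fun r => (k r : ℂ) * f s) r := by
      intro s r; simp [g, Set.indicator_apply]
    have hg2 : ∀ s r, g (s, r) = (Set.Ioo (-r) r).indicator (fun s => (k r : ℂ) * f s) s := by
      intro s r; simp [g, Set.indicator_apply, abs_lt]
    have hgint : Integrable g (volume.prod volume) := by
      rw [integrable_prod_iff' hgm.aestronglyMeasurable]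
      constructor
      · refine Eventually.of_forall fun r => ?_
        simp only [hg2]
        rw [integrable_indicator_iff measurableSet_Ioo]
        refine Measure.integrableOn_of_bounded (M := ‖(k r : ℂ)‖ * D) (by simp)
          (by fun_prop) (Eventually.of_forall fun s => ?_)
        rw [norm_mul]
        exact mul_le_mul_of_nonneg_left (hD s) (norm_nonneg _)
      · have hbound : IntegrableOn (fun r => 2 * D * (r * k r)) (Set.Ioi 0) := hkint.const_mul _
        refine Integrable.mono ((integrable_indicator_iff measurableSet_Ioi).2 hbound) ?_
          (Eventually.of_forall fun r => ?_)
        · exact (hgm.norm.stronglyMeasurable.integral_prod_left').aestronglyMeasurable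
        · simp only [hg2, norm_indicator_eq_indicator_norm]
          rw [integral_indicator measurableSet_Ioo, Real.norm_of_nonneg
            (setIntegral_nonneg measurableSet_Ioo fun _ _ => norm_nonneg _)]
          by_cases hr : 0 < r
          · rw [Set.indicator_of_mem (by exact hr)]
            refine (setIntegral_mono_on (g := fun _ => k r * D) ?_ (integrableOn_const (by simp))
              measurableSet_Ioo fun s _ => ?_).trans ?_
            · refine Measure.integrableOn_of_bounded (M := ‖(k r : ℂ)‖ * D) (by simp)
                (by fun_prop) (Eventually.of_forall fun s => ?_)
              rw [norm_norm, norm_mul]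
              exact mul_le_mul_of_nonneg_left (hD s) (norm_nonneg _)
            · rw [norm_mul, Complex.norm_real, Real.norm_of_nonneg (hk0 r hr)]
              exact mul_le_mul_of_nonneg_left (hD s) (hk0 r hr)
            · rw [setIntegral_const, Real.volume_real_Ioo_of_le (by linarith), smul_eq_mul]
              refine le_trans (le_of_eq ?_) (le_abs_self _)
              ring
          · rw [Set.Ioo_eq_empty (by linarith), Set.indicator_of_notMem (by exact hr)]
            simp
    calc ∫ s, (K s : ℂ) * f s = ∫ s, ∫ r, g (s, r) := by
          refine integral_congr_ae ?_
          filter_upwards [compl_mem_ae_iff.2 (measure_singleton (0 : ℝ))] with s hs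
          simp only [hg1]
          rw [integral_indicator measurableSet_Ioi, integral_mul_const, integral_complex_ofReal,
            hK s hs]
      _ = ∫ r, ∫ s, g (s, r) := integral_integral_swap hgint
      _ = ∫ r, (Set.Ioi (0 : ℝ)).indicator
            (fun r => (k r : ℂ) * ∫ s in Set.Ioo (-r) r, f s) r := by
          refine integral_congr_ae (Eventually.of_forall fun r => ?_)
          simp only [hg2]
          rw [integral_indicator measurableSet_Ioo, integral_const_mul]
          by_cases hr : 0 < r
          · rw [Set.indicator_of_mem (by exact hr)]
          · rw [Set.indicator_of_notMem (by exact hr), Set.Ioo_eq_empty (by linarith)]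
            simp
      _ = _ := integral_indicator measurableSet_Ioi
  filter_upwards [tendsto_integral_symm_interval hloc] with x hx
  have h1 : ∀ ε : ℝ, ∫ s, (K s : ℂ) * m (x + ε * s) =
      ∫ r in Set.Ioi (0 : ℝ), (k r : ℂ) * ∫ s in Set.Ioo (-r) r, m (x + ε * s) := fun ε =>
    layer (fun s => m (x + ε * s)) (by fun_prop) ⟨C, fun s => hC _⟩
  have h2 : (∫ s, (K s : ℂ)) * m x = ∫ r in Set.Ioi (0 : ℝ), (k r : ℂ) * ((2 * r : ℝ) * m x) := by
    have := layer (fun _ => m x) (by fun_prop) ⟨C, fun s => hC _⟩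
    rw [integral_mul_const] at this
    rw [this]
    refine setIntegral_congr_fun measurableSet_Ioi fun r hr => ?_
    have hr' : (0 : ℝ) < r := hr
    rw [setIntegral_const, Real.volume_real_Ioo_of_le (by linarith), Complex.real_smul]
    congr 3
    ring
  simp only [h1, h2]
  -- The inner integral runs over an interval of length `2r` with integrand bounded by `C`, so the
  -- dominating function does not depend on `ε`.
  refine tendsto_integral_filter_of_dominated_convergence (fun r => 2 * C * (r * k r)) ?_ ?_
    (hkint.const_mul _) ?_
  · refine Eventually.of_forall fun ε => ?_
    refine (Measurable.mul (by fun_prop) ?_).aestronglyMeasurable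
    have h3 : Measurable (fun p : ℝ × ℝ =>
        {p : ℝ × ℝ | |p.2| < p.1}.indicator (fun p => m (x + ε * p.2)) p) :=
      Measurable.indicator (by fun_prop) (measurableSet_lt (by fun_prop) (by fun_prop))
    have h4 : (fun r : ℝ => ∫ s in Set.Ioo (-r) r, m (x + ε * s)) =
        fun r => ∫ s, {p : ℝ × ℝ | |p.2| < p.1}.indicator (fun p => m (x + ε * p.2)) (r, s) := by
      funext r
      rw [← integral_indicator measurableSet_Ioo]
      simp [Set.indicator_apply, abs_lt]
    rw [h4]
    exact h3.stronglyMeasurable.integral_prod_right.measurable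
  · refine Eventually.of_forall fun ε => ?_
    filter_upwards [ae_restrict_mem measurableSet_Ioi] with r hr
    have hr' : (0 : ℝ) < r := hr
    rw [norm_mul, Complex.norm_real, Real.norm_of_nonneg (hk0 r hr)]
    have := norm_setIntegral_le_of_norm_le_const (μ := volume) (s := Set.Ioo (-r) r)
      (f := fun s => m (x + ε * s)) (C := C) (by simp) (fun s _ => hC _)
    rw [Real.volume_real_Ioo_of_le (by linarith)] at this
    calc k r * _ ≤ k r * (C * (r - -r)) := mul_le_mul_of_nonneg_left this (hk0 r hr)
      _ = _ := by ring
  · filter_upwards [ae_restrict_mem measurableSet_Ioi] with r hr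
    exact (hx r hr).const_mul _

end Radial

end LRScattering

end

noncomputable section

namespace LRScattering

/-! ### Gaussian regularizations -/

section GaussConv

/-- The integral of `y` against the Gaussian with complex center `z`. -/
def gaussConv (a : ℝ) (y : ℝ → ℂ) (z : ℂ) : ℂ := ∫ q, gauss a z q * y q

lemma hasDerivAt_gauss (a : ℝ) (q : ℝ) (w : ℂ) :
    HasDerivAt (fun w => gauss a w q) (2 * a * (q - w) * gauss a w q) w := by
  have h1 : HasDerivAt (fun w : ℂ => -(a : ℂ) * ((q : ℂ) - w) ^ 2)
      (-(a : ℂ) * (2 * ((q : ℂ) - w) * -1)) w := by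
    have := (((hasDerivAt_id w).const_sub (q : ℂ)).pow 2).const_mul (-(a : ℂ))
    simpa using this
  refine h1.cexp.congr_deriv ?_
  rw [gauss]
  ring

/-- A bound uniform in the center near `w₀` is needed to differentiate under the integral.
Recentering at `Re w₀` lowers the exponent from `a` to `a/2`, and absorbing the linear factor `q -
w` lowers it to `a/4`. -/
lemma norm_deriv_gauss_le {a : ℝ} (ha : 0 < a) (w₀ : ℂ) : ∃ D, ∀ w ∈ Metric.ball w₀ 1, ∀ q : ℝ,
    ‖2 * a * (q - w) * gauss a w q‖ ≤ D * Real.exp (-(a / 4) * (q - w₀.re) ^ 2) := by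
  refine ⟨2 * a * (2 + |w₀.im| + 4 / a) * Real.exp (a * (|w₀.im| + 1) ^ 2 + a),
    fun w hw q => ?_⟩
  have hw' : ‖w - w₀‖ < 1 := by simpa [dist_eq_norm] using hw
  have hre : |w.re - w₀.re| ≤ 1 := (Complex.abs_re_le_norm (w - w₀)).trans hw'.le
  have him : |w.im - w₀.im| ≤ 1 := (Complex.abs_im_le_norm (w - w₀)).trans hw'.le
  set t := q - w₀.re with ht
  have e1 : t ^ 2 ≤ 4 / a * Real.exp (a / 4 * t ^ 2) := by
    have := Real.add_one_le_exp (a / 4 * t ^ 2)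
    rw [div_mul_eq_mul_div, le_div_iff₀ ha]
    linarith
  have e2 : 1 ≤ Real.exp (a / 4 * t ^ 2) := Real.one_le_exp (by positivity)
  have e3 : ‖(q : ℂ) - w‖ ≤ (2 + |w₀.im| + 4 / a) * Real.exp (a / 4 * t ^ 2) := by
    have h1 : ‖(q : ℂ) - w‖ ≤ |t| + |w₀.im| + 1 := by
      have : (q : ℂ) - w = (t : ℂ) + (-(w₀.im : ℂ) * Complex.I) + (w₀ - w) := by
        apply Complex.ext <;> simp [ht]
        ring
      rw [this]
      refine (norm_add_le _ _).trans (add_le_add ((norm_add_le _ _).trans ?_) ?_)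
      · simp
      · rw [norm_sub_rev]; exact hw'.le
    have h2 : |t| ≤ 1 + t ^ 2 := by
      rw [← sq_abs]; nlinarith [sq_nonneg (|t| - 1), abs_nonneg t]
    calc ‖(q : ℂ) - w‖ ≤ (2 + |w₀.im|) * 1 + t ^ 2 := by linarith
      _ ≤ (2 + |w₀.im|) * Real.exp (a / 4 * t ^ 2) + 4 / a * Real.exp (a / 4 * t ^ 2) := by
          gcongr
      _ = _ := by ring
  have e4 : ‖gauss a w q‖ ≤ Real.exp (a * (|w₀.im| + 1) ^ 2 + a) *
      Real.exp (-(a / 2) * t ^ 2) := by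
    rw [norm_gauss, ← Real.exp_add, ← Real.exp_add, Real.exp_le_exp]
    have h1 : w.im ^ 2 ≤ (|w₀.im| + 1) ^ 2 := by
      rw [← sq_abs]
      have : |w.im| ≤ |w₀.im| + 1 := by
        have := abs_add_le (w.im - w₀.im) w₀.im
        simp only [sub_add_cancel] at this
        linarith
      gcongr
    have h2 : (w.re - w₀.re) ^ 2 ≤ 1 := by
      rw [← sq_abs]; nlinarith [abs_nonneg (w.re - w₀.re)]
    have h3 : t ^ 2 ≤ 2 * (q - w.re) ^ 2 + 2 := by
      have : t = (q - w.re) + (w.re - w₀.re) := by rw [ht]; ring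
      rw [this]
      nlinarith [sq_nonneg ((q - w.re) - (w.re - w₀.re))]
    nlinarith [mul_le_mul_of_nonneg_left h1 ha.le, mul_le_mul_of_nonneg_left h3 ha.le]
  calc ‖2 * a * (q - w) * gauss a w q‖ = 2 * a * ‖(q : ℂ) - w‖ * ‖gauss a w q‖ := by
        simp [abs_of_pos ha]
    _ ≤ 2 * a * ((2 + |w₀.im| + 4 / a) * Real.exp (a / 4 * t ^ 2)) *
        (Real.exp (a * (|w₀.im| + 1) ^ 2 + a) * Real.exp (-(a / 2) * t ^ 2)) := by
        gcongr
    _ = 2 * a * (2 + |w₀.im| + 4 / a) * Real.exp (a * (|w₀.im| + 1) ^ 2 + a) *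
        (Real.exp (a / 4 * t ^ 2) * Real.exp (-(a / 2) * t ^ 2)) := by ring
    _ = _ := by
        rw [← Real.exp_add]
        congr 2
        ring

/-- The functions which are integrable against all Gaussians. -/
def GaussIntegrable (y : ℝ → ℂ) : Prop :=
  AEStronglyMeasurable y volume ∧
    ∀ b > 0, ∀ x : ℝ, Integrable fun q => Real.exp (-b * (q - x) ^ 2) * ‖y q‖

lemma GaussIntegrable.integrable {y : ℝ → ℂ} (hy : GaussIntegrable y) {a : ℝ} (ha : 0 < a)
    (z : ℂ) : Integrable fun q => gauss a z q * y q := by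
  refine ((hy.2 a ha z.re).const_mul (Real.exp (a * z.im ^ 2))).mono'
    ((continuous_gauss a z).aestronglyMeasurable.mul hy.1) (Eventually.of_forall fun q => ?_)
  rw [norm_mul, norm_gauss, mul_assoc]

lemma GaussIntegrable.of_bounded {y : ℝ → ℂ} (hy : AEStronglyMeasurable y volume) {C : ℝ}
    (hC : ∀ q, ‖y q‖ ≤ C) : GaussIntegrable y := by
  refine ⟨hy, fun b hb x => ?_⟩
  exact (integrable_exp_sq hb x).mul_bdd (c := C) hy.norm
    (Eventually.of_forall fun q => by simpa using hC q)

lemma GaussIntegrable.of_memLp {y : ℝ → ℂ} (hy : MemLp y 2 volume) : GaussIntegrable y := by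
  refine ⟨hy.1, fun b hb x => ?_⟩
  have h1 : MemLp (fun q => Real.exp (-b * (q - x) ^ 2)) 2 volume := by
    convert (memLp_gauss hb (x : ℂ)).norm using 2 with q
    simp [norm_gauss]
  exact h1.integrable_mul hy.norm

/-- The derivative is dominated by a Gaussian of exponent `a/4`; this is why `GaussIntegrable` asks
for integrability against Gaussians of every width. -/
lemma GaussIntegrable.differentiable {y : ℝ → ℂ} (hy : GaussIntegrable y) {a : ℝ} (ha : 0 < a) :
    Differentiable ℂ (gaussConv a y) := by
  intro w₀
  obtain ⟨D, hD⟩ := norm_deriv_gauss_le ha w₀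
  have hm : ∀ w : ℂ, AEStronglyMeasurable (fun q : ℝ => gauss a w q * y q) volume := fun w =>
    (continuous_gauss a w).aestronglyMeasurable.mul hy.1
  refine (hasDerivAt_integral_of_dominated_loc_of_deriv_le (μ := volume) (𝕜 := ℂ)
    (F := fun w q => gauss a w q * y q) (F' := fun w q => 2 * a * (q - w) * gauss a w q * y q)
    (s := Metric.ball w₀ 1)
    (bound := fun q => D * (Real.exp (-(a / 4) * (q - w₀.re) ^ 2) * ‖y q‖))
    (Metric.ball_mem_nhds w₀ one_pos) (Eventually.of_forall hm) (hy.integrable ha w₀) ?_ ?_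
    ((hy.2 (a / 4) (by positivity) w₀.re).const_mul D) ?_).2.differentiableAt
  · refine AEStronglyMeasurable.mul ?_ hy.1
    have := continuous_gauss a w₀
    exact Continuous.aestronglyMeasurable (by fun_prop)
  · refine Eventually.of_forall fun q w hw => ?_
    rw [norm_mul, ← mul_assoc]
    exact mul_le_mul_of_nonneg_right (hD w hw q) (norm_nonneg _)
  · exact Eventually.of_forall fun q w _ => (hasDerivAt_gauss a q w).mul_const (y q)

lemma integral_exp_sq (a x : ℝ) :
    ∫ q : ℝ, Real.exp (-a * (q - x) ^ 2) = Real.sqrt (Real.pi / a) := by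
  rw [integral_sub_right_eq_self (fun q : ℝ => Real.exp (-a * q ^ 2)) x, integral_gaussian]

lemma norm_gaussConv_le {y : ℝ → ℂ} {C : ℝ} (hC : ∀ q, ‖y q‖ ≤ C) {a : ℝ} (ha : 0 < a) (z : ℂ) :
    ‖gaussConv a y z‖ ≤ C * Real.exp (a * z.im ^ 2) * Real.sqrt (Real.pi / a) := by
  have := norm_integral_le_of_norm_le (μ := volume) (f := fun q => gauss a z q * y q)
    ((integrable_exp_sq ha z.re).const_mul (C * Real.exp (a * z.im ^ 2)))
    (Eventually.of_forall fun q => by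
      rw [norm_mul, norm_gauss, mul_comm, mul_assoc C]
      exact mul_le_mul_of_nonneg_right (hC q) (by positivity))
  rwa [integral_const_mul, integral_exp_sq] at this

/-- Two functions on the line which, in a regularized sense, are boundary values of the same
analytic function on the strip `ℝ + i(0, π)`. -/
def CrossingPair (m n : ℝ → ℂ) : Prop :=
  ∀ a > 0, ∀ z, gaussConv a m (z + Real.pi * Complex.I) = gaussConv a n z

/-- Both sides extend to entire functions of `x`. Continuity removes the null set, and the identity
theorem passes from the real line to the plane. -/
lemma crossingPair_of_ae {m n : ℝ → ℂ} (hm : GaussIntegrable m) (hn : GaussIntegrable n)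
    (h : ∀ a > 0, ∀ᵐ x : ℝ, gaussConv a m (x + Real.pi / 2 * Complex.I) =
      gaussConv a n (x - Real.pi / 2 * Complex.I)) : CrossingPair m n := by
  intro a ha
  have dm := hm.differentiable ha
  have dn := hn.differentiable ha
  have h1 : ∀ x : ℝ, gaussConv a m (x + Real.pi / 2 * Complex.I) =
      gaussConv a n (x - Real.pi / 2 * Complex.I) := by
    have := Continuous.ae_eq_iff_eq (volume : Measure ℝ)
      (f := fun x : ℝ => gaussConv a m (x + Real.pi / 2 * Complex.I))
      (g := fun x : ℝ => gaussConv a n (x - Real.pi / 2 * Complex.I))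
      (dm.continuous.comp (by fun_prop)) (dn.continuous.comp (by fun_prop))
    exact fun x => congrFun (this.1 (h a ha)) x
  have f1 : AnalyticOnNhd ℂ (fun z => gaussConv a m (z + Real.pi / 2 * Complex.I)) Set.univ :=
    DifferentiableOn.analyticOnNhd
      ((dm.comp (differentiable_id.add_const _)).differentiableOn) isOpen_univ
  have f2 : AnalyticOnNhd ℂ (fun z => gaussConv a n (z - Real.pi / 2 * Complex.I)) Set.univ :=
    DifferentiableOn.analyticOnNhd
      ((dn.comp (differentiable_id.sub_const _)).differentiableOn) isOpen_univ
  have h2 := f1.eq_of_frequently_eq (z₀ := 0) f2 (by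
    have : Tendsto (fun x : ℝ => (x : ℂ)) (𝓝[≠] 0) (𝓝[≠] 0) := by
      refine tendsto_nhdsWithin_iff.2 ⟨?_, ?_⟩
      · exact (Complex.continuous_ofReal.tendsto' 0 0 (by simp)).mono_left nhdsWithin_le_nhds
      · filter_upwards [self_mem_nhdsWithin] with x hx
        simpa using hx
    exact this.frequently (Eventually.of_forall h1).frequently)
  intro z
  have := congrFun h2 (z + Real.pi / 2 * Complex.I)
  simp only [add_sub_cancel_right] at this
  rw [← this]
  congr 1
  ring

lemma gaussConv_comp_neg (a : ℝ) (y : ℝ → ℂ) (z : ℂ) :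
    gaussConv a (fun q => y (-q)) z = gaussConv a y (-z) := by
  rw [gaussConv, gaussConv, ← integral_neg_eq_self]
  refine integral_congr_ae (Eventually.of_forall fun q => ?_)
  simp only [neg_neg, gauss]
  congr 2
  push_cast
  ring

/-- This is the symmetry `z ↦ iπ - z` of the strip, which exchanges its edges. -/
lemma CrossingPair.comp_neg {m n : ℝ → ℂ} (h : CrossingPair m n) :
    CrossingPair (fun q => n (-q)) (fun q => m (-q)) := by
  intro a ha z
  rw [gaussConv_comp_neg, gaussConv_comp_neg, ← h a ha]
  congr 1
  ring

/-- The direct estimate contains the factor `exp (a (Im z)²)`, useless for large `a`. It equals `1`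
on the lower edge, and on the upper edge the crossing relation replaces `m` by `n` with a real
center. Phragmén–Lindelöf carries the edge bounds inside. -/
lemma CrossingPair.norm_le {m n : ℝ → ℂ} (h : CrossingPair m n) {C : ℝ}
    (hm : AEStronglyMeasurable m volume) (hmC : ∀ q, ‖m q‖ ≤ C) (hnC : ∀ q, ‖n q‖ ≤ C)
    {a : ℝ} (ha : 0 < a) {z : ℂ} (h0 : 0 ≤ z.im) (hπ : z.im ≤ Real.pi) :
    ‖gaussConv a m z‖ ≤ C * Real.sqrt (Real.pi / a) := by
  have hC0 : 0 ≤ C := (norm_nonneg _).trans (hmC 0)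
  refine PhragmenLindelof.horizontal_strip (a := 0) (b := Real.pi) (f := gaussConv a m)
    -- For fixed `a` the function is already bounded on the strip, so the growth condition holds
    -- with both constants equal to `0`.
    ((GaussIntegrable.of_bounded hm hmC).differentiable ha).diffContOnCl ⟨0, by
      rw [sub_zero, div_self Real.pi_ne_zero]; exact one_pos, 0, ?_⟩
    (fun w hw => ?_) (fun w hw => ?_) h0 hπ
  · refine Asymptotics.IsBigO.of_bound (C * Real.exp (a * Real.pi ^ 2) * Real.sqrt (Real.pi / a)) ?_
    refine eventually_inf_principal.2 (Eventually.of_forall fun w hw => ?_)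
    have hw1 : 0 < w.im := hw.1
    have hw2 : w.im < Real.pi := hw.2
    simp only [zero_mul, Real.exp_zero, norm_one, mul_one]
    refine (norm_gaussConv_le hmC ha w).trans ?_
    gcongr
  · simpa [hw] using norm_gaussConv_le hmC ha w
  · have : w = (w - Real.pi * Complex.I) + Real.pi * Complex.I := by ring
    rw [this, h a ha]
    have := norm_gaussConv_le hnC ha (w - Real.pi * Complex.I)
    simpa [hw] using this

lemma integrableOn_gauss_radial : IntegrableOn (fun r : ℝ => r * (2 * r * Real.exp (-r ^ 2)))
    (Set.Ioi 0) := by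
  have := (integrable_rpow_mul_exp_neg_mul_sq (b := 1) one_pos (s := 2) (by norm_num)).const_mul 2
  refine (this.integrableOn (s := Set.Ioi 0)).congr_fun (fun r hr => ?_) measurableSet_Ioi
  have : (r : ℝ) ^ (2 : ℝ) = r ^ 2 := by exact_mod_cast Real.rpow_natCast r 2
  simp only [this]
  ring_nf

/-- Normalized Gaussian regularizations converge almost everywhere. -/
lemma ae_tendsto_gaussConv {m : ℝ → ℂ} (hm : Measurable m) {C : ℝ} (hC : ∀ q, ‖m q‖ ≤ C) :
    ∀ᵐ x : ℝ, Tendsto (fun a : ℝ => (Real.sqrt (a / Real.pi) : ℂ) * gaussConv a m x) atTop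
      (𝓝 (m x)) := by
  -- The Gaussian as a superposition of indicators of centered intervals, weighted by minus its
  -- derivative.
  have hK : ∀ s : ℝ, s ≠ 0 → Real.exp (-s ^ 2) =
      ∫ r in Set.Ioi |s|, 2 * r * Real.exp (-r ^ 2) := by
    intro s _
    have hd : ∀ r ∈ Set.Ici |s|, HasDerivAt (fun r : ℝ => -Real.exp (-r ^ 2))
        (2 * r * Real.exp (-r ^ 2)) r := by
      intro r _
      refine (hasDerivAt_pow 2 r).fun_neg.exp.fun_neg.congr_deriv ?_
      push_cast
      ring
    have ht : Tendsto (fun r : ℝ => -Real.exp (-r ^ 2)) atTop (𝓝 (-0)) := by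
      refine (Real.tendsto_exp_atBot.comp ?_).neg
      exact tendsto_neg_atTop_atBot.comp (tendsto_pow_atTop two_ne_zero)
    rw [integral_Ioi_of_hasDerivAt_of_nonneg' hd (fun r hr => ?_) ht]
    · simp
    · have : 0 < r := lt_of_le_of_lt (abs_nonneg s) hr
      positivity
  filter_upwards [ae_tendsto_integral_radial (k := fun r => 2 * r * Real.exp (-r ^ 2))
    (K := fun s => Real.exp (-s ^ 2)) (by fun_prop) (fun r hr => by positivity)
    integrableOn_gauss_radial hK hm hC] with x hx
  have h1 : ∫ s : ℝ, (Real.exp (-s ^ 2) : ℂ) = (Real.sqrt Real.pi : ℂ) := by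
    rw [integral_complex_ofReal]
    have := integral_gaussian 1
    simp only [neg_mul, one_mul, div_one] at this
    rw [this]
  rw [h1] at hx
  -- The Gaussian with parameter `a` is the standard one dilated by `ε = a^{-1/2}`.
  have h2 : Tendsto (fun a : ℝ => (Real.sqrt a)⁻¹) atTop (𝓝[>] 0) :=
    tendsto_inv_atTop_nhdsGT_zero.comp Real.tendsto_sqrt_atTop
  have h3 := ((hx.comp h2).const_mul ((Real.sqrt Real.pi : ℂ)⁻¹))
  have hπ : (Real.sqrt Real.pi : ℂ) ≠ 0 := by
    exact_mod_cast (Real.sqrt_pos.2 Real.pi_pos).ne'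
  rw [inv_mul_cancel_left₀ hπ] at h3
  refine h3.congr' ?_
  filter_upwards [eventually_gt_atTop 0] with a ha
  have hs := Real.sqrt_pos.2 ha
  simp only [Function.comp_apply]
  rw [gaussConv, Real.sqrt_div' _ Real.pi_pos.le]
  have h4 := Measure.integral_comp_mul_left (fun u => gauss a x ((x + u : ℝ)) * m (x + u))
    (Real.sqrt a)⁻¹
  rw [integral_add_left_eq_self (fun q => gauss a x q * m q), inv_inv, abs_of_pos hs,
    Complex.real_smul] at h4
  rw [Complex.ofReal_div, div_mul_eq_mul_div, ← h4, div_eq_inv_mul]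
  congr 1
  refine integral_congr_ae (Eventually.of_forall fun s => ?_)
  simp only [gauss]
  congr 1
  rw [Complex.ofReal_exp]
  congr 1
  have h5 : ((Real.sqrt a : ℝ) : ℂ) ^ 2 = a := by exact_mod_cast Real.sq_sqrt ha.le
  have h6 : ((Real.sqrt a : ℝ) : ℂ) ≠ 0 := by exact_mod_cast hs.ne'
  push_cast
  rw [add_sub_cancel_left, mul_pow, inv_pow, h5, ← mul_assoc, neg_mul, mul_inv_cancel₀]
  · ring
  · exact_mod_cast ha.ne'

end GaussConv

end LRScattering

end

noncomputable section

namespace LRScattering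

/-! ### The Cauchy formula for a strip -/

section Cauchy

/-- The difference of the Cauchy kernels of `z` and `conj z`. -/
def stripKernel (z w : ℂ) : ℂ := 2 * Complex.I * z.im / ((w - z) * (w - conj z))

lemma integrable_lorentz (x : ℝ) {A : ℝ} (hA : 0 < A) :
    Integrable fun q : ℝ => A / ((q - x) ^ 2 + A ^ 2) := by
  have h1 := ((integrable_inv_one_add_sq.comp_div hA.ne').comp_sub_right x).const_mul A⁻¹
  refine h1.congr (Eventually.of_forall fun q => ?_)
  have : (q - x) ^ 2 + A ^ 2 ≠ 0 := by positivity
  have : 1 + ((q - x) / A) ^ 2 ≠ 0 := by positivity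
  field_simp
  ring

lemma integral_lorentz (x : ℝ) {A : ℝ} (hA : 0 < A) :
    ∫ q : ℝ, A / ((q - x) ^ 2 + A ^ 2) = Real.pi := by
  rw [integral_sub_right_eq_self (fun q : ℝ => A / (q ^ 2 + A ^ 2)) x]
  have h1 := Measure.integral_comp_div (fun q : ℝ => (1 + q ^ 2)⁻¹) A
  rw [integral_univ_inv_one_add_sq, abs_of_pos hA, smul_eq_mul] at h1
  have h2 : ∀ q : ℝ, A / (q ^ 2 + A ^ 2) = A⁻¹ * (1 + (q / A) ^ 2)⁻¹ := by
    intro q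
    have : q ^ 2 + A ^ 2 ≠ 0 := by positivity
    have : 1 + (q / A) ^ 2 ≠ 0 := by positivity
    field_simp
    ring
  simp only [h2]
  rw [integral_const_mul, h1, inv_mul_cancel_left₀ hA.ne']

/-- On the real axis the two factors of the denominator are conjugate to each other, so the kernel
is `2i` times the unnormalized Poisson kernel of the half-plane. -/
lemma stripKernel_ofReal (z : ℂ) (q : ℝ) :
    stripKernel z q = 2 * Complex.I * ((z.im / ((q - z.re) ^ 2 + z.im ^ 2) : ℝ) : ℂ) := by
  have h : ((q : ℂ) - z) * (q - conj z) = (((q - z.re) ^ 2 + z.im ^ 2 : ℝ) : ℂ) := by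
    apply Complex.ext
    · simp [pow_two]
    · simp [pow_two]; ring
  rw [stripKernel, h, mul_div_assoc]
  push_cast
  rfl

lemma stripKernel_ofReal_add {z : ℂ} (h0 : 0 < z.im) (hπ : z.im < Real.pi) (q : ℝ) :
    stripKernel z (q + Real.pi * Complex.I) =
      ((q - z.re : ℝ) + (Real.pi - z.im : ℝ) * Complex.I)⁻¹ -
      ((q - z.re : ℝ) + (Real.pi + z.im : ℝ) * Complex.I)⁻¹ := by
  have h1 : (q : ℂ) + Real.pi * Complex.I - z =
      (q - z.re : ℝ) + (Real.pi - z.im : ℝ) * Complex.I := by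
    apply Complex.ext <;> simp
  have h2 : (q : ℂ) + Real.pi * Complex.I - conj z =
      (q - z.re : ℝ) + (Real.pi + z.im : ℝ) * Complex.I := by
    apply Complex.ext <;> simp
  have n1 : ((q - z.re : ℝ) : ℂ) + (Real.pi - z.im : ℝ) * Complex.I ≠ 0 := fun h => by
    have := congrArg Complex.im h
    simp at this
    linarith
  have n2 : ((q - z.re : ℝ) : ℂ) + (Real.pi + z.im : ℝ) * Complex.I ≠ 0 := fun h => by
    have := congrArg Complex.im h
    simp at this
    linarith
  rw [stripKernel, h1, h2, inv_sub_inv n1 n2]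
  congr 1
  push_cast
  ring

/-- Points of the upper edge are closer to `z` than to `conj z`, so the denominator is at least the
square of the smaller distance. The prefactor `z.im` makes this edge negligible when `z` approaches
the real axis. -/
lemma norm_stripKernel_ofReal_add_le {z : ℂ} (h0 : 0 < z.im) (hπ : z.im < Real.pi) (q : ℝ) :
    ‖stripKernel z (q + Real.pi * Complex.I)‖ ≤
      2 * z.im / (Real.pi - z.im) *
        ((Real.pi - z.im) / ((q - z.re) ^ 2 + (Real.pi - z.im) ^ 2)) := by
  have hA : 0 < Real.pi - z.im := by linarith
  have key : (q - z.re) ^ 2 + (Real.pi - z.im) ^ 2 ≤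
      ‖((q : ℂ) + Real.pi * Complex.I - z) * (q + Real.pi * Complex.I - conj z)‖ := by
    rw [norm_mul]
    have e1 : ‖(q : ℂ) + Real.pi * Complex.I - z‖ ^ 2
        = (q - z.re) ^ 2 + (Real.pi - z.im) ^ 2 := by
      rw [Complex.sq_norm, Complex.normSq_apply]; simp; ring
    have e2 : ‖(q : ℂ) + Real.pi * Complex.I - conj z‖ ^ 2
        = (q - z.re) ^ 2 + (Real.pi + z.im) ^ 2 := by
      rw [Complex.sq_norm, Complex.normSq_apply]; simp; ring
    have e3 : ‖(q : ℂ) + Real.pi * Complex.I - z‖ ≤ ‖(q : ℂ) + Real.pi * Complex.I - conj z‖ := by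
      rw [← sq_le_sq₀ (norm_nonneg _) (norm_nonneg _), e1, e2]
      nlinarith [Real.pi_pos]
    rw [← e1, pow_two]
    exact mul_le_mul_of_nonneg_left e3 (norm_nonneg _)
  rw [stripKernel, norm_div]
  have : ‖2 * Complex.I * (z.im : ℂ)‖ = 2 * z.im := by simp [abs_of_pos h0]
  rw [this, div_mul_div_comm, mul_comm (Real.pi - z.im), mul_div_mul_right _ _ hA.ne']
  have : 0 < (q - z.re) ^ 2 + (Real.pi - z.im) ^ 2 := by positivity
  gcongr

lemma continuous_stripKernel_ofReal {z : ℂ} (h0 : 0 < z.im) :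
    Continuous fun q : ℝ => stripKernel z q := by
  simp only [stripKernel_ofReal]
  have : ∀ q : ℝ, (q - z.re) ^ 2 + z.im ^ 2 ≠ 0 := fun q => by positivity
  fun_prop (disch := assumption)

lemma continuous_stripKernel_ofReal_add {z : ℂ} (h0 : 0 < z.im) (hπ : z.im < Real.pi) :
    Continuous fun q : ℝ => stripKernel z (q + Real.pi * Complex.I) := by
  unfold stripKernel
  refine Continuous.div (by fun_prop) (by fun_prop) fun q => mul_ne_zero ?_ ?_
  · intro h
    have := congrArg Complex.im h
    simp at this
    linarith
  · intro h
    have := congrArg Complex.im h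
    simp at this
    linarith

lemma integrable_stripKernel_ofReal {z : ℂ} (h0 : 0 < z.im) :
    Integrable fun q : ℝ => stripKernel z q := by
  simp only [stripKernel_ofReal]
  exact ((integrable_lorentz z.re h0).ofReal).const_mul _

lemma integrable_stripKernel_ofReal_add {z : ℂ} (h0 : 0 < z.im) (hπ : z.im < Real.pi) :
    Integrable fun q : ℝ => stripKernel z (q + Real.pi * Complex.I) :=
  ((integrable_lorentz z.re (sub_pos.2 hπ)).const_mul _).mono'
    (continuous_stripKernel_ofReal_add h0 hπ).aestronglyMeasurable
    (Eventually.of_forall (norm_stripKernel_ofReal_add_le h0 hπ))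

lemma integral_stripKernel_ofReal {z : ℂ} (h0 : 0 < z.im) :
    ∫ q : ℝ, stripKernel z q = 2 * Real.pi * Complex.I := by
  simp only [stripKernel_ofReal]
  rw [integral_const_mul, integral_complex_ofReal, integral_lorentz _ h0]
  ring

/-- Both poles lie below the upper edge. Concretely, adding the values at `v` and `-v` leaves the
difference of two Lorentz kernels, of widths `π - Im z` and `π + Im z`, which have the same
integral. -/
lemma integral_stripKernel_ofReal_add {z : ℂ} (h0 : 0 < z.im) (hπ : z.im < Real.pi) :
    ∫ q : ℝ, stripKernel z (q + Real.pi * Complex.I) = 0 := by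
  have hA : 0 < Real.pi - z.im := by linarith
  have hB : 0 < Real.pi + z.im := by linarith
  set f : ℝ → ℂ := fun v => ((v : ℂ) + (Real.pi - z.im : ℝ) * Complex.I)⁻¹ -
      ((v : ℂ) + (Real.pi + z.im : ℝ) * Complex.I)⁻¹ with hf
  have e1 : (fun q : ℝ => stripKernel z (q + Real.pi * Complex.I)) = fun q => f (q - z.re) := by
    funext q
    rw [stripKernel_ofReal_add h0 hπ]
  have hfi : Integrable f := by
    have := (integrable_stripKernel_ofReal_add h0 hπ).comp_add_right z.re
    refine this.congr (Eventually.of_forall fun v => ?_)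
    have := congrFun e1 (v + z.re)
    simpa using this
  rw [e1, integral_sub_right_eq_self f z.re]
  have e2 : ∀ (A : ℝ), 0 < A → ∀ v : ℝ, ((v : ℂ) + (A : ℝ) * Complex.I)⁻¹ +
      (((-v : ℝ) : ℂ) + (A : ℝ) * Complex.I)⁻¹ =
        -2 * Complex.I * ((A / ((v - 0) ^ 2 + A ^ 2) : ℝ) : ℂ) := by
    intro A hA v
    have n1 : (v : ℂ) + (A : ℝ) * Complex.I ≠ 0 := fun h => by
      have := congrArg Complex.im h
      simp at this
      linarith
    have n2 : ((-v : ℝ) : ℂ) + (A : ℝ) * Complex.I ≠ 0 := fun h => by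
      have := congrArg Complex.im h
      simp at this
      linarith
    have n3 : (v : ℂ) ^ 2 + (A : ℂ) ^ 2 ≠ 0 := by
      have : (v ^ 2 + A ^ 2 : ℝ) ≠ 0 := by positivity
      exact_mod_cast this
    rw [inv_add_inv n1 n2]
    push_cast at n2 ⊢
    rw [div_eq_iff (mul_ne_zero n1 n2)]
    rw [sub_zero]
    field_simp
    ring_nf
    simp only [show Complex.I ^ 3 = -Complex.I by
      rw [pow_succ, Complex.I_sq]; ring]
    ring
  have e3 : ∀ v : ℝ, f v + f (-v) = -2 * Complex.I *
      (((Real.pi - z.im) / ((v - 0) ^ 2 + (Real.pi - z.im) ^ 2) : ℝ) : ℂ) - -2 * Complex.I *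
      (((Real.pi + z.im) / ((v - 0) ^ 2 + (Real.pi + z.im) ^ 2) : ℝ) : ℂ) := by
    intro v
    rw [← e2 _ hA, ← e2 _ hB]
    simp only [hf]
    ring
  have e4 : ∫ v, f v + f (-v) = 0 := by
    simp only [e3]
    rw [integral_sub ((integrable_lorentz 0 hA).ofReal.const_mul _)
      ((integrable_lorentz 0 hB).ofReal.const_mul _), integral_const_mul, integral_const_mul,
      integral_complex_ofReal, integral_complex_ofReal, integral_lorentz 0 hA,
      integral_lorentz 0 hB, sub_self]
  rw [integral_add hfi hfi.comp_neg, integral_neg_eq_self] at e4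
  have : (2 : ℂ) * ∫ v, f v = 0 := by rw [two_mul]; exact e4
  simpa using this

/-- The Cauchy formula for bounded analytic functions on a strip. -/
lemma strip_cauchy {u : ℂ → ℂ} (hu : Differentiable ℂ u) {B : ℝ}
    (hB : ∀ w : ℂ, 0 ≤ w.im → w.im ≤ Real.pi → ‖u w‖ ≤ B) {z : ℂ} (hz : z ∈ strip) :
    2 * Real.pi * Complex.I * u z = (∫ q : ℝ, u q * stripKernel z q) -
      ∫ q : ℝ, u (q + Real.pi * Complex.I) * stripKernel z (q + Real.pi * Complex.I) := by
  obtain ⟨h0, hπ⟩ := hz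
  -- This is `(u w - u z)` times the kernel, with the singularity at `z` removed and the other pole
  -- below the strip. The subtracted constant is recovered from the integrals of the kernel over the
  -- edges, `2πi` and `0`.
  set h : ℂ → ℂ := fun w => dslope u z w * (2 * Complex.I * z.im / (w - conj z)) with hh
  have hne : ∀ w : ℂ, 0 ≤ w.im → w - conj z ≠ 0 := by
    intro w hw h1
    have := congrArg Complex.im h1
    simp at this
    linarith
  have hk : ∀ w : ℂ, w ≠ z → h w = (u w - u z) * stripKernel z w := by
    intro w hw
    have hw' := sub_ne_zero.2 hw
    simp only [hh]
    rw [dslope_of_ne _ hw, slope_def_field, stripKernel, div_mul_div_comm, mul_div_assoc]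
  have hreal : ∀ q : ℝ, h q = (u q - u z) * stripKernel z q := fun q => hk _ fun h1 => by
    have := congrArg Complex.im h1
    simp at this
    linarith
  have htop : ∀ q : ℝ, h (q + Real.pi * Complex.I) = (u (q + Real.pi * Complex.I) - u z) *
      stripKernel z (q + Real.pi * Complex.I) := fun q => hk _ fun h1 => by
    have := congrArg Complex.im h1
    simp at this
    linarith
  have hzB : ‖u z‖ ≤ B := hB z h0.le hπ.le
  have i1 : Integrable fun q : ℝ => u q * stripKernel z q := by
    refine (integrable_stripKernel_ofReal h0).bdd_mul (c := B) ?_ (Eventually.of_forall fun q => ?_)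
    · have := hu.continuous
      exact Continuous.aestronglyMeasurable (by fun_prop)
    · exact hB _ (by simp) (by simpa using Real.pi_pos.le)
  have i2 : Integrable fun q : ℝ => u (q + Real.pi * Complex.I) *
      stripKernel z (q + Real.pi * Complex.I) := by
    refine (integrable_stripKernel_ofReal_add h0 hπ).bdd_mul (c := B) ?_
      (Eventually.of_forall fun q => ?_)
    · have := hu.continuous
      exact Continuous.aestronglyMeasurable (by fun_prop)
    · exact hB _ (by simpa using Real.pi_pos.le) (by simp)
  have j1 : Integrable fun q : ℝ => h q := by
    simp only [hreal, sub_mul]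
    exact i1.sub ((integrable_stripKernel_ofReal h0).const_mul _)
  have j2 : Integrable fun q : ℝ => h (q + Real.pi * Complex.I) := by
    simp only [htop, sub_mul]
    exact i2.sub ((integrable_stripKernel_ofReal_add h0 hπ).const_mul _)
  have hdiff : DifferentiableOn ℂ h {w | 0 ≤ w.im} := by
    refine DifferentiableOn.mul ?_ ?_
    · exact ((Complex.differentiableOn_dslope (c := z) (s := Set.univ) (by simp)).2
        hu.differentiableOn).mono (Set.subset_univ _)
    · exact DifferentiableOn.div (by fun_prop) (by fun_prop) fun w hw => hne w hw
  have hrect : ∀ R : ℝ, 0 < R → (∫ x in (-R)..R, h x) -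
      (∫ x in (-R)..R, h (x + Real.pi * Complex.I)) =
      -(Complex.I * ∫ y in (0 : ℝ)..Real.pi, h (R + y * Complex.I)) +
        Complex.I * ∫ y in (0 : ℝ)..Real.pi, h (-R + y * Complex.I) := by
    intro R hR
    have := Complex.integral_boundary_rect_eq_zero_of_differentiableOn h (-R : ℂ)
      (R + Real.pi * Complex.I) (hdiff.mono fun w hw => by
        have := hw.2
        simp only [Set.mem_preimage] at this
        simp [Set.uIcc_of_le Real.pi_pos.le] at this
        exact this.1)
    simp at this
    linear_combination this
  -- The kernel decays quadratically, which is the gain from subtracting the Cauchy kernel of `conj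
  -- z`, so the vertical sides of the rectangle drop out as `R → ∞`.
  have hside : ∀ R : ℝ, |z.re| < R → ∀ x : ℝ, |x| = R → ∀ y ∈ Set.uIoc (0 : ℝ) Real.pi,
      ‖h (x + y * Complex.I)‖ ≤ 2 * B * (2 * z.im) * ((R - |z.re|) ^ 2)⁻¹ := by
    intro R hR x hx y hy
    rw [Set.uIoc_of_le Real.pi_pos.le] at hy
    have hd : R - |z.re| ≤ |x - z.re| := by rw [← hx]; exact abs_sub_abs_le_abs_sub _ _
    have hd' : 0 < R - |z.re| := sub_pos.2 hR
    have n1 : R - |z.re| ≤ ‖(x : ℂ) + y * Complex.I - z‖ := by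
      refine hd.trans ?_
      simpa using Complex.abs_re_le_norm ((x : ℂ) + y * Complex.I - z)
    have n2 : R - |z.re| ≤ ‖(x : ℂ) + y * Complex.I - conj z‖ := by
      refine hd.trans ?_
      simpa using Complex.abs_re_le_norm ((x : ℂ) + y * Complex.I - conj z)
    rw [hk _ (fun h1 => by rw [h1, sub_self, norm_zero] at n1; linarith), norm_mul, stripKernel,
      norm_div, norm_mul ((x : ℂ) + y * Complex.I - z)]
    have e1 : ‖u (x + y * Complex.I) - u z‖ ≤ 2 * B := by
      refine (norm_sub_le _ _).trans ?_
      have := hB (x + y * Complex.I) (by simpa using hy.1.le) (by simpa using hy.2)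
      linarith
    have e2 : ‖2 * Complex.I * (z.im : ℂ)‖ = 2 * z.im := by simp [abs_of_pos h0]
    rw [e2, mul_assoc, ← div_eq_mul_inv, pow_two]
    have : 0 ≤ B := (norm_nonneg _).trans hzB
    gcongr
  have hlim0 : Tendsto (fun R : ℝ => 2 * B * (2 * z.im) * ((R - |z.re|) ^ 2)⁻¹ * |Real.pi - 0|)
      atTop (𝓝 0) := by
    have : Tendsto (fun R : ℝ => ((R - |z.re|) ^ 2)⁻¹) atTop (𝓝 0) :=
      tendsto_inv_atTop_zero.comp ((tendsto_pow_atTop two_ne_zero).comp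
        (tendsto_atTop_add_const_right _ _ tendsto_id))
    simpa using (this.const_mul (2 * B * (2 * z.im))).mul_const |Real.pi - 0|
  have s1 : Tendsto (fun R : ℝ => ∫ y in (0 : ℝ)..Real.pi, h (R + y * Complex.I)) atTop (𝓝 0) := by
    refine squeeze_zero_norm' ?_ hlim0
    filter_upwards [eventually_gt_atTop |z.re|] with R hR
    exact intervalIntegral.norm_integral_le_of_norm_le_const fun y hy =>
      hside R hR R (abs_of_nonneg ((abs_nonneg _).trans hR.le)) y hy
  have s2 : Tendsto (fun R : ℝ => ∫ y in (0 : ℝ)..Real.pi, h (-R + y * Complex.I)) atTop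
      (𝓝 0) := by
    refine squeeze_zero_norm' ?_ hlim0
    filter_upwards [eventually_gt_atTop |z.re|] with R hR
    refine intervalIntegral.norm_integral_le_of_norm_le_const fun y hy => ?_
    have := hside R hR (-R) (by rw [abs_neg]; exact abs_of_nonneg ((abs_nonneg _).trans hR.le)) y hy
    simpa using this
  have t1 := intervalIntegral_tendsto_integral j1 tendsto_neg_atTop_atBot tendsto_id
  have t2 := intervalIntegral_tendsto_integral j2 tendsto_neg_atTop_atBot tendsto_id
  have heq : (∫ q : ℝ, h q) - ∫ q : ℝ, h (q + Real.pi * Complex.I) = 0 := by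
    refine tendsto_nhds_unique (t1.sub t2) ?_
    have := ((s1.const_mul Complex.I).neg).add (s2.const_mul Complex.I)
    simp only [mul_zero, neg_zero, add_zero] at this
    refine this.congr' ?_
    filter_upwards [eventually_gt_atTop 0] with R hR
    exact (hrect R hR).symm
  simp only [hreal, htop, sub_mul] at heq
  rw [integral_sub i1 ((integrable_stripKernel_ofReal h0).const_mul _),
    integral_sub i2 ((integrable_stripKernel_ofReal_add h0 hπ).const_mul _), integral_const_mul,
    integral_const_mul, integral_stripKernel_ofReal h0, integral_stripKernel_ofReal_add h0 hπ]
    at heq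
  linear_combination -heq

end Cauchy

end LRScattering

end

noncomputable section

namespace LRScattering

/-! ### Boundary values on a strip -/

section Boundary

lemma isOpen_strip : IsOpen strip :=
  (isOpen_lt continuous_const Complex.continuous_im).inter
    (isOpen_lt Complex.continuous_im continuous_const)

/-- A bounded pointwise limit of analytic functions is analytic. -/
lemma differentiableOn_of_tendsto {U : Set ℂ} (hU : IsOpen U) {f : ℕ → ℂ → ℂ} {F : ℂ → ℂ}
    (hf : ∀ n, DifferentiableOn ℂ (f n) U) {C : ℝ} (hC : ∀ n, ∀ z ∈ U, ‖f n z‖ ≤ C)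
    (hF : ∀ z ∈ U, Tendsto (fun n => f n z) atTop (𝓝 (F z))) : DifferentiableOn ℂ F U := by
  intro c hc
  obtain ⟨r, hr, hrU⟩ := Metric.nhds_basis_closedBall.mem_iff.1 (hU.mem_nhds hc)
  lift r to NNReal using hr.le
  have hr0 : 0 < r := by exact_mod_cast hr
  have hcirc : ∀ θ, circleMap c r θ ∈ U := fun θ => hrU (circleMap_mem_closedBall c r.coe_nonneg θ)
  have hcont : ∀ n, Continuous fun θ => f n (circleMap c r θ) := fun n =>
    (hf n).continuousOn.comp_continuous (continuous_circleMap c r) hcirc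
  have hFm : StronglyMeasurable fun θ => F (circleMap c r θ) :=
    stronglyMeasurable_of_tendsto atTop (fun n => (hcont n).stronglyMeasurable)
      (tendsto_pi_nhds.2 fun θ => hF _ (hcirc θ))
  have hFC : ∀ z ∈ U, ‖F z‖ ≤ C := fun z hz =>
    le_of_tendsto (hF z hz).norm (Eventually.of_forall fun n => hC n z hz)
  have hFi : CircleIntegrable F c r :=
    (intervalIntegrable_const (c := C)).mono_fun hFm.aestronglyMeasurable
      (Eventually.of_forall fun θ => (hFC _ (hcirc θ)).trans (Real.le_norm_self C))
  have hps := hasFPowerSeriesOn_cauchy_integral hFi hr0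
  -- The Cauchy formula of each `f n` passes to the limit by dominated convergence on the circle,
  -- and a Cauchy integral is analytic whatever its integrable boundary data.
  have heq : Set.EqOn F (fun w => (2 * Real.pi * Complex.I : ℂ)⁻¹ •
      ∮ z in C(c, r), (z - w)⁻¹ • F z) (Metric.ball c r) := by
    intro w hw
    have h1 : ∀ n, f n w = (2 * Real.pi * Complex.I : ℂ)⁻¹ •
        ∮ z in C(c, r), (z - w)⁻¹ • f n z := fun n =>
      (DiffContOnCl.two_pi_i_inv_smul_circleIntegral_sub_inv_smul
        (((hf n).mono hrU).diffContOnCl_ball subset_rfl) hw).symm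
    have h2 : Tendsto (fun n => ∮ z in C(c, r), (z - w)⁻¹ • f n z) atTop
        (𝓝 (∮ z in C(c, r), (z - w)⁻¹ • F z)) := by
      have hne : ∀ θ, circleMap c r θ - w ≠ 0 := fun θ h => by
        have h4 : circleMap c r θ = w := sub_eq_zero.1 h
        have h5 := circleMap_mem_sphere c r.coe_nonneg θ
        rw [h4] at h5
        have := Metric.mem_ball.1 hw
        rw [Metric.mem_sphere.1 h5] at this
        exact lt_irrefl _ this
      have hinv : Continuous fun θ => (circleMap c r θ - w)⁻¹ :=
        ((continuous_circleMap c r).sub continuous_const).inv₀ hne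
      have hder : Continuous fun θ => deriv (circleMap c r) θ := by
        simp only [deriv_circleMap]
        have := continuous_circleMap 0 r
        fun_prop
      refine intervalIntegral.tendsto_integral_filter_of_dominated_convergence
        (fun θ => ‖deriv (circleMap c r) θ‖ * (‖(circleMap c r θ - w)⁻¹‖ * C)) ?_ ?_ ?_ ?_
      · exact Eventually.of_forall fun n => (hder.smul (hinv.smul (hcont n))).aestronglyMeasurable
      · refine Eventually.of_forall fun n => Eventually.of_forall fun θ _ => ?_
        rw [norm_smul, norm_smul]
        gcongr
        exact hC n _ (hcirc θ)
      · exact Continuous.intervalIntegrable (by fun_prop) _ _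
      · refine Eventually.of_forall fun θ _ => ?_
        exact ((hF _ (hcirc θ)).const_smul _).const_smul _
    refine tendsto_nhds_unique (hF w (hrU (Metric.ball_subset_closedBall hw))) ?_
    simp only [h1]
    exact h2.const_smul _
  have hd : DifferentiableOn ℂ F (Metric.ball c r) := by
    refine DifferentiableOn.congr ?_ heq
    have := hps.differentiableOn
    rwa [Metric.eball_coe] at this
  exact ((hd c (Metric.mem_ball_self hr)).differentiableAt
    (Metric.ball_mem_nhds c hr)).differentiableWithinAt

/-- The bounded analytic function on the strip with boundary values `m` and `n`. -/
def stripExtension (m n : ℝ → ℂ) (z : ℂ) : ℂ :=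
  (2 * Real.pi * Complex.I)⁻¹ * ((∫ q : ℝ, m q * stripKernel z q) -
    ∫ q : ℝ, n q * stripKernel z (q + Real.pi * Complex.I))

variable {m n : ℝ → ℂ} {C : ℝ}

lemma CrossingPair.norm_sqrt_mul_le (h : CrossingPair m n)
    (hm : AEStronglyMeasurable m volume) (hmC : ∀ q, ‖m q‖ ≤ C) (hnC : ∀ q, ‖n q‖ ≤ C)
    {a : ℝ} (ha : 0 < a) {z : ℂ} (h0 : 0 ≤ z.im) (hπ : z.im ≤ Real.pi) :
    ‖(Real.sqrt (a / Real.pi) : ℂ) * gaussConv a m z‖ ≤ C := by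
  rw [norm_mul, Complex.norm_real, Real.norm_of_nonneg (Real.sqrt_nonneg _)]
  calc Real.sqrt (a / Real.pi) * ‖gaussConv a m z‖
      ≤ Real.sqrt (a / Real.pi) * (C * Real.sqrt (Real.pi / a)) :=
        mul_le_mul_of_nonneg_left (h.norm_le hm hmC hnC ha h0 hπ) (Real.sqrt_nonneg _)
    _ = C * (Real.sqrt (a / Real.pi) * Real.sqrt (Real.pi / a)) := by ring
    _ = C := by
        rw [← Real.sqrt_mul (by positivity), div_mul_div_cancel₀ Real.pi_ne_zero, div_self ha.ne',
          Real.sqrt_one, mul_one]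

/-- The Cauchy formula expresses the regularization at `z` by its values on the two edges. By the
crossing relation these are regularizations of `m` and `n`, which converge almost everywhere and
boundedly, so dominated convergence applies. -/
lemma CrossingPair.tendsto_stripExtension (h : CrossingPair m n) (hm : Measurable m)
    (hn : Measurable n) (hmC : ∀ q, ‖m q‖ ≤ C) (hnC : ∀ q, ‖n q‖ ≤ C) {z : ℂ} (hz : z ∈ strip) :
    Tendsto (fun a : ℝ => (Real.sqrt (a / Real.pi) : ℂ) * gaussConv a m z) atTop
      (𝓝 (stripExtension m n z)) := by
  have hd : ∀ a > 0, Differentiable ℂ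
      fun z => (Real.sqrt (a / Real.pi) : ℂ) * gaussConv a m z := fun a ha =>
    ((GaussIntegrable.of_bounded hm.aestronglyMeasurable hmC).differentiable ha).const_mul _
  have hb : ∀ a > 0, ∀ w : ℂ, 0 ≤ w.im → w.im ≤ Real.pi →
      ‖(Real.sqrt (a / Real.pi) : ℂ) * gaussConv a m w‖ ≤ C := fun a ha w =>
    h.norm_sqrt_mul_le hm.aestronglyMeasurable hmC hnC ha
  have l1 : Tendsto (fun a : ℝ => ∫ q : ℝ, ((Real.sqrt (a / Real.pi) : ℂ) * gaussConv a m q) *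
      stripKernel z q) atTop (𝓝 (∫ q : ℝ, m q * stripKernel z q)) := by
    refine tendsto_integral_filter_of_dominated_convergence (fun q => C * ‖stripKernel z q‖) ?_ ?_
      ((integrable_stripKernel_ofReal hz.1).norm.const_mul C) ?_
    · filter_upwards [eventually_gt_atTop 0] with a ha
      exact (((hd a ha).continuous.comp Complex.continuous_ofReal).mul
        (continuous_stripKernel_ofReal hz.1)).aestronglyMeasurable
    · filter_upwards [eventually_gt_atTop 0] with a ha
      refine Eventually.of_forall fun q => ?_
      rw [norm_mul]
      exact mul_le_mul_of_nonneg_right (hb a ha q (by simp) (by simpa using Real.pi_pos.le))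
        (norm_nonneg _)
    · filter_upwards [ae_tendsto_gaussConv hm hmC] with q hq
      exact hq.mul_const _
  have l2 : Tendsto (fun a : ℝ => ∫ q : ℝ, ((Real.sqrt (a / Real.pi) : ℂ) *
      gaussConv a m (q + Real.pi * Complex.I)) * stripKernel z (q + Real.pi * Complex.I)) atTop
      (𝓝 (∫ q : ℝ, n q * stripKernel z (q + Real.pi * Complex.I))) := by
    refine tendsto_integral_filter_of_dominated_convergence
      (fun q => C * ‖stripKernel z (q + Real.pi * Complex.I)‖) ?_ ?_
      ((integrable_stripKernel_ofReal_add hz.1 hz.2).norm.const_mul C) ?_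
    · filter_upwards [eventually_gt_atTop 0] with a ha
      have := (hd a ha).continuous
      exact ((this.comp (by fun_prop : Continuous fun q : ℝ => (q : ℂ) + Real.pi * Complex.I)).mul
        (continuous_stripKernel_ofReal_add hz.1 hz.2)).aestronglyMeasurable
    · filter_upwards [eventually_gt_atTop 0] with a ha
      refine Eventually.of_forall fun q => ?_
      rw [norm_mul]
      exact mul_le_mul_of_nonneg_right (hb a ha _ (by simpa using Real.pi_pos.le) (by simp))
        (norm_nonneg _)
    · filter_upwards [ae_tendsto_gaussConv hn hnC] with q hq
      refine Tendsto.mul_const _ (hq.congr' ?_)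
      filter_upwards [eventually_gt_atTop 0] with a ha
      rw [h a ha]
  refine ((l1.sub l2).const_mul (2 * Real.pi * Complex.I)⁻¹).congr' ?_
  filter_upwards [eventually_gt_atTop 0] with a ha
  rw [← strip_cauchy (hd a ha) (hb a ha) hz, inv_mul_cancel_left₀]
  simp [Real.pi_ne_zero]

lemma CrossingPair.norm_stripExtension_le (h : CrossingPair m n) (hm : Measurable m)
    (hn : Measurable n) (hmC : ∀ q, ‖m q‖ ≤ C) (hnC : ∀ q, ‖n q‖ ≤ C) {z : ℂ} (hz : z ∈ strip) :
    ‖stripExtension m n z‖ ≤ C := by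
  refine le_of_tendsto (h.tendsto_stripExtension hm hn hmC hnC hz).norm ?_
  filter_upwards [eventually_gt_atTop 0] with a ha
  exact h.norm_sqrt_mul_le hm.aestronglyMeasurable hmC hnC ha hz.1.le hz.2.le

lemma CrossingPair.differentiableOn_stripExtension (h : CrossingPair m n) (hm : Measurable m)
    (hn : Measurable n) (hmC : ∀ q, ‖m q‖ ≤ C) (hnC : ∀ q, ‖n q‖ ≤ C) :
    DifferentiableOn ℂ (stripExtension m n) strip := by
  refine differentiableOn_of_tendsto isOpen_strip (C := C)
    -- The shift by `1` keeps the Gaussian parameter positive for every `k`, including `0`.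
    (f := fun k z => (Real.sqrt (((k : ℝ) + 1) / Real.pi) : ℂ) * gaussConv (k + 1) m z)
    (fun k => ?_) (fun k z hz => ?_) (fun z hz => ?_)
  · exact (((GaussIntegrable.of_bounded hm.aestronglyMeasurable hmC).differentiable
      (by positivity)).const_mul _).differentiableOn
  · exact h.norm_sqrt_mul_le hm.aestronglyMeasurable hmC hnC (by positivity) hz.1.le hz.2.le
  · exact (h.tendsto_stripExtension hm hn hmC hnC hz).comp
      (tendsto_atTop_add_const_right _ _ tendsto_natCast_atTop_atTop)

lemma integrableOn_lorentz_radial :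
    IntegrableOn (fun r : ℝ => r * (2 * r / (1 + r ^ 2) ^ 2)) (Set.Ioi 0) := by
  refine Integrable.integrableOn ?_
  refine (integrable_inv_one_add_sq.const_mul 2).mono' ?_ (Eventually.of_forall fun r => ?_)
  · have : ∀ r : ℝ, (1 + r ^ 2) ^ 2 ≠ 0 := fun r => by positivity
    exact Continuous.aestronglyMeasurable (by fun_prop (disch := assumption))
  · have : r * (2 * r / (1 + r ^ 2) ^ 2) = 2 * r ^ 2 / (1 + r ^ 2) ^ 2 := by ring
    rw [this, Real.norm_of_nonneg (by positivity), ← div_eq_mul_inv, div_le_div_iff₀ (by positivity)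
      (by positivity)]
    nlinarith [sq_nonneg r, sq_nonneg (r ^ 2)]

/-- This is Fatou's theorem for the half-plane: up to the factor `2i`, the kernel is the dilation by
`y` of `(1 + s²)⁻¹`, a radial kernel of integral `π`. -/
lemma ae_tendsto_integral_stripKernel (hm : Measurable m) (hmC : ∀ q, ‖m q‖ ≤ C) :
    ∀ᵐ x : ℝ, Tendsto (fun y : ℝ => ∫ q : ℝ, m q * stripKernel (x + y * Complex.I) q) (𝓝[>] 0)
      (𝓝 (2 * Real.pi * Complex.I * m x)) := by
  have hK : ∀ s : ℝ, s ≠ 0 → (1 + s ^ 2)⁻¹ =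
      ∫ r in Set.Ioi |s|, 2 * r / (1 + r ^ 2) ^ 2 := by
    intro s _
    have hd : ∀ r ∈ Set.Ici |s|, HasDerivAt (fun r : ℝ => -(1 + r ^ 2)⁻¹)
        (2 * r / (1 + r ^ 2) ^ 2) r := by
      intro r _
      have h1 : (1 + r ^ 2) ≠ 0 := by positivity
      refine (((hasDerivAt_pow 2 r).const_add 1).fun_inv h1).fun_neg.congr_deriv ?_
      push_cast
      ring
    have ht : Tendsto (fun r : ℝ => -(1 + r ^ 2)⁻¹) atTop (𝓝 (-0)) := by
      refine (tendsto_inv_atTop_zero.comp ?_).neg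
      exact tendsto_atTop_add_const_left _ _ (tendsto_pow_atTop two_ne_zero)
    rw [integral_Ioi_of_hasDerivAt_of_nonneg' hd (fun r hr => ?_) ht]
    · simp
    · have : 0 < r := lt_of_le_of_lt (abs_nonneg s) hr
      positivity
  filter_upwards [ae_tendsto_integral_radial (k := fun r => 2 * r / (1 + r ^ 2) ^ 2)
    (K := fun s => (1 + s ^ 2)⁻¹) (by fun_prop) (fun r hr => by positivity)
    integrableOn_lorentz_radial hK hm hmC] with x hx
  rw [integral_complex_ofReal, integral_univ_inv_one_add_sq] at hx
  have := hx.const_mul (2 * Complex.I)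
  rw [show 2 * Complex.I * ((Real.pi : ℂ) * m x) = 2 * Real.pi * Complex.I * m x by ring] at this
  refine this.congr' ?_
  filter_upwards [self_mem_nhdsWithin] with y hy
  have hy' : 0 < y := hy
  have h4 := Measure.integral_comp_mul_left
    (fun u => m (x + u) * stripKernel (x + y * Complex.I) ((x + u : ℝ))) y
  rw [integral_add_left_eq_self (fun q : ℝ => m q * stripKernel (x + y * Complex.I) q),
    abs_of_pos (inv_pos.2 hy'), Complex.real_smul] at h4
  have hy0 : (y : ℂ) ≠ 0 := by exact_mod_cast hy'.ne'
  have h5 : ∫ q : ℝ, m q * stripKernel (x + y * Complex.I) q =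
      y * ∫ s : ℝ, m (x + y * s) * stripKernel (x + y * Complex.I) ((x + y * s : ℝ)) := by
    rw [h4, Complex.ofReal_inv, mul_inv_cancel_left₀ hy0]
  rw [h5, ← integral_const_mul, ← integral_const_mul]
  refine integral_congr_ae (Eventually.of_forall fun s => ?_)
  simp only [stripKernel_ofReal]
  have h6 : (y : ℝ) * (y / ((x + y * s - x) ^ 2 + y ^ 2)) = (1 + s ^ 2)⁻¹ := by
    have : (x + y * s - x) ^ 2 + y ^ 2 = y ^ 2 * (1 + s ^ 2) := by ring
    rw [this]
    have : 1 + s ^ 2 ≠ 0 := by positivity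
    field_simp
  simp only [← h6]
  simp
  ring

/-- The `L¹` norm of the kernel on the upper edge is at most `2πy/(π - y)`, so boundedness of `n`
suffices at every `x`. -/
lemma tendsto_integral_stripKernel_add (hnC : ∀ q, ‖n q‖ ≤ C) (x : ℝ) :
    Tendsto (fun y : ℝ => ∫ q : ℝ, n q * stripKernel (x + y * Complex.I) (q + Real.pi * Complex.I))
      (𝓝[>] 0) (𝓝 0) := by
  have h1 : Tendsto (fun y : ℝ => C * (2 * y / (Real.pi - y) * Real.pi)) (𝓝[>] 0) (𝓝 0) := by
    have : ContinuousAt (fun y : ℝ => C * (2 * y / (Real.pi - y) * Real.pi)) 0 := by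
      have : Real.pi - 0 ≠ 0 := by simp [Real.pi_ne_zero]
      fun_prop (disch := assumption)
    have h2 := this.tendsto
    simp only [mul_zero, zero_div, zero_mul] at h2
    exact h2.mono_left nhdsWithin_le_nhds
  refine squeeze_zero_norm' ?_ h1
  filter_upwards [self_mem_nhdsWithin, nhdsWithin_le_nhds (Iio_mem_nhds Real.pi_pos)] with y hy hy2
  have hy' : 0 < y := hy
  have hy2' : y < Real.pi := hy2
  have e1 : ((x : ℂ) + y * Complex.I).im = y := by simp
  have e2 : ((x : ℂ) + y * Complex.I).re = x := by simp
  refine (norm_integral_le_of_norm_le (((integrable_lorentz x (sub_pos.2 hy2')).const_mul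
    (2 * y / (Real.pi - y))).const_mul C) (Eventually.of_forall fun q => ?_)).trans ?_
  · rw [norm_mul]
    have := norm_stripKernel_ofReal_add_le (z := x + y * Complex.I) (by rwa [e1]) (by rwa [e1]) q
    rw [e1, e2] at this
    exact mul_le_mul (hnC q) this (norm_nonneg _) ((norm_nonneg _).trans (hnC 0))
  · rw [integral_const_mul, integral_const_mul, integral_lorentz _ (sub_pos.2 hy2')]

lemma ae_tendsto_stripExtension (hm : Measurable m) (hmC : ∀ q, ‖m q‖ ≤ C)
    (hnC : ∀ q, ‖n q‖ ≤ C) : ∀ᵐ x : ℝ,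
    Tendsto (fun y : ℝ => stripExtension m n (x + y * Complex.I)) (𝓝[>] 0) (𝓝 (m x)) := by
  filter_upwards [ae_tendsto_integral_stripKernel hm hmC] with x hx
  have := (hx.sub (tendsto_integral_stripKernel_add hnC x)).const_mul
    (2 * Real.pi * Complex.I)⁻¹
  rwa [sub_zero, inv_mul_cancel_left₀ (by simp [Real.pi_ne_zero])] at this

/-- The extension to the strip is symmetric under the rotation exchanging the two edges. -/
lemma CrossingPair.stripExtension_comp_neg (h : CrossingPair m n) (hm : Measurable m)
    (hn : Measurable n) (hmC : ∀ q, ‖m q‖ ≤ C) (hnC : ∀ q, ‖n q‖ ≤ C) {z : ℂ} (hz : z ∈ strip) :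
    stripExtension (fun q => n (-q)) (fun q => m (-q)) z =
      stripExtension m n (Real.pi * Complex.I - z) := by
  have hz' : Real.pi * Complex.I - z ∈ strip := by
    have h1 := hz.1
    have h2 := hz.2
    constructor <;> simp <;> linarith
  refine tendsto_nhds_unique (h.comp_neg.tendsto_stripExtension (by fun_prop) (by fun_prop)
    (fun q => hnC _) (fun q => hmC _) hz)
    ((h.tendsto_stripExtension hm hn hmC hnC hz').congr' ?_)
  filter_upwards [eventually_gt_atTop 0] with a ha
  rw [gaussConv_comp_neg, ← h a ha]
  congr 2
  ring

/-- The result for the lower edge is applied to the reflected pair and rotated back. -/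
lemma CrossingPair.ae_tendsto_stripExtension_top (h : CrossingPair m n) (hm : Measurable m)
    (hn : Measurable n) (hmC : ∀ q, ‖m q‖ ≤ C) (hnC : ∀ q, ‖n q‖ ≤ C) : ∀ᵐ x : ℝ,
    Tendsto (fun y : ℝ => stripExtension m n (x + y * Complex.I)) (𝓝[<] Real.pi)
      (𝓝 (n x)) := by
  have h1 := ae_tendsto_stripExtension (m := fun q => n (-q)) (n := fun q => m (-q))
    (by fun_prop) (fun q => hnC _) (fun q => hmC _)
  have h2 := (Measure.measurePreserving_neg (volume : Measure ℝ)).quasiMeasurePreserving.ae h1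
  filter_upwards [h2] with x hx
  simp only [neg_neg] at hx
  have h3 : Tendsto (fun y : ℝ => Real.pi - y) (𝓝[<] Real.pi) (𝓝[>] 0) := by
    refine tendsto_nhdsWithin_iff.2 ⟨?_, ?_⟩
    · have : ContinuousAt (fun y : ℝ => Real.pi - y) Real.pi := by fun_prop
      simpa using this.tendsto.mono_left nhdsWithin_le_nhds
    · filter_upwards [self_mem_nhdsWithin] with y hy
      simpa using hy
  refine (hx.comp h3).congr' ?_
  filter_upwards [self_mem_nhdsWithin, nhdsWithin_le_nhds (Ioi_mem_nhds Real.pi_pos)] with y hy hy2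
  have hy' : y < Real.pi := hy
  have hy2' : 0 < y := hy2
  have e1 : (((-x : ℝ) : ℂ) + (Real.pi - y : ℝ) * Complex.I).im = Real.pi - y := by simp
  rw [Function.comp_apply, h.stripExtension_comp_neg hm hn hmC hnC
    ⟨by rw [e1]; linarith, by rw [e1]; linarith⟩]
  congr 1
  push_cast
  ring

/-- The boundary value on the upper edge is determined by the one on the lower edge. -/
lemma CrossingPair.ae_unique {n' : ℝ → ℂ} (h : CrossingPair m n) (h' : CrossingPair m n')
    (hn : Measurable n) (hn' : Measurable n') (hnC : ∀ q, ‖n q‖ ≤ C) (hnC' : ∀ q, ‖n' q‖ ≤ C) :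
    ∀ᵐ x : ℝ, n x = n' x := by
  filter_upwards [ae_tendsto_gaussConv hn hnC, ae_tendsto_gaussConv hn' hnC'] with x h1 h2
  refine tendsto_nhds_unique h1 (h2.congr' ?_)
  filter_upwards [eventually_gt_atTop 0] with a ha
  rw [← h a ha, ← h' a ha]

end Boundary

end LRScattering

end

noncomputable section

namespace LRScattering

/-! ### Vector-valued analytic functions -/

section Analytic

variable {𝓗 : Type*} [NormedAddCommGroup 𝓗] [InnerProductSpace ℂ 𝓗] [CompleteSpace 𝓗]

/-- A continuous, weakly analytic function is analytic. -/
lemma differentiable_of_weak {f : ℂ → 𝓗} (hf : Continuous f)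
    (hw : ∀ y, Differentiable ℂ fun z => ⟪y, f z⟫_ℂ) : Differentiable ℂ f := by
  intro c
  have hps := hasFPowerSeriesOn_cauchy_integral (c := c) (R := 1) (f := f)
    (hf.continuousOn.circleIntegrable (by norm_num)) one_pos
  -- Continuity makes the vector-valued Cauchy integral exist. Pairing with an arbitrary `y` reduces
  -- the formula to the scalar one.
  have heq : Set.EqOn f (fun w => (2 * Real.pi * Complex.I : ℂ)⁻¹ •
      ∮ z in C(c, (1 : NNReal)), (z - w)⁻¹ • f z) (Metric.ball c (1 : NNReal)) := by
    intro w hw'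
    refine ext_inner_left ℂ fun y => ?_
    have h1 := DiffContOnCl.two_pi_i_inv_smul_circleIntegral_sub_inv_smul
      ((hw y).diffContOnCl (s := Metric.ball c (1 : NNReal))) hw'
    simp only
    rw [← h1, inner_smul_right, smul_eq_mul]
    congr 1
    have hne : ∀ θ, circleMap c (1 : NNReal) θ - w ≠ 0 := fun θ h => by
      have h4 : circleMap c (1 : NNReal) θ = w := sub_eq_zero.1 h
      have h5 := circleMap_mem_sphere c (1 : NNReal).coe_nonneg θ
      rw [h4] at h5
      have := Metric.mem_ball.1 hw'
      rw [Metric.mem_sphere.1 h5] at this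
      exact lt_irrefl _ this
    have hinv : Continuous fun θ => (circleMap c (1 : NNReal) θ - w)⁻¹ :=
      ((continuous_circleMap c _).sub continuous_const).inv₀ hne
    have hder : Continuous fun θ => deriv (circleMap c (1 : NNReal)) θ := by
      simp only [deriv_circleMap]
      have := continuous_circleMap 0 (1 : NNReal)
      fun_prop
    have h6 := (innerSL ℂ y).intervalIntegral_comp_comm (μ := volume) (a := 0) (b := 2 * Real.pi)
      (f := fun θ => deriv (circleMap c (1 : NNReal)) θ •
        (circleMap c (1 : NNReal) θ - w)⁻¹ • f (circleMap c (1 : NNReal) θ))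
      ((hder.smul (hinv.smul (hf.comp (continuous_circleMap c _)))).intervalIntegrable _ _)
    simp only [innerSL_apply_apply] at h6
    rw [circleIntegral, circleIntegral, ← h6]
    refine intervalIntegral.integral_congr fun θ _ => ?_
    simp only [inner_smul_right, smul_eq_mul]
  have hd : DifferentiableOn ℂ f (Metric.ball c (1 : NNReal)) := by
    refine DifferentiableOn.congr ?_ heq
    have := hps.differentiableOn
    rwa [Metric.eball_coe] at this
  exact (hd c (Metric.mem_ball_self one_pos)).differentiableAt (Metric.ball_mem_nhds c one_pos)

/-- The left slot of the inner product is conjugate linear. Evaluating `e` at `conj w` compensates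
for this and makes the dependence on `w` holomorphic. -/
lemma hasDerivAt_innerSL_conj {e : ℂ → 𝓗} {e' : 𝓗} {z : ℂ} (he : HasDerivAt e e' (conj z)) :
    HasDerivAt (fun w => innerSL ℂ (e (conj w))) (innerSL ℂ e') z := by
  rw [hasDerivAt_iff_tendsto_slope] at he ⊢
  have h1 : Tendsto (fun w : ℂ => conj w) (𝓝[≠] z) (𝓝[≠] conj z) := by
    refine tendsto_nhdsWithin_iff.2 ⟨?_, ?_⟩
    · exact (Complex.continuous_conj.tendsto z).mono_left nhdsWithin_le_nhds
    · filter_upwards [self_mem_nhdsWithin] with w hw h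
      exact hw ((starRingEnd ℂ).injective h)
  refine (((innerSL ℂ (E := 𝓗)).continuous.tendsto e').comp (he.comp h1)).congr fun w => ?_
  simp only [Function.comp_apply, slope_def_module, map_smulₛₗ, map_sub, map_inv₀]
  simp

lemma differentiableAt_inner_conj {e F : ℂ → 𝓗} (he : Differentiable ℂ e) {z : ℂ}
    (hF : DifferentiableAt ℂ F z) : DifferentiableAt ℂ (fun w => ⟪e (conj w), F w⟫_ℂ) z :=
  ((hasDerivAt_innerSL_conj (he (conj z)).hasDerivAt).clm_apply hF.hasDerivAt).differentiableAt

/-- A function which is analytic in a strip and vanishes on an edge of the strip vanishes. -/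
lemma eq_zero_of_edge {g : ℂ → ℂ} (hc : ContinuousOn g {z | -(1 / 2) ≤ z.im ∧ z.im ≤ 0})
    (hd : DifferentiableOn ℂ g {z | -(1 / 2) < z.im ∧ z.im < 0}) (h0 : ∀ t : ℝ, g t = 0) {z : ℂ}
    (hz : -(1 / 2) ≤ z.im ∧ z.im ≤ 0) : g z = 0 := by
  -- Take the open square centered at `p` whose upper side lies on the real axis, and multiply `g`
  -- with its copies rotated about `p` by quarter turns. On each side of the square one factor is
  -- evaluated on the real axis and vanishes, so the maximum principle gives `g(p)⁴ = 0`. The bound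
  -- `-1/4` keeps the square inside the strip.
  have hnear : ∀ p : ℂ, -(1 / 4) < p.im → p.im < 0 → g p = 0 := by
    intro p hp1 hp2
    set r := -p.im with hr
    set φ : ℂ → ℝ := fun w => max |w.re| |w.im| with hφ
    have hφc : Continuous φ := by fun_prop
    set v : ℂ → ℂ := fun w =>
      g (p + w) * g (p + Complex.I * w) * g (p - w) * g (p - Complex.I * w) with hv
    have hmem : ∀ w, φ w ≤ r → |w.re| ≤ r ∧ |w.im| ≤ r := fun w hw => max_le_iff.1 hw
    have hU : {w | φ w < r} ⊆ {w : ℂ | |w.re| < r ∧ |w.im| < r} := fun w hw => max_lt_iff.1 hw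
    have hbd : Bornology.IsBounded {w | φ w < r} := by
      refine (Metric.isBounded_closedBall (x := (0 : ℂ)) (r := r + r)).subset fun w hw => ?_
      have := hmem w (le_of_lt hw)
      rw [mem_closedBall_zero_iff]
      exact (Complex.norm_le_abs_re_add_abs_im w).trans (add_le_add this.1 this.2)
    have hcl : closure {w | φ w < r} ⊆ {w | φ w ≤ r} := closure_lt_subset_le hφc continuous_const
    have hdiff : DiffContOnCl ℂ v {w | φ w < r} := by
      constructor
      · have key : ∀ ψ : ℂ → ℂ, Differentiable ℂ ψ → (∀ w, φ w < r → |(ψ w).im - p.im| < r) →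
            DifferentiableOn ℂ (fun w => g (ψ w)) {w | φ w < r} := by
          intro ψ hψ h
          refine hd.comp hψ.differentiableOn fun w hw => ?_
          have := abs_lt.1 (h w hw)
          constructor <;> linarith
        refine (((key _ (by fun_prop) ?_).mul (key _ (by fun_prop) ?_)).mul
          (key _ (by fun_prop) ?_)).mul (key _ (by fun_prop) ?_) <;>
        · intro w hw
          have := hU hw
          simp [this.1, this.2]
      · have key : ∀ ψ : ℂ → ℂ, Continuous ψ → (∀ w, φ w ≤ r → |(ψ w).im - p.im| ≤ r) →
            ContinuousOn (fun w => g (ψ w)) (closure {w | φ w < r}) := by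
          intro ψ hψ h
          refine hc.comp hψ.continuousOn fun w hw => ?_
          have := abs_le.1 (h w (hcl hw))
          constructor <;> linarith
        refine (((key _ (by fun_prop) ?_).mul (key _ (by fun_prop) ?_)).mul
          (key _ (by fun_prop) ?_)).mul (key _ (by fun_prop) ?_) <;>
        · intro w hw
          have := hmem w hw
          simp [this.1, this.2]
    have hedge : ∀ w : ℂ, w.im = 0 → g w = 0 := fun w hw => by
      have : w = (w.re : ℂ) := by apply Complex.ext <;> simp [hw]
      rw [this]; exact h0 _
    have hfr : ∀ w ∈ frontier {w | φ w < r}, ‖v w‖ ≤ 0 := by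
      intro w hw
      have h1 : φ w = r := frontier_lt_subset_eq hφc continuous_const hw
      rw [norm_le_zero_iff]
      have h2 : |w.re| = r ∨ |w.im| = r := by
        rcases max_choice |w.re| |w.im| with h | h
        · exact Or.inl (h.symm.trans h1)
        · exact Or.inr (h.symm.trans h1)
      have hr0 : 0 < r := by linarith
      simp only [hv]
      rcases h2 with h2 | h2
      · rcases (abs_eq hr0.le).1 h2 with h3 | h3
        · rw [hedge (p + Complex.I * w) (by simp [h3, hr])]; ring
        · rw [hedge (p - Complex.I * w) (by simp [h3, hr])]; ring
      · rcases (abs_eq hr0.le).1 h2 with h3 | h3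
        · rw [hedge (p + w) (by simp [h3, hr])]; ring
        · rw [hedge (p - w) (by simp [h3, hr])]; ring
    have h1 := Complex.norm_le_of_forall_mem_frontier_norm_le hbd hdiff hfr
      (z := 0) (subset_closure (by simp [hφ]; linarith))
    rw [norm_le_zero_iff] at h1
    simp only [hv, mul_zero, add_zero, sub_zero] at h1
    simpa using h1
  have hopen : IsOpen {z : ℂ | -(1 / 2) < z.im ∧ z.im < 0} :=
    (isOpen_lt continuous_const Complex.continuous_im).inter
      (isOpen_lt Complex.continuous_im continuous_const)
  have hset : {z : ℂ | -(1 / 2) < z.im ∧ z.im < 0} = Complex.im ⁻¹' Set.Ioo (-(1 / 2)) 0 := rfl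
  have hset' : {z : ℂ | -(1 / 2) ≤ z.im ∧ z.im ≤ 0} = Complex.im ⁻¹' Set.Icc (-(1 / 2)) 0 := rfl
  have hconv : Convex ℝ {z : ℂ | -(1 / 2) < z.im ∧ z.im < 0} :=
    (convex_Ioo _ _).linear_preimage Complex.imLm
  have hp0 : (-(Complex.I / 8)) ∈ {z : ℂ | -(1 / 2) < z.im ∧ z.im < 0} := by
    constructor <;> norm_num
  -- Vanishing near the upper edge spreads through the connected open strip by the identity theorem,
  -- and then to the closure by continuity.
  have hin : Set.EqOn g 0 {z : ℂ | -(1 / 2) < z.im ∧ z.im < 0} := by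
    refine (hd.analyticOnNhd hopen).eqOn_zero_of_preconnected_of_eventuallyEq_zero
      hconv.isPreconnected hp0 ?_
    have hnb : {z : ℂ | -(1 / 4) < z.im ∧ z.im < 0} ∈ 𝓝 (-(Complex.I / 8)) := by
      refine IsOpen.mem_nhds ((isOpen_lt continuous_const Complex.continuous_im).inter
        (isOpen_lt Complex.continuous_im continuous_const)) ?_
      constructor <;> norm_num
    filter_upwards [hnb] with p hp
    exact hnear p hp.1 hp.2
  have hall := hin.of_subset_closure hc continuousOn_const (fun z hz => ⟨hz.1.le, hz.2.le⟩) (by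
    rw [hset, hset', Complex.closure_preimage_im, closure_Ioo (by norm_num)])
  exact hall hz

end Analytic

/-! ### Gaussian vectors in standard subspaces -/

section GaussVectors

variable {ι : Type*} [Fintype ι]

lemma inner_gaussL2 {a : ℝ} (ha : 0 < a) (c : EuclideanSpace ℂ ι) (y : L2 ℝ ι) (w : ℂ) :
    ⟪y, gaussL2 ha w c⟫_ℂ = gaussConv a (fun q => ⟪y q, c⟫_ℂ) w := by
  rw [L2.inner_def, gaussConv]
  refine integral_congr_ae ?_
  filter_upwards [gaussL2_ae ha w c] with q hq
  simp only [PiLp.inner_apply, RCLike.inner_apply, hq, Finset.mul_sum, mul_assoc]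

/-- Weak analyticity is that of `gaussConv`. Norm continuity follows from the mean value inequality
applied pointwise, with the wider Gaussian of exponent `a/4` as an `L²` majorant. -/
lemma differentiable_gaussL2 {a : ℝ} (ha : 0 < a) (c : EuclideanSpace ℂ ι) :
    Differentiable ℂ fun w => gaussL2 ha w c := by
  refine differentiable_of_weak ?_ fun y => ?_
  · rw [continuous_iff_continuousAt]
    intro w₀
    obtain ⟨D, hD⟩ := norm_deriv_gauss_le ha w₀
    have hD0 : 0 ≤ D := by
      have := (norm_nonneg _).trans (hD w₀ (Metric.mem_ball_self one_pos) w₀.re)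
      simpa using this
    have ha4 : 0 < a / 4 := by positivity
    have hle : ∀ w ∈ Metric.ball w₀ 1, ‖gaussL2 ha w c - gaussL2 ha w₀ c‖ ≤
        D * ‖w - w₀‖ * ‖gaussL2 ha4 (w₀.re : ℂ) c‖ := by
      intro w hw
      have h1 : ‖gaussL2 ha w c - gaussL2 ha w₀ c‖ ≤
          ‖((D * ‖w - w₀‖ : ℝ) : ℂ) • gaussL2 ha4 (w₀.re : ℂ) c‖ := by
        refine Lp.norm_le_norm_of_ae_le ?_
        filter_upwards [Lp.coeFn_sub (gaussL2 ha w c) (gaussL2 ha w₀ c),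
          (memLp_gauss_smul ha w c).coeFn_toLp, (memLp_gauss_smul ha w₀ c).coeFn_toLp,
          (memLp_gauss_smul ha4 (w₀.re : ℂ) c).coeFn_toLp,
          Lp.coeFn_smul ((D * ‖w - w₀‖ : ℝ) : ℂ) (gaussL2 ha4 (w₀.re : ℂ) c)] with q e1 e2 e3 e4 e5
        rw [e1, e5, Pi.sub_apply, Pi.smul_apply, gaussL2, gaussL2, gaussL2, e2, e3, e4, ← sub_smul,
          norm_smul, norm_smul, norm_smul, ← mul_assoc]
        refine mul_le_mul_of_nonneg_right ?_ (norm_nonneg _)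
        have := (convex_ball w₀ 1).norm_image_sub_le_of_norm_hasDerivWithin_le
          (f := fun w => gauss a w q) (fun w _ => (hasDerivAt_gauss a q w).hasDerivWithinAt)
          (fun w hw => hD w hw q) (Metric.mem_ball_self one_pos) hw
        refine this.trans (le_of_eq ?_)
        rw [norm_gauss, Complex.norm_real, Real.norm_of_nonneg (by positivity)]
        simp
        ring
      rwa [norm_smul, Complex.norm_real, Real.norm_of_nonneg (by positivity)] at h1
    rw [ContinuousAt, tendsto_iff_norm_sub_tendsto_zero]
    have hlim : Tendsto (fun w => D * ‖w - w₀‖ * ‖gaussL2 ha4 (w₀.re : ℂ) c‖) (𝓝 w₀) (𝓝 0) := by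
      have : Continuous fun w => D * ‖w - w₀‖ * ‖gaussL2 ha4 (w₀.re : ℂ) c‖ := by fun_prop
      exact this.tendsto' _ _ (by simp)
    refine squeeze_zero' (Eventually.of_forall fun _ => norm_nonneg _) ?_ hlim
    filter_upwards [Metric.ball_mem_nhds w₀ one_pos] with w hw using hle w hw
  · simp only [inner_gaussL2]
    refine GaussIntegrable.differentiable (GaussIntegrable.of_memLp ?_) ha
    exact (Lp.memLp y).inner_const c

variable {𝓗 : Type*} [NormedAddCommGroup 𝓗] [InnerProductSpace ℂ 𝓗] [CompleteSpace 𝓗]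
  {P : StandardPair 𝓗} (X : Parametrization P ι) {a : ℝ} (ha : 0 < a)

/-- The Gaussian vector `exp (-a (q - w)²) c`. -/
def Parametrization.gaussVec (w : ℂ) (c : EuclideanSpace ℂ ι) : 𝓗 := X.V.symm (gaussL2 ha w c)

/-- The conjugation `c ↦ (conj c^{ᾱ})` of `ℂⁿ`. -/
def Parametrization.conjVec (c : EuclideanSpace ℂ ι) : EuclideanSpace ℂ ι :=
  WithLp.toLp 2 fun α => conj (c (X.bar α))

lemma Parametrization.gaussVec_ae (w : ℂ) (c : EuclideanSpace ℂ ι) :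
    ∀ᵐ q, ∀ α, X.V (X.gaussVec ha w c) q α = gauss a w q * c α := by
  rw [Parametrization.gaussVec, LinearIsometryEquiv.apply_symm_apply]
  exact gaussL2_ae ha w c

lemma Parametrization.differentiable_gaussVec (c : EuclideanSpace ℂ ι) :
    Differentiable ℂ fun w => X.gaussVec ha w c :=
  X.V.symm.toContinuousLinearEquiv.differentiable.comp (differentiable_gaussL2 ha c)

lemma Parametrization.U_gaussVec (t : ℝ) (w : ℂ) (c : EuclideanSpace ℂ ι) :
    X.U t (X.gaussVec ha w c) = X.gaussVec ha (w + 2 * Real.pi * t) c := by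
  refine X.V.injective (L2_ext ?_)
  filter_upwards [X.modularGroup t (X.gaussVec ha w c),
    X.gaussVec_ae ha (w + 2 * Real.pi * t) c,
    (measurePreserving_sub_right (volume : Measure ℝ)
      (2 * Real.pi * t)).quasiMeasurePreserving.ae (X.gaussVec_ae ha w c)] with q h1 h2 h3 α
  rw [h1, h2, h3]
  simp only [gauss]
  congr 2
  push_cast
  ring

lemma conj_gauss (a : ℝ) (w : ℂ) (q : ℝ) : conj (gauss a w q) = gauss a (conj w) q := by
  simp [gauss, ← Complex.exp_conj]

lemma Parametrization.J_gaussVec (w : ℂ) (c : EuclideanSpace ℂ ι) :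
    X.J (X.gaussVec ha w c) = X.gaussVec ha (conj w) (X.conjVec c) := by
  refine X.V.injective (L2_ext ?_)
  filter_upwards [X.conjugation (X.gaussVec ha w c), X.gaussVec_ae ha (conj w) (X.conjVec c),
    X.gaussVec_ae ha w c] with q h1 h2 h3 α
  rw [h1, h2, h3, map_mul, conj_gauss]
  rfl

/-- `H` is the fixed point set of its Tomita operator, since `f + ig = f - ig` forces `g = 0`. -/
lemma Parametrization.mem_tomitaGraph {x : 𝓗} :
    (x, x) ∈ tomitaGraph P.H ↔ x ∈ P.H.toClosedSubmodule := by
  constructor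
  · rintro ⟨f, hf, g, hg, h⟩
    obtain ⟨h1, h2⟩ := Prod.mk.inj h
    have h3 : (2 * Complex.I) • g = 0 := by
      have : f + Complex.I • g = f - Complex.I • g := h1.symm.trans h2
      rw [mul_smul, two_smul]
      have h4 := sub_eq_zero.2 this
      rw [← h4]
      abel
    have h4 : g = 0 := by simpa using h3
    rw [h1, h4]
    simpa using hf
  · intro hx
    exact ⟨x, hx, 0, zero_mem _, by simp⟩

variable {c : EuclideanSpace ℂ ι}

/-- The modular orbit moves the center by `2πt`. Continued to `t = -i/2` it takes `iπ/2` to `-iπ/2`,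
and `J` reflects the center back while fixing `c`. The vector is thus fixed by `S_H = J Δ^{1/2}`. -/
lemma Parametrization.gaussVec_mem (hc : X.conjVec c = c) :
    X.gaussVec ha (Real.pi / 2 * Complex.I) c ∈ P.H.toClosedSubmodule := by
  rw [← Parametrization.mem_tomitaGraph, X.isModular.polar]
  have hd : Differentiable ℂ fun z : ℂ =>
      X.gaussVec ha (Real.pi / 2 * Complex.I + 2 * Real.pi * z) c :=
    (X.differentiable_gaussVec ha c).comp (by fun_prop)
  refine ⟨X.gaussVec ha (-(Real.pi / 2 * Complex.I)) c,
    ⟨_, hd.continuous.continuousOn, hd.differentiableOn, fun t => ?_, ?_⟩, ?_⟩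
  · exact (X.U_gaussVec ha t _ c).symm
  · simp only
    congr 1
    ring
  · simp only
    rw [X.J_gaussVec, hc]
    congr 1
    simp [Complex.conj_ofNat]

/-- For `y` in `H`, pair the continued orbit of the Gaussian `x`, at `conj z`, with that of `y`, at
`z`. The result is analytic in the strip and constant on the real edge by unitarity, hence constant.
At `z = -i/2` it equals `⟪J x, J y⟫ = ⟪y, x⟫`, so `⟪x, y⟫` is real. -/
lemma Parametrization.gaussVec_mem_symplComp (hc : X.conjVec c = c) :
    X.gaussVec ha (-(Real.pi / 2 * Complex.I)) c ∈ P.H.symplComp.toClosedSubmodule := by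
  change _ ∈ P.H.toClosedSubmodule.symplComp
  rw [ClosedSubmodule.mem_symplComp_iff]
  intro y hy
  rw [← Parametrization.mem_tomitaGraph, X.isModular.polar] at hy
  obtain ⟨y', ⟨F, hFc, hFd, hF, hF'⟩, hJ⟩ := hy
  simp only at hF hF' hJ
  set x := X.gaussVec ha (-(Real.pi / 2 * Complex.I)) c with hx
  set e : ℂ → 𝓗 := fun w => X.gaussVec ha (-(Real.pi / 2 * Complex.I) + 2 * Real.pi * w) c with he
  have hed : Differentiable ℂ e := (X.differentiable_gaussVec ha c).comp (by fun_prop)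
  have key := eq_zero_of_edge (g := fun z => ⟪e (conj z), F z⟫_ℂ - ⟪x, y⟫_ℂ) ?_ ?_ ?_
    (z := -(Complex.I / 2)) (by norm_num)
  · have h1 : e (conj (-(Complex.I / 2))) = X.J x := by
      rw [hx, X.J_gaussVec, hc]
      simp only [he]
      congr 1
      simp [Complex.conj_ofNat]
      ring
    have h2 : y' = X.J y := by rw [hJ, X.isModular.involutive]
    rw [h1, hF', h2, inner_antiunitary, sub_eq_zero] at key
    have h3 := congrArg Complex.im key
    rw [← inner_conj_symm x y, Complex.conj_im] at h3
    linarith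
  · refine ContinuousOn.sub (ContinuousOn.inner (𝕜 := ℂ) ?_ hFc) continuousOn_const
    exact (hed.continuous.comp Complex.continuous_conj).continuousOn
  · intro z hz
    have hopen : IsOpen {z : ℂ | -(1 / 2) < z.im ∧ z.im < 0} :=
      (isOpen_lt continuous_const Complex.continuous_im).inter
        (isOpen_lt Complex.continuous_im continuous_const)
    have := differentiableAt_inner_conj hed ((hFd z hz).differentiableAt (hopen.mem_nhds hz))
    exact (this.sub_const _).differentiableWithinAt
  · intro t
    have h1 : e (conj (t : ℂ)) = X.U t x := by
      rw [hx, X.U_gaussVec, Complex.conj_ofReal]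
    rw [h1, hF, sub_eq_zero]
    exact ContinuousLinearMap.inner_map_map_of_mem_unitary (X.isModular.unitaryGroup.unitary t) x y

end GaussVectors

end LRScattering

end

noncomputable section

namespace LRScattering

/-! ### Crossing pairs from integrated Gaussian identities -/

section Crossing

lemma conj_gaussConv (a : ℝ) (y : ℝ → ℂ) (z : ℂ) :
    conj (gaussConv a y z) = gaussConv a (fun q => conj (y q)) (conj z) := by
  rw [gaussConv, gaussConv, ← integral_conj]
  simp only [map_mul, conj_gauss]

lemma integral_gauss_mul_comp_add (a : ℝ) (m : ℝ → ℂ) (w : ℂ) (x : ℝ) :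
    ∫ q, gauss a w q * m (q + x) = gaussConv a m (x + w) := by
  rw [gaussConv, ← integral_add_right_eq_self (fun q => gauss a (x + w) q * m q) x]
  refine integral_congr_ae (.of_forall fun q => ?_)
  simp only [gauss]
  congr 3
  push_cast
  ring

lemma integrable_gauss_mul_comp_add {a : ℝ} (ha : 0 < a) (w : ℂ) {m : ℝ → ℂ} (hm : Measurable m)
    {C : ℝ} (hC : ∀ q, ‖m q‖ ≤ C) {E : Set ℝ} (hE : MeasurableSet E) (hE' : volume E < ⊤) :
    Integrable fun q : ℝ × ℝ => gauss a w q.1 * E.indicator 1 q.2 * m (q.1 + q.2) := by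
  have h1 : Integrable (E.indicator (1 : ℝ → ℂ)) :=
    (integrable_indicator_iff hE).2 (integrableOn_const hE'.ne)
  refine ((integrable_gauss ha w).mul_prod h1).mul_bdd (c := C) ?_ (.of_forall fun q => hC _)
  exact (hm.comp (measurable_fst.add measurable_snd)).aestronglyMeasurable

lemma integral_gauss_mul_comp_add_prod {a : ℝ} (ha : 0 < a) (w : ℂ) {m : ℝ → ℂ}
    (hm : Measurable m) {C : ℝ} (hC : ∀ q, ‖m q‖ ≤ C) {E : Set ℝ} (hE : MeasurableSet E)
    (hE' : volume E < ⊤) :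
    ∫ q : ℝ × ℝ, gauss a w q.1 * E.indicator 1 q.2 * m (q.1 + q.2) =
      ∫ x in E, gaussConv a m (x + w) := by
  rw [Measure.volume_eq_prod, integral_prod_symm _
    (integrable_gauss_mul_comp_add ha w hm hC hE hE'), ← integral_indicator hE]
  refine integral_congr_ae (.of_forall fun x => ?_)
  by_cases hx : x ∈ E
  · simp [hx, integral_gauss_mul_comp_add]
  · simp [hx]

/-- Locality only controls the relation smeared in the second variable. Smearing with indicators of
all sets of finite measure still determines the integrand almost everywhere. -/
lemma crossingPair_of_setIntegral {m n : ℝ → ℂ} (hm : Measurable m) (hn : Measurable n) {C : ℝ}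
    (hmC : ∀ q, ‖m q‖ ≤ C) (hnC : ∀ q, ‖n q‖ ≤ C)
    (h : ∀ a > 0, ∀ E : Set ℝ, MeasurableSet E → volume E < ⊤ →
      ∫ x in E, gaussConv a m (x + Real.pi / 2 * Complex.I) =
        ∫ x in E, gaussConv a n (x + -(Real.pi / 2 * Complex.I))) :
    CrossingPair m n := by
  have Hm := GaussIntegrable.of_bounded hm.aestronglyMeasurable hmC
  have Hn := GaussIntegrable.of_bounded hn.aestronglyMeasurable hnC
  refine crossingPair_of_ae Hm Hn fun a ha => ?_
  have cm (w : ℂ) : Continuous fun x : ℝ => gaussConv a m (x + w) :=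
    (Hm.differentiable ha).continuous.comp (by fun_prop)
  have cn (w : ℂ) : Continuous fun x : ℝ => gaussConv a n (x + w) :=
    (Hn.differentiable ha).continuous.comp (by fun_prop)
  have bound {y : ℝ → ℂ} (hy : ∀ q, ‖y q‖ ≤ C) (w : ℂ) :
      ∃ D, ∀ x : ℝ, ‖gaussConv a y (x + w)‖ ≤ D := by
    refine ⟨C * Real.exp (a * w.im ^ 2) * √(Real.pi / a), fun x => ?_⟩
    simpa using norm_gaussConv_le hy ha (x + w)
  have hint {y : ℝ → ℂ} {w : ℂ} (hc : Continuous fun x : ℝ => gaussConv a y (x + w))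
      (hy : ∀ q, ‖y q‖ ≤ C) {E : Set ℝ} (hE : volume E < ⊤) :
      IntegrableOn (fun x : ℝ => gaussConv a y (x + w)) E := by
    obtain ⟨D, hD⟩ := bound hy w
    exact IntegrableOn.of_bound hE hc.aestronglyMeasurable D (.of_forall hD)
  have := ae_eq_of_forall_setIntegral_eq_of_sigmaFinite
    (fun E _ hE => hint (cm (Real.pi / 2 * Complex.I)) hmC hE)
    (fun E _ hE => hint (cn (-(Real.pi / 2 * Complex.I))) hnC hE) (h a ha)
  filter_upwards [this] with x hx
  rw [hx, sub_eq_add_neg]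

end Crossing

/-! ### Left locality implies the first crossing relation -/

section Locality

variable {𝓗₁ 𝓗₂ : Type*}
  [NormedAddCommGroup 𝓗₁] [InnerProductSpace ℂ 𝓗₁] [CompleteSpace 𝓗₁]
  [NormedAddCommGroup 𝓗₂] [InnerProductSpace ℂ 𝓗₂] [CompleteSpace 𝓗₂]
  {P₁ : StandardPair 𝓗₁} {P₂ : StandardPair 𝓗₂} {ι κ : Type*} [Fintype ι] [Fintype κ]

/-- The vectors fixed by the conjugation span `ℂⁿ` over `ℂ`: with `c̄` the conjugate of `c`, both `c
+ c̄` and `i(c - c̄)` are fixed. -/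
lemma Parametrization.eq_zero_of_conjVec (X : Parametrization P₁ ι)
    (L : EuclideanSpace ℂ ι →ₗ[ℂ] ℂ) (h : ∀ c, X.conjVec c = c → L c = 0)
    (c : EuclideanSpace ℂ ι) : L c = 0 := by
  have h1 := h (c + X.conjVec c) <| by
    ext α; simp [Parametrization.conjVec, X.bar_bar, add_comm]
  have h2 := h (Complex.I • (c - X.conjVec c)) <| by
    ext α; simp [Parametrization.conjVec, X.bar_bar]; ring
  rw [map_add] at h1
  rw [map_smul, smul_eq_zero, map_sub] at h2
  have h3 := h2.resolve_left Complex.I_ne_zero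
  linear_combination (h1 + h3) / 2

lemma Parametrization.eq_zero_of_sesquilinear [DecidableEq ι] (X : Parametrization P₁ ι)
    (D : ι → ι → ℂ)
    (h : ∀ c d, X.conjVec c = c → X.conjVec d = d → ∑ α, ∑ γ, conj (d α) * c γ * D α γ = 0)
    (α γ : ι) : D α γ = 0 := by
  have h1 (d) (hd : X.conjVec d = d) (c : EuclideanSpace ℂ ι) :
      ∑ α, ∑ γ, conj (d α) * c γ * D α γ = 0 := by
    let L : EuclideanSpace ℂ ι →ₗ[ℂ] ℂ :=
      { toFun := fun c => ∑ α, ∑ γ, conj (d α) * c γ * D α γ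
        map_add' := fun c c' => by
          simp only [PiLp.add_apply, mul_add, add_mul, Finset.sum_add_distrib]
        map_smul' := fun t c => by
          simp only [PiLp.smul_apply, smul_eq_mul, RingHom.id_apply, Finset.mul_sum]
          refine Finset.sum_congr rfl fun _ _ => Finset.sum_congr rfl fun _ _ => ?_
          ring }
    exact X.eq_zero_of_conjVec L (fun c hc => h c d hc hd) c
  -- The form is conjugate linear in `d`, so its complex conjugate is used to get a linear
  -- functional.
  let L : EuclideanSpace ℂ ι →ₗ[ℂ] ℂ :=
    { toFun := fun d => ∑ α, d α * conj (D α γ)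
      map_add' := fun d d' => by
        simp only [PiLp.add_apply, add_mul, Finset.sum_add_distrib]
      map_smul' := fun t d => by
        simp only [PiLp.smul_apply, smul_eq_mul, RingHom.id_apply, Finset.mul_sum, mul_assoc] }
  have h2 := X.eq_zero_of_conjVec L (fun d hd => ?_) (EuclideanSpace.single α 1)
  · simpa [L, PiLp.single_apply] using h2
  · have h3 := congrArg conj (h1 d hd (EuclideanSpace.single γ 1))
    simpa [L, PiLp.single_apply] using h3

variable [DecidableEq κ] (X₁ : Parametrization P₁ ι) (X₂ : Parametrization P₂ κ)
  {S : HTensor 𝓗₁ 𝓗₂ →L[ℂ] HTensor 𝓗₁ 𝓗₂} {M : ℝ → Matrix (ι × κ) (ι × κ) ℂ}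

/-- The left vector has center `conj w`, so conjugation inside the inner product brings it to `w`
and the two Gaussians multiply to a single one with parameter `2a`. The indicators fix the second
indices and restrict the second variable to `E`. -/
lemma inner_gaussVec_indL2 (hM : ∀ a b, Measurable fun q => M q a b) {C : ℝ}
    (hC : ∀ q a b, ‖M q a b‖ ≤ C)
    (hS : ∀ Φ, ∀ᵐ q : ℝ × ℝ, ∀ a,
      pairL2 X₁ X₂ (S Φ) q a = ∑ b, M (q.1 + q.2) a b * pairL2 X₁ X₂ Φ q b)
    {a : ℝ} (ha : 0 < a) (w : ℂ) (c d : EuclideanSpace ℂ ι) {E : Set ℝ} (hE : MeasurableSet E)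
    (hE' : volume E < ⊤) (β δ : κ) :
    ⟪tpure (X₁.gaussVec ha (conj w) d) (X₂.V.symm (indL2 hE hE' β)),
        S (tpure (X₁.gaussVec ha w c) (X₂.V.symm (indL2 hE hE' δ)))⟫_ℂ =
      ∑ α, ∑ γ, conj (d α) * c γ *
        ∫ x in E, gaussConv (2 * a) (fun q => M q (α, β) (γ, δ)) (x + w) := by
  have ha2 : 0 < 2 * a := by positivity
  have hint (α γ : ι) : Integrable fun q : ℝ × ℝ => conj (d α) * c γ *
      (gauss (2 * a) w q.1 * E.indicator 1 q.2 * M (q.1 + q.2) (α, β) (γ, δ)) :=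
    (integrable_gauss_mul_comp_add ha2 w (hM (α, β) (γ, δ))
      (fun q => hC q _ _) hE hE').const_mul _
  have key : ⟪tpure (X₁.gaussVec ha (conj w) d) (X₂.V.symm (indL2 hE hE' β)),
        S (tpure (X₁.gaussVec ha w c) (X₂.V.symm (indL2 hE hE' δ)))⟫_ℂ =
      ∫ q : ℝ × ℝ, ∑ α, ∑ γ, conj (d α) * c γ *
        (gauss (2 * a) w q.1 * E.indicator 1 q.2 * M (q.1 + q.2) (α, β) (γ, δ)) := by
    rw [← (pairL2 X₁ X₂).inner_map_map, L2.inner_def]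
    refine integral_congr_ae ?_
    filter_upwards [hS (tpure (X₁.gaussVec ha w c) (X₂.V.symm (indL2 hE hE' δ))),
      tensorL2_tpure_ae X₁.V X₂.V (X₁.gaussVec ha w c) (X₂.V.symm (indL2 hE hE' δ)),
      tensorL2_tpure_ae X₁.V X₂.V (X₁.gaussVec ha (conj w) d) (X₂.V.symm (indL2 hE hE' β)),
      ae_fst (Y := ℝ) (X₁.gaussVec_ae ha w c), ae_fst (Y := ℝ) (X₁.gaussVec_ae ha (conj w) d),
      ae_snd (X := ℝ) (indL2_ae hE hE' δ), ae_snd (X := ℝ) (indL2_ae hE hE' β)]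
      with q h1 h2 h3 h4 h5 h6 h7
    have h8 : gauss (2 * a) w q.1 = gauss a w q.1 * gauss a w q.1 := by
      rw [gauss, gauss, ← Complex.exp_add]
      congr 1
      push_cast
      ring
    simp only [PiLp.inner_apply, RCLike.inner_apply, h1, h2, h3, h4, h5, h6, h7,
      LinearIsometryEquiv.apply_symm_apply, map_mul, conj_gauss, Complex.conj_conj,
      Fintype.sum_prod_type, h8]
    refine Finset.sum_congr rfl fun α _ => ?_
    by_cases hq : q.2 ∈ E
    · simp only [hq, Set.indicator_of_mem, Pi.one_apply, mul_ite, mul_one, mul_zero,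
        Finset.sum_ite_eq', Finset.mem_univ, if_true, apply_ite conj, map_one, map_zero,
        Finset.sum_mul]
      refine Finset.sum_congr rfl fun γ _ => ?_
      ring
    · simp [hq]
  rw [key, integral_finsetSum _ fun α _ => integrable_finsetSum _ fun γ _ => hint α γ]
  refine Finset.sum_congr rfl fun α _ => ?_
  rw [integral_finsetSum _ fun γ _ => hint α γ]
  refine Finset.sum_congr rfl fun γ _ => ?_
  rw [integral_const_mul, integral_gauss_mul_comp_add_prod ha2 w (hM (α, β) (γ, δ))
    (fun q => hC q _ _) hE hE']

/-- Locality is tested on a Gaussian of center `iπ/2` in `H` and one of center `-iπ/2` in `H'`. The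
conjugate on the right side reflects the center and exchanges the roles of `ξ` and `η`, hence of `β`
and `δ`. -/
lemma crossingPair_of_locality [DecidableEq ι] (hM : ∀ a b, Measurable fun q => M q a b) {C : ℝ}
    (hC : ∀ q a b, ‖M q a b‖ ≤ C)
    (hS : ∀ Φ, ∀ᵐ q : ℝ × ℝ, ∀ a,
      pairL2 X₁ X₂ (S Φ) q a = ∑ b, M (q.1 + q.2) a b * pairL2 X₁ X₂ Φ q b)
    (h : ∀ f ∈ P₁.H.toClosedSubmodule, ∀ g' ∈ P₁.H.symplComp.toClosedSubmodule, ∀ ξ η : 𝓗₂,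
      ⟪tpure g' η, S (tpure f ξ)⟫_ℂ = conj ⟪tpure g' ξ, S (tpure f η)⟫_ℂ) (α γ : ι) (β δ : κ) :
    CrossingPair (fun q => M q (α, β) (γ, δ))
      (fun q => conj (M q (X₁.bar α, δ) (X₁.bar γ, β))) := by
  have hconj {y : ℝ → ℂ} (hy : Measurable y) : Measurable fun q => conj (y q) :=
    Complex.continuous_conj.measurable.comp hy
  refine crossingPair_of_setIntegral (hM _ _) (hconj (hM _ _)) (C := C) (fun q => hC _ _ _)
    (fun q => (RCLike.norm_conj _).trans_le (hC _ _ _)) fun a ha E hE hE' => ?_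
  -- The product of two Gaussians of parameter `b` has parameter `2b`.
  obtain ⟨b, hb, rfl⟩ : ∃ b : ℝ, 0 < b ∧ a = 2 * b := ⟨a / 2, by positivity, by ring⟩
  have hw : conj ((Real.pi / 2 : ℂ) * Complex.I) = -(Real.pi / 2 * Complex.I) := by
    simp [Complex.conj_ofNat]
  have key := X₁.eq_zero_of_sesquilinear (fun α γ =>
    (∫ x in E, gaussConv (2 * b) (fun q => M q (α, β) (γ, δ)) (x + Real.pi / 2 * Complex.I)) -
    ∫ x in E, gaussConv (2 * b) (fun q => conj (M q (X₁.bar α, δ) (X₁.bar γ, β)))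
      (x + -(Real.pi / 2 * Complex.I))) (fun c d hc hd => ?_) α γ
  · exact sub_eq_zero.1 key
  · have h1 := h _ (X₁.gaussVec_mem hb hc) _ (X₁.gaussVec_mem_symplComp hb hd)
      (X₂.V.symm (indL2 hE hE' δ)) (X₂.V.symm (indL2 hE hE' β))
    rw [← hw, inner_gaussVec_indL2 X₁ X₂ hM hC hS, inner_gaussVec_indL2 X₁ X₂ hM hC hS] at h1
    simp only [map_sum, map_mul, Complex.conj_conj, ← integral_conj, conj_gaussConv, map_add,
      Complex.conj_ofReal] at h1
    have hd' (α : ι) : starRingEnd ℂ (d (X₁.bar α)) = d α := congrFun (congrArg WithLp.ofLp hd) α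
    have hc' (γ : ι) : c (X₁.bar γ) = starRingEnd ℂ (c γ) := by
      rw [← congrFun (congrArg WithLp.ofLp hc) γ]
      simp [Parametrization.conjVec]
    simp only [mul_sub, Finset.sum_sub_distrib, h1, sub_eq_zero]
    -- For vectors fixed by the conjugation, passing to the index `ᾱ` conjugates the component.
    -- Reindexing therefore restores the coefficients of the left side and leaves the bars on the
    -- matrix entries.
    let e := Function.Involutive.toPerm X₁.bar X₁.bar_bar
    refine Fintype.sum_equiv e _ _ fun α => Fintype.sum_equiv e _ _ fun γ => ?_
    have he (α : ι) : e α = X₁.bar α := rfl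
    rw [he, he, hd', hc', X₁.bar_bar, X₁.bar_bar, ← map_mul, hw]

end Locality

/-! ### Right locality implies the second crossing relation -/

section RightLocality

variable {𝓗₁ 𝓗₂ : Type*}
  [NormedAddCommGroup 𝓗₁] [InnerProductSpace ℂ 𝓗₁] [CompleteSpace 𝓗₁]
  [NormedAddCommGroup 𝓗₂] [InnerProductSpace ℂ 𝓗₂] [CompleteSpace 𝓗₂]
  {P₁ : StandardPair 𝓗₁} {P₂ : StandardPair 𝓗₂} {ι κ : Type*} [Fintype ι] [Fintype κ]
  [DecidableEq ι] [DecidableEq κ] (X₁ : Parametrization P₁ ι) (X₂ : Parametrization P₂ κ)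
  {S : HTensor 𝓗₁ 𝓗₂ →L[ℂ] HTensor 𝓗₁ 𝓗₂} {M : ℝ → Matrix (ι × κ) (ι × κ) ℂ}

/-- Conjugation by the flip turns right locality into left locality. The symbol only has its index
pairs swapped, because `q₁ + q₂` is symmetric. -/
lemma crossingPair_of_locality_right (hM : ∀ a b, Measurable fun q => M q a b) {C : ℝ}
    (hC : ∀ q a b, ‖M q a b‖ ≤ C)
    (hS : ∀ Φ, ∀ᵐ q : ℝ × ℝ, ∀ a,
      pairL2 X₁ X₂ (S Φ) q a = ∑ b, M (q.1 + q.2) a b * pairL2 X₁ X₂ Φ q b)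
    (h : ∀ f ∈ P₂.H.toClosedSubmodule, ∀ g' ∈ P₂.H.symplComp.toClosedSubmodule, ∀ ξ η : 𝓗₁,
      ⟪tpure η g', S (tpure ξ f)⟫_ℂ = conj ⟪tpure ξ g', S (tpure η f)⟫_ℂ) (α γ : ι) (β δ : κ) :
    CrossingPair (fun q => M q (α, β) (γ, δ))
      (fun q => conj (M q (γ, X₂.bar β) (α, X₂.bar δ))) := by
  let S' : HTensor 𝓗₂ 𝓗₁ →L[ℂ] HTensor 𝓗₂ 𝓗₁ :=
    (flipH 𝓗₁ 𝓗₂ : HTensor 𝓗₁ 𝓗₂ →L[ℂ] HTensor 𝓗₂ 𝓗₁) ∘L S ∘L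
      (flipH 𝓗₂ 𝓗₁ : HTensor 𝓗₂ 𝓗₁ →L[ℂ] HTensor 𝓗₁ 𝓗₂)
  have hinner (x y : 𝓗₂) (ξ η : 𝓗₁) :
      ⟪tpure x η, S' (tpure y ξ)⟫_ℂ = ⟪tpure η x, S (tpure ξ y)⟫_ℂ := by
    rw [← (flipH 𝓗₁ 𝓗₂).inner_map_map (tpure η x), flipH_tpure]
    simp [S']
  refine crossingPair_of_locality X₂ X₁ (S := S')
    (M := fun q a b => M q a.swap b.swap) (fun a b => hM _ _) (fun q a b => hC _ _ _)
    (fun Φ => ?_) (fun f hf g' hg' ξ η => ?_) β δ α γ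
  · filter_upwards [flipH_ae X₁.V X₂.V (S (flipH 𝓗₂ 𝓗₁ Φ)), flipH_ae X₂.V X₁.V Φ,
      Measure.measurePreserving_swap.quasiMeasurePreserving.ae (hS (flipH 𝓗₂ 𝓗₁ Φ)),
      Measure.measurePreserving_swap.quasiMeasurePreserving.ae (flipH_ae X₂.V X₁.V Φ)]
      with q h1 h2 h3 h4 a
    refine (h1 a).trans ((h3 a.swap).trans ?_)
    rw [← (Equiv.prodComm κ ι).sum_comp]
    refine Finset.sum_congr rfl fun b _ => ?_
    have h5 := h4 b.swap
    simp only [Prod.fst_swap, Prod.snd_swap] at h5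
    simp only [Prod.fst_swap, Prod.snd_swap, Equiv.prodComm_apply, add_comm q.2 q.1]
    exact congrArg _ h5
  · rw [hinner, hinner, h f hf g' hg']

end RightLocality

end LRScattering

end

noncomputable section

namespace LRScattering

/-! ### Yang–Baxter equations in terms of matrix symbols -/

section YangBaxter

variable {ι κ μ : Type*} [Fintype ι] [Fintype κ] [Fintype μ]
  [DecidableEq ι] [DecidableEq κ] [DecidableEq μ]

/-- The matrix `m₁₂` on a threefold index set. -/
def legMat12 (μ : Type*) [DecidableEq μ] (m : Matrix (ι × κ) (ι × κ) ℂ) :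
    Matrix ((ι × κ) × μ) ((ι × κ) × μ) ℂ :=
  fun a b => if a.2 = b.2 then m a.1 b.1 else 0

/-- The matrix `m₁₃` on a threefold index set. -/
def legMat13 (κ : Type*) [DecidableEq κ] (m : Matrix (ι × μ) (ι × μ) ℂ) :
    Matrix ((ι × κ) × μ) ((ι × κ) × μ) ℂ :=
  fun a b => if a.1.2 = b.1.2 then m (a.1.1, a.2) (b.1.1, b.2) else 0

/-- The matrix `m₂₃` on a threefold index set. -/
def legMat23 (ι : Type*) [DecidableEq ι] (m : Matrix (κ × μ) (κ × μ) ℂ) :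
    Matrix ((ι × κ) × μ) ((ι × κ) × μ) ℂ :=
  fun a b => if a.1.1 = b.1.1 then m (a.1.2, a.2) (b.1.2, b.2) else 0

lemma legMat12_mulVec (m : Matrix (ι × κ) (ι × κ) ℂ) (v : (ι × κ) × μ → ℂ) (a : (ι × κ) × μ) :
    (legMat12 μ m).mulVec v a = ∑ b, m a.1 b * v (b, a.2) := by
  simp [legMat12, Matrix.mulVec, dotProduct, Fintype.sum_prod_type]

lemma legMat13_mulVec (m : Matrix (ι × μ) (ι × μ) ℂ) (v : (ι × κ) × μ → ℂ) (a : (ι × κ) × μ) :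
    (legMat13 κ m).mulVec v a = ∑ b, m (a.1.1, a.2) b * v ((b.1, a.1.2), b.2) := by
  simp only [legMat13, Matrix.mulVec, dotProduct, Fintype.sum_prod_type, ite_mul, zero_mul]
  refine Finset.sum_congr rfl fun x _ => ?_
  rw [Finset.sum_comm]
  simp

lemma legMat23_mulVec (m : Matrix (κ × μ) (κ × μ) ℂ) (v : (ι × κ) × μ → ℂ) (a : (ι × κ) × μ) :
    (legMat23 ι m).mulVec v a = ∑ b, m (a.1.2, a.2) b * v ((a.1.1, b.1), b.2) := by
  simp only [legMat23, Matrix.mulVec, dotProduct, Fintype.sum_prod_type, ite_mul, zero_mul]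
  rw [Finset.sum_eq_single a.1.1 (fun x _ hx => by simp [hx.symm]) (by simp)]
  simp

/-- Column `e` is the image of a basis vector, so the three factors are applied to it in turn and
the Kronecker deltas leave only three sums. -/
lemma legMat_mul_apply (A : Matrix (ι × κ) (ι × κ) ℂ) (B : Matrix (ι × μ) (ι × μ) ℂ)
    (C : Matrix (κ × μ) (κ × μ) ℂ) (a e : (ι × κ) × μ) :
    (legMat12 μ A * (legMat13 κ B * legMat23 ι C)) a e = ∑ α, ∑ β, ∑ γ,
      A a.1 (α, β) * B (α, a.2) (e.1.1, γ) * C (β, γ) (e.1.2, e.2) := by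
  have h := congrFun (Matrix.mulVec_single_one (legMat12 μ A * (legMat13 κ B * legMat23 ι C)) e) a
  rw [Matrix.col_apply] at h
  rw [← h, ← Matrix.mulVec_mulVec, ← Matrix.mulVec_mulVec, legMat12_mulVec]
  simp only [legMat13_mulVec, legMat23_mulVec, Fintype.sum_prod_type, Pi.single_apply,
    Prod.ext_iff, mul_ite, mul_one, mul_zero]
  refine Finset.sum_congr rfl fun α _ => Finset.sum_congr rfl fun β _ => ?_
  rw [Finset.sum_eq_single e.1.1 (fun x _ hx => by simp [hx]) (by simp), Finset.mul_sum]
  refine Finset.sum_congr rfl fun γ _ => ?_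
  rw [Finset.sum_eq_single e.1.2 (fun x _ hx => by simp [hx]) (by simp)]
  simp [mul_assoc]

lemma legMat_mul_apply' (A : Matrix (ι × κ) (ι × κ) ℂ) (B : Matrix (ι × μ) (ι × μ) ℂ)
    (C : Matrix (κ × μ) (κ × μ) ℂ) (a e : (ι × κ) × μ) :
    (legMat23 ι C * (legMat13 κ B * legMat12 μ A)) a e = ∑ α, ∑ β, ∑ γ,
      C (a.1.2, a.2) (β, γ) * B (a.1.1, γ) (α, e.2) * A (α, β) e.1 := by
  have h := congrFun (Matrix.mulVec_single_one (legMat23 ι C * (legMat13 κ B * legMat12 μ A)) e) a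
  rw [Matrix.col_apply] at h
  rw [← h, ← Matrix.mulVec_mulVec, ← Matrix.mulVec_mulVec, legMat23_mulVec]
  simp only [legMat13_mulVec, legMat12_mulVec, Fintype.sum_prod_type, Pi.single_apply,
    Prod.ext_iff, mul_ite, mul_one, mul_zero]
  rw [Finset.sum_comm]
  conv_rhs => rw [Finset.sum_comm_cycle]
  refine Finset.sum_congr rfl fun γ _ => ?_
  conv_rhs => rw [Finset.sum_comm]
  refine Finset.sum_congr rfl fun β _ => ?_
  rw [Finset.mul_sum]
  refine Finset.sum_congr rfl fun α _ => ?_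
  rw [Finset.sum_eq_single e.2 (fun x _ hx => by simp [hx]) (by simp),
    Finset.sum_eq_single e.1.1 (fun x _ hx => by simp [hx]) (by simp),
    Finset.sum_eq_single e.1.2 (fun x _ hx => by simp [hx]) (by simp)]
  simp [mul_assoc]

variable {E F G X Y Z : Type*}
  [NormedAddCommGroup E] [InnerProductSpace ℂ E] [NormedAddCommGroup F] [InnerProductSpace ℂ F]
  [NormedAddCommGroup G] [InnerProductSpace ℂ G]
  [MeasureSpace X] [MeasureSpace Y] [MeasureSpace Z]
  [SigmaFinite (volume : Measure X)] [SigmaFinite (volume : Measure Y)]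
  [SigmaFinite (volume : Measure Z)]

/-- The Yang-Baxter equation for operators given by matrix-valued functions. -/
lemma yangBaxter_ae (V₁ : E ≃ₗᵢ[ℂ] L2 X ι) (V₂ : F ≃ₗᵢ[ℂ] L2 Y κ) (V₃ : G ≃ₗᵢ[ℂ] L2 Z μ)
    {A : HTensor E F →L[ℂ] HTensor E F} {B : HTensor E G →L[ℂ] HTensor E G}
    {C : HTensor F G →L[ℂ] HTensor F G} {mA : X × Y → Matrix (ι × κ) (ι × κ) ℂ}
    {mB : X × Z → Matrix (ι × μ) (ι × μ) ℂ} {mC : Y × Z → Matrix (κ × μ) (κ × μ) ℂ}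
    (hA : ∀ Φ, ∀ᵐ q, ∀ a, tensorL2 V₁ V₂ (A Φ) q a = ∑ b, mA q a b * tensorL2 V₁ V₂ Φ q b)
    (hB : ∀ Φ, ∀ᵐ q, ∀ a, tensorL2 V₁ V₃ (B Φ) q a = ∑ b, mB q a b * tensorL2 V₁ V₃ Φ q b)
    (hC : ∀ Φ, ∀ᵐ q, ∀ a, tensorL2 V₂ V₃ (C Φ) q a = ∑ b, mC q a b * tensorL2 V₂ V₃ Φ q b)
    (h : leg12 G A * leg13 F B * leg23 E C = leg23 E C * leg13 F B * leg12 G A) :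
    ∀ᵐ q : (X × Y) × Z, ∀ α β γ α'' β'' γ'',
      ∑ α', ∑ β', ∑ γ', mA q.1 (α, β) (α', β') * mB (q.1.1, q.2) (α', γ) (α'', γ') *
          mC (q.1.2, q.2) (β', γ') (β'', γ'') =
        ∑ α', ∑ β', ∑ γ', mC (q.1.2, q.2) (β, γ) (β', γ') * mB (q.1.1, q.2) (α, γ') (α', γ'') *
          mA q.1 (α', β') (α'', β'') := by
  have key := matrix_ae_ext (tensorL2 (tensorL2 V₁ V₂) V₃)
    (m := fun q => legMat12 μ (mA q.1) * (legMat13 κ (mB (q.1.1, q.2)) *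
      legMat23 ι (mC (q.1.2, q.2))))
    (m' := fun q => legMat23 ι (mC (q.1.2, q.2)) * (legMat13 κ (mB (q.1.1, q.2)) *
      legMat12 μ (mA q.1))) fun Φ => ?_
  · filter_upwards [key] with q hq α β γ α'' β'' γ''
    have := congrFun (congrFun hq ((α, β), γ)) ((α'', β''), γ'')
    rwa [legMat_mul_apply, legMat_mul_apply'] at this
  · have h12 := leg12_ae V₁ V₂ V₃ hA
    have h13 := leg13_ae V₁ V₂ V₃ hB
    have h23 := leg23_ae V₁ V₂ V₃ hC
    have h1 := congrArg (fun T => T Φ) h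
    simp only [ContinuousLinearMap.mul_def, ContinuousLinearMap.comp_apply] at h1
    filter_upwards [h12 Φ, h23 Φ, h13 (leg12 G A Φ), h13 (leg23 E C Φ),
      h12 (leg13 F B (leg23 E C Φ)), h23 (leg13 F B (leg12 G A Φ))]
      with q e1 e2 e3 e4 e5 e6 a
    set v : (ι × κ) × μ → ℂ := fun b => tensorL2 (tensorL2 V₁ V₂) V₃ Φ q b with hv
    have e1' : (fun a => tensorL2 (tensorL2 V₁ V₂) V₃ (leg12 G A Φ) q a) =
        (legMat12 μ (mA q.1)).mulVec v :=
      funext fun a => (e1 a).trans (legMat12_mulVec _ _ _).symm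
    have e2' : (fun a => tensorL2 (tensorL2 V₁ V₂) V₃ (leg23 E C Φ) q a) =
        (legMat23 ι (mC (q.1.2, q.2))).mulVec v :=
      funext fun a => (e2 a).trans (legMat23_mulVec _ _ _).symm
    have e3' : (fun a => tensorL2 (tensorL2 V₁ V₂) V₃ (leg13 F B (leg12 G A Φ)) q a) =
        (legMat13 κ (mB (q.1.1, q.2))).mulVec ((legMat12 μ (mA q.1)).mulVec v) := by
      rw [← e1']; exact funext fun a => (e3 a).trans (legMat13_mulVec _ _ _).symm
    have e4' : (fun a => tensorL2 (tensorL2 V₁ V₂) V₃ (leg13 F B (leg23 E C Φ)) q a) =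
        (legMat13 κ (mB (q.1.1, q.2))).mulVec ((legMat23 ι (mC (q.1.2, q.2))).mulVec v) := by
      rw [← e2']; exact funext fun a => (e4 a).trans (legMat13_mulVec _ _ _).symm
    change (Matrix.mulVec _ v) a = (Matrix.mulVec _ v) a
    rw [← Matrix.mulVec_mulVec, ← Matrix.mulVec_mulVec, ← Matrix.mulVec_mulVec,
      ← Matrix.mulVec_mulVec, ← e3', ← e4', legMat12_mulVec, legMat23_mulVec, ← e5, ← e6, h1]

end YangBaxter

/-! ### Linear changes of variables for almost everywhere statements -/

section ChangeOfVariables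

lemma measurePreserving_sub_diag :
    MeasurePreserving (fun q : ℝ × (ℝ × ℝ) => (q.1, q.2 - (q.1, q.1))) volume volume :=
  (MeasurePreserving.id (volume : Measure ℝ)).skew_product (by fun_prop)
    (.of_forall fun t => (measurePreserving_sub_right (volume : Measure (ℝ × ℝ)) (t, t)).map_eq)

lemma ae_of_ae_snd {X Y : Type*} [MeasureSpace X] [MeasureSpace Y] [SFinite (volume : Measure X)]
    [SFinite (volume : Measure Y)] [NeZero (volume : Measure X)] {p : Y → Prop}
    (h : ∀ᵐ q : X × Y, p q.2) : ∀ᵐ y, p y := by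
  obtain ⟨x, hx⟩ := (Measure.ae_ae_of_ae_prod h).exists
  exact hx

/-- In the left Yang–Baxter identity the symbols depend only on `q₁ + q₃` and `q₂ + q₃`. A measure
preserving shear makes these the coordinates, and the remaining one is dropped by Fubini.
`ae_add_left` serves the right identity in the same way. -/
lemma ae_add_right {p : ℝ × ℝ → Prop}
    (h : ∀ᵐ q : (ℝ × ℝ) × ℝ, p (q.1.1 + q.2, q.1.2 + q.2)) : ∀ᵐ x, p x := by
  refine ae_of_ae_snd (X := ℝ) ?_
  filter_upwards [((Measure.measurePreserving_swap (μ := (volume : Measure ℝ))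
    (ν := (volume : Measure (ℝ × ℝ)))).comp
    measurePreserving_sub_diag).quasiMeasurePreserving.ae h] with q hq
  simpa using hq

lemma ae_add_left {p : ℝ × ℝ → Prop}
    (h : ∀ᵐ q : (ℝ × ℝ) × ℝ, p (q.1.1 + q.1.2, q.1.1 + q.2)) : ∀ᵐ x, p x := by
  refine ae_of_ae_snd (X := ℝ) ?_
  filter_upwards [((volume_preserving_prodAssoc (α₁ := ℝ) (β₁ := ℝ) (γ₁ := ℝ)).symm.comp
    measurePreserving_sub_diag).quasiMeasurePreserving.ae h] with q hq
  simpa [MeasurableEquiv.prodAssoc] using hq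

lemma ae_add_iff {p : ℝ → Prop} : (∀ᵐ q : ℝ × ℝ, p (q.1 + q.2)) ↔ ∀ᵐ x, p x := by
  constructor
  · intro h
    obtain ⟨x, hx⟩ := (Measure.ae_ae_of_ae_prod h).exists
    filter_upwards [(measurePreserving_sub_right (volume : Measure ℝ) x).quasiMeasurePreserving.ae
      hx] with y hy
    simpa using hy
  · intro h
    exact (measurePreserving_prod_add (volume : Measure ℝ)
      (volume : Measure ℝ)).quasiMeasurePreserving.ae (ae_snd (X := ℝ) h)

end ChangeOfVariables

/-! ### Versions with unitary values everywhere -/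

section Unitary

/-- A measurable function with values almost everywhere in the unitary group has a version with
values everywhere in the unitary group. -/
lemma exists_unitary_version {X ι : Type*} [MeasureSpace X] [Fintype ι] [DecidableEq ι]
    {M : X → Matrix ι ι ℂ} (hM : ∀ a b, Measurable fun q => M q a b)
    (h : ∀ᵐ q, (M q).conjTranspose * M q = 1) :
    ∃ M' : X → Matrix ι ι ℂ, (∀ a b, Measurable fun q => M' q a b) ∧
      (∀ q, M' q ∈ Matrix.unitaryGroup ι ℂ) ∧ ∀ᵐ q, M' q = M q := by
  classical
  have hs : MeasurableSet {q | (M q).conjTranspose * M q = 1} := by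
    have : {q | (M q).conjTranspose * M q = 1} =
        ⋂ a, ⋂ b, {q | ∑ c, conj (M q c a) * M q c b = (1 : Matrix ι ι ℂ) a b} := by
      ext q
      simp [← Matrix.ext_iff, Matrix.mul_apply]
    rw [this]
    refine .iInter fun a => .iInter fun b => measurableSet_eq_fun ?_ measurable_const
    exact Finset.measurable_sum _ fun c _ =>
      (Complex.continuous_conj.measurable.comp (hM c a)).mul (hM c b)
  -- The identity matrix is the default on the null set, so that entry bounds hold at every point
  -- and not only almost everywhere.
  refine ⟨fun q => if (M q).conjTranspose * M q = 1 then M q else 1, fun a b => ?_, fun q => ?_, ?_⟩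
  · simp only [apply_ite (fun m : Matrix ι ι ℂ => m a b)]
    exact Measurable.ite hs (hM a b) measurable_const
  · simp only
    split_ifs with hq
    · exact Matrix.mem_unitaryGroup_iff'.2 hq
    · exact one_mem _
  · filter_upwards [h] with q hq
    simp [hq]

end Unitary

end LRScattering

end

noncomputable section

namespace LRScattering

/-! ### Symbols of scattering operators -/

section Scattering

variable {𝓗₁ 𝓗₂ : Type*}
  [NormedAddCommGroup 𝓗₁] [InnerProductSpace ℂ 𝓗₁] [CompleteSpace 𝓗₁]
  [NormedAddCommGroup 𝓗₂] [InnerProductSpace ℂ 𝓗₂] [CompleteSpace 𝓗₂]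
  {P₁ : StandardPair 𝓗₁} {P₂ : StandardPair 𝓗₂}
  {ι κ : Type*} [Fintype ι] [DecidableEq ι] [Fintype κ] [DecidableEq κ]

lemma isMultiplication_of_ae (X₁ : Parametrization P₁ ι) (X₂ : Parametrization P₂ κ)
    {s : ℝ × ℝ → ℝ} {A : HTensor 𝓗₁ 𝓗₂ →L[ℂ] HTensor 𝓗₁ 𝓗₂}
    {M : ℝ → Matrix (ι × κ) (ι × κ) ℂ} (hM : ∀ a b, Measurable fun q => M q a b)
    (h : ∀ Φ, ∀ᵐ q : ℝ × ℝ, ∀ a,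
      pairL2 X₁ X₂ (A Φ) q a = ∑ b, M (s q) a b * pairL2 X₁ X₂ Φ q b) :
    IsMultiplication X₁ X₂ s A M := by
  refine ⟨hM, pairL2 X₁ X₂, fun x y => ?_, h⟩
  filter_upwards [tensorL2_tpure_ae X₁.V X₂.V x y] with q hq α β
  exact hq (α, β)

lemma IsScattering.exists_matrix {R : HTensor 𝓗₁ 𝓗₁ →L[ℂ] HTensor 𝓗₁ 𝓗₁}
    (hR : IsScattering P₁ R) (X : Parametrization P₁ ι) :
    ∃ A : ℝ → Matrix (ι × ι) (ι × ι) ℂ, (∀ a b, Measurable fun q => A q a b) ∧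
      ∀ Φ, ∀ᵐ q : ℝ × ℝ, ∀ a,
        pairL2 X X (R Φ) q a = ∑ b, A (q.1 - q.2) a b * pairL2 X X Φ q b := by
  obtain ⟨A, hA, h⟩ := exists_symbol_sum X X R hR.translation (ε := -1) (.inr rfl) fun t => by
    simpa using (hR.dilation X.J X.U X.isModular t).symm
  refine ⟨A, hA, fun Φ => ?_⟩
  filter_upwards [h Φ] with q hq
  simpa [sub_eq_add_neg] using hq

/-- A left-right scattering operator is the multiplication by a unitary matrix-valued function of
the sum of the two variables. -/
lemma IsLRScattering.exists_unitary_matrix {R₁ : HTensor 𝓗₁ 𝓗₁ →L[ℂ] HTensor 𝓗₁ 𝓗₁}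
    {R₂ : HTensor 𝓗₂ 𝓗₂ →L[ℂ] HTensor 𝓗₂ 𝓗₂} {S : HTensor 𝓗₁ 𝓗₂ →L[ℂ] HTensor 𝓗₁ 𝓗₂}
    (hS : IsLRScattering P₁ P₂ R₁ R₂ S) (X₁ : Parametrization P₁ ι) (X₂ : Parametrization P₂ κ) :
    ∃ M : ℝ → Matrix (ι × κ) (ι × κ) ℂ, (∀ a b, Measurable fun q => M q a b) ∧
      (∀ q, M q ∈ Matrix.unitaryGroup (ι × κ) ℂ) ∧
      ∀ Φ, ∀ᵐ q : ℝ × ℝ, ∀ a,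
        pairL2 X₁ X₂ (S Φ) q a = ∑ b, M (q.1 + q.2) a b * pairL2 X₁ X₂ Φ q b := by
  obtain ⟨M₀, hM₀, h₀⟩ := exists_symbol_sum X₁ X₂ S hS.translation (ε := 1) (.inl rfl) fun t => by
    simpa using hS.boost X₁.J X₁.U X₂.J X₂.U X₁.isModular X₂.isModular t
  have hU : ∀ᵐ q, (M₀ q).conjTranspose * M₀ q = 1 := by
    have := conjTranspose_mul_self_ae (pairL2 X₁ X₂) (A := S)
      (ContinuousLinearMap.inner_map_map_of_mem_unitary hS.unitary) h₀
    exact ae_add_iff.1 (by simpa using this)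
  obtain ⟨M, hM, hMU, hMM⟩ := exists_unitary_version hM₀ hU
  refine ⟨M, hM, hMU, fun Φ => ?_⟩
  filter_upwards [h₀ Φ, ae_add_iff.2 hMM] with q h1 h2
  rw [h2]
  simpa using h1

/-- Moving `S*` to the other side of the inner product writes locality as an equation between a
matrix element of `S` and the conjugate of another. -/
lemma IsLRScattering.crossingPair {R₁ : HTensor 𝓗₁ 𝓗₁ →L[ℂ] HTensor 𝓗₁ 𝓗₁}
    {R₂ : HTensor 𝓗₂ 𝓗₂ →L[ℂ] HTensor 𝓗₂ 𝓗₂} {S : HTensor 𝓗₁ 𝓗₂ →L[ℂ] HTensor 𝓗₁ 𝓗₂}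
    (hS : IsLRScattering P₁ P₂ R₁ R₂ S) (X₁ : Parametrization P₁ ι) (X₂ : Parametrization P₂ κ)
    {M : ℝ → Matrix (ι × κ) (ι × κ) ℂ} (hM : ∀ a b, Measurable fun q => M q a b)
    {C : ℝ} (hC : ∀ q a b, ‖M q a b‖ ≤ C)
    (h : ∀ Φ, ∀ᵐ q : ℝ × ℝ, ∀ a,
        pairL2 X₁ X₂ (S Φ) q a = ∑ b, M (q.1 + q.2) a b * pairL2 X₁ X₂ Φ q b)
    (α γ : ι) (β δ : κ) :
    CrossingPair (fun q => M q (α, β) (γ, δ))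
        (fun q => conj (M q (X₁.bar α, δ) (X₁.bar γ, β))) ∧
      CrossingPair (fun q => M q (α, β) (γ, δ))
        (fun q => conj (M q (γ, X₂.bar β) (α, X₂.bar δ))) := by
  constructor
  · refine crossingPair_of_locality X₁ X₂ hM hC h (fun f hf g' hg' ξ η => ?_) α γ β δ
    rw [hS.leftLocality f hf g' hg', ContinuousLinearMap.star_eq_adjoint,
      ContinuousLinearMap.adjoint_inner_right, inner_conj_symm]
  · refine crossingPair_of_locality_right X₁ X₂ hM hC h (fun f hf g' hg' ξ η => ?_) α γ β δ
    rw [hS.rightLocality f hf g' hg', ContinuousLinearMap.star_eq_adjoint,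
      ContinuousLinearMap.adjoint_inner_right, inner_conj_symm]

end Scattering

lemma isStripBoundaryValue_of_crossingPair {m : Type*} [Finite m] {M N : ℝ → Matrix m m ℂ} {C : ℝ}
    (h : ∀ a b, CrossingPair (fun q => M q a b) (fun q => N q a b))
    (hM : ∀ a b, Measurable fun q => M q a b) (hN : ∀ a b, Measurable fun q => N q a b)
    (hMC : ∀ q a b, ‖M q a b‖ ≤ C) (hNC : ∀ q a b, ‖N q a b‖ ≤ C) :
    IsStripBoundaryValue M N := by
  refine ⟨fun z a b => stripExtension (fun q => M q a b) (fun q => N q a b) z,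
    fun a b => (h a b).differentiableOn_stripExtension (hM a b) (hN a b) (fun q => hMC q a b)
      (fun q => hNC q a b),
    ⟨C, fun z hz a b => (h a b).norm_stripExtension_le (hM a b) (hN a b) (fun q => hMC q a b)
      (fun q => hNC q a b) hz⟩, ?_, ?_⟩
  · refine ae_all_iff.2 fun a => ae_all_iff.2 fun b => ?_
    exact ae_tendsto_stripExtension (hM a b) (fun q => hMC q a b) (fun q => hNC q a b)
  · refine ae_all_iff.2 fun a => ae_all_iff.2 fun b => ?_
    exact (h a b).ae_tendsto_stripExtension_top (hM a b) (hN a b) (fun q => hMC q a b)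
      (fun q => hNC q a b)

end LRScattering

end

theorem mainTheorem4
    {𝓗₁ 𝓗₂ : Type*}
    [NormedAddCommGroup 𝓗₁] [InnerProductSpace ℂ 𝓗₁] [CompleteSpace 𝓗₁]
    [NormedAddCommGroup 𝓗₂] [InnerProductSpace ℂ 𝓗₂] [CompleteSpace 𝓗₂]
    {ι κ : Type*} [Fintype ι] [DecidableEq ι] [Fintype κ] [DecidableEq κ]
    (P₁ : StandardPair 𝓗₁) (P₂ : StandardPair 𝓗₂)
    (X₁ : Parametrization P₁ ι) (X₂ : Parametrization P₂ κ)
    (R₁ : HTensor 𝓗₁ 𝓗₁ →L[ℂ] HTensor 𝓗₁ 𝓗₁) (R₂ : HTensor 𝓗₂ 𝓗₂ →L[ℂ] HTensor 𝓗₂ 𝓗₂)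
    (hR₁ : IsScattering P₁ R₁) (hR₂ : IsScattering P₂ R₂)
    (S : HTensor 𝓗₁ 𝓗₂ →L[ℂ] HTensor 𝓗₁ 𝓗₂)
    (hS : IsLRScattering P₁ P₂ R₁ R₂ S) :
    ∃ (A : ℝ → Matrix (ι × ι) (ι × ι) ℂ) (B : ℝ → Matrix (κ × κ) (κ × κ) ℂ)
      (M Mπ : ℝ → Matrix (ι × κ) (ι × κ) ℂ),
      -- `R⁺`, `R⁻` and `S` are given by the matrix-valued functions `A`, `B` and `M`
      IsMultiplication X₁ X₁ (fun q => q.1 - q.2) R₁ A ∧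
      IsMultiplication X₂ X₂ (fun q => q.1 - q.2) R₂ B ∧
      IsMultiplication X₁ X₂ (fun q => q.1 + q.2) S M ∧
      -- unitarity
      (∀ᵐ q : ℝ, M q ∈ Matrix.unitaryGroup (ι × κ) ℂ) ∧
      -- left mixed Yang-Baxter identity
      (∀ᵐ p : ℝ × ℝ, ∀ (α β : ι) (γ : κ) (α'' β'' : ι) (γ'' : κ),
        ∑ α' : ι, ∑ β' : ι, ∑ γ' : κ, A (p.1 - p.2) (α, β) (α', β') *
            M p.1 (α', γ) (α'', γ') * M p.2 (β', γ') (β'', γ'') =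
          ∑ α' : ι, ∑ β' : ι, ∑ γ' : κ, M p.2 (β, γ) (β', γ') *
            M p.1 (α, γ') (α', γ'') * A (p.1 - p.2) (α', β') (α'', β'')) ∧
      -- right mixed Yang-Baxter identity
      (∀ᵐ p : ℝ × ℝ, ∀ (α : ι) (β γ : κ) (α'' : ι) (β'' γ'' : κ),
        ∑ α' : ι, ∑ β' : κ, ∑ γ' : κ, M p.1 (α, β) (α', β') *
            M p.2 (α', γ) (α'', γ') * B (p.1 - p.2) (β', γ') (β'', γ'') =
          ∑ α' : ι, ∑ β' : κ, ∑ γ' : κ, B (p.1 - p.2) (β, γ) (β', γ') *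
            M p.2 (α, γ') (α', γ'') * M p.1 (α', β') (α'', β'')) ∧
      -- analyticity, with boundary value `Mπ q = M (q + iπ)` on the upper edge
      IsStripBoundaryValue M Mπ ∧
      -- mixed unitary-crossing relation
      (∀ᵐ q : ℝ, ∀ (α γ : ι) (β δ : κ),
        Mπ q (α, β) (γ, δ) = star (M q (X₁.bar α, δ) (X₁.bar γ, β)) ∧
        star (M q (X₁.bar α, δ) (X₁.bar γ, β)) = star (M q (γ, X₂.bar β) (α, X₂.bar δ))) := by
  obtain ⟨A, hA, hA'⟩ := hR₁.exists_matrix X₁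
  obtain ⟨B, hB, hB'⟩ := hR₂.exists_matrix X₂
  obtain ⟨M, hM, hMU, hM'⟩ := hS.exists_unitary_matrix X₁ X₂
  have hC (q : ℝ) (a b : ι × κ) : ‖M q a b‖ ≤ 1 := entry_norm_bound_of_unitary (hMU q) a b
  have hconj (a b : ι × κ) : Measurable fun q => star (M q a b) :=
    Complex.continuous_conj.measurable.comp (hM a b)
  have hconjC (q : ℝ) (a b : ι × κ) : ‖star (M q a b)‖ ≤ 1 := (norm_star _).trans_le (hC q a b)
  have hcross := hS.crossingPair X₁ X₂ hM hC hM'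
  -- The upper boundary value is defined by the first crossing formula. Its content then lies in the
  -- analyticity claim, and the second formula follows from uniqueness of the upper boundary value.
  refine ⟨A, B, M, fun q a b => star (M q (X₁.bar a.1, b.2) (X₁.bar b.1, a.2)),
    isMultiplication_of_ae X₁ X₁ hA hA', isMultiplication_of_ae X₂ X₂ hB hB',
    isMultiplication_of_ae X₁ X₂ hM hM', .of_forall hMU, ?_, ?_, ?_, ?_⟩
  · refine ae_add_right ?_
    filter_upwards [yangBaxter_ae X₁.V X₁.V X₂.V hA' hM' hM' hS.leftYangBaxter] with q hq
    -- With `p = (q₁ + q₃, q₂ + q₃)` the argument `q₁ - q₂` of the symbol of `R⁺` is the difference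
    -- of the coordinates of `p`.
    simpa only [add_sub_add_right_eq_sub] using hq
  · refine ae_add_left ?_
    filter_upwards [yangBaxter_ae X₁.V X₂.V X₂.V hM' hM' hB' hS.rightYangBaxter] with q hq
    simpa only [add_sub_add_left_eq_sub] using hq
  · exact isStripBoundaryValue_of_crossingPair (fun a b => (hcross a.1 b.1 a.2 b.2).1) hM
      (fun a b => hconj _ _) hC (fun q a b => hconjC _ _ _)
  · refine ae_all_iff.2 fun α => ae_all_iff.2 fun γ => ae_all_iff.2 fun β =>
      ae_all_iff.2 fun δ => ?_
    filter_upwards [(hcross α γ β δ).1.ae_unique (hcross α γ β δ).2 (hconj _ _) (hconj _ _)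
      (fun q => hconjC _ _ _) (fun q => hconjC _ _ _)] with q hq
    exact ⟨rfl, hq⟩
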